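/- Let $2<\gamma<3$, $\alpha=\frac{2\gamma-4}{3}$, $\beta=\frac{\gamma-1}{3}$; all functions are real valued. For functions on $\mathbb R^3$ put $\mathcal I f=|x|^{-\gamma}*f$. Resolution spaces. For $0\le\theta\le1$ a pair $(q,r)$ of exponents in $[2,\infty]$ is called admissible if $(q,r,\theta)\ne(2,\infty,0)$ and $\frac1q+\frac{2+\theta}{2r}\le\frac{2+\theta}{4}$. For $\mu\ge0$ and an interval $I\subseteq\mathbb R$, $X^\mu_\theta(I)$ is the set of all $v\in (C\cap L^\infty)(I;H^\mu(\mathbb R^3))$ such that $v\in L^q(I;B^\sigma_{r,2}(\mathbb R^3))$ for all admissible $(q,r)$, where $\sigma$ is given by $\frac1q=(3+\theta)\left(\frac12-\frac1r\right)+\sigma-\mu$, and $X^\mu(I)=\bigcap_{0\le\theta\le1}X^\mu_\theta(I)$. Here $B^\sigma_{r,2}$ is the inhomogeneous Besov space, with the norm $\big(\sum_{j\ge0}(2^{j\sigma}\|\Delta_jf\|_{L^r})^2\big)^{1/2}+\|S_0f\|_{L^r}$ of a Littlewood–Paley decomposition. Let $I$ be an interval that contains $0$ and some positive number (for instance $I=\mathbb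 R$), let $v\in X^\alpha(I)\cap X^\beta(I)$ and $(u_0,u_1)\in H^1(\mathbb R^3)\times L^2(\mathbb R^3)$. Then there is $T>0$ with $[0,T]\subseteq I$ such that the Cauchy problem $$\begin{cases}\partial_{tt}u-\Delta u+u+\mathcal I(u^2)u+2\mathcal I(uv)u+\mathcal I(v^2)u+\mathcal I(u^2)v+2\mathcal I(uv)v=0,\\ u|_{t=0}=u_0,\qquad \partial_tu|_{t=0}=u_1,\end{cases}$$ has exactly one solution $u\in C([0,T];H^1(\mathbb R^3))$ on $[0,T]$. Solutions are understood in the sense of distributions: the sum $N$ of the five nonlinear terms is given by almost everywhere absolutely convergent convolution integrals and lies in $L^1([0,T];L^2)$, $u(0)=u_0$, and for every Schwartz function $\psi$ on $\mathbb R^3$ the function $t\mapsto\langle u(t),\psi\rangle$ is differentiable on $[0,T]$ with $\frac{d}{dt}\langle u(t),\psi\rangle=\langle u_1,\psi\rangle+\int_0^t\big(\langle u(\tau),\Delta\psi-\psi\rangle-\langle N(\tau),\psi\rangle\big)\,d\tau$. -/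

import Mathlib

open MeasureTheory Set Filter Topology
open scoped ENNReal SchwartzMap FourierTransform Laplacian

namespace KleinGordonHartree

noncomputable section

/-- The space `ℝ³`. -/
abbrev R3 : Type := EuclideanSpace ℝ (Fin 3)

/-- The real space `L²(ℝ³)`.  All the Sobolev spaces `H^μ` below have `μ ≥ 0`, so that their
elements are elements of `L²(ℝ³)`. -/
abbrev L2 : Type := Lp ℝ 2 (volume : Measure R3)

/-! ### Sobolev norms -/

/-- The Fourier transform of a real function in `L²(ℝ³)`, with Mathlib's normalisation
`𝓕 f (ξ) = ∫ exp (-2πi x·ξ) f(x) dx`; hence the frequency variable of the convention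
`∫ exp (-i x·ξ) f(x) dx` is `2πξ`. -/
def fourierL2 (f : L2) : Lp ℂ 2 (volume : Measure R3) :=
  𝓕 (Complex.ofRealCLM.compLp f)

/-- The norm of `H^s(ℝ³)`, for `s ≥ 0`, with value `∞` at the functions in `L²` that are not in
`H^s`: the `L²` norm of `(1 + |ξ|²)^(s/2) f̂(ξ)`, where `|ξ|` is the frequency `2π‖ξ‖`. -/
def sobolevENorm (s : ℝ) (f : L2) : ℝ≥0∞ :=
  eLpNorm (fun ξ : R3 => (((1 + (2 * Real.pi * ‖ξ‖) ^ 2) ^ (s / 2) : ℝ) : ℂ) * fourierL2 f ξ)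
    2 volume

/-- `u ∈ C(I; H^s)`: the values on `I` lie in `H^s` and `u` is continuous on `I` in the norm of
`H^s`. -/
def ContinuousIntoSobolev (s : ℝ) (I : Set ℝ) (u : ℝ → L2) : Prop :=
  (∀ t ∈ I, sobolevENorm s (u t) < ∞) ∧
    ∀ t ∈ I, Tendsto (fun τ => sobolevENorm s (u τ - u t)) (𝓝[I] t) (𝓝 0)

/-- `u ∈ (C ∩ L^∞)(I; H^s)`. -/
def BoundedContinuousIntoSobolev (s : ℝ) (I : Set ℝ) (u : ℝ → L2) : Prop :=
  ContinuousIntoSobolev s I u ∧ ∃ M : ℝ≥0∞, M < ∞ ∧ ∀ t ∈ I, sobolevENorm s (u t) ≤ M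

/-! ### Littlewood–Paley decomposition and Besov norms -/

/-- A pair of nonnegative radial Schwartz functions that generates a dyadic partition of unity.
(The supports of `φ (2⁻ʲ ·)` and `φ (2⁻ᵏ ·)` for `|j - k| ≥ 2`, and those of `χ` and `φ (2⁻ʲ ·)`
for `j ≥ 1`, are then disjoint, since `8/3 < 4 · 3/4` and `4/3 < 2 · 3/4`.) -/
structure LittlewoodPaleyPair where
  χ : 𝓢(R3, ℝ)
  φ : 𝓢(R3, ℝ)
  χ_nonneg : ∀ ξ, 0 ≤ χ ξ
  φ_nonneg : ∀ ξ, 0 ≤ φ ξ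
  χ_radial : ∀ ξ η, ‖ξ‖ = ‖η‖ → χ ξ = χ η
  φ_radial : ∀ ξ η, ‖ξ‖ = ‖η‖ → φ ξ = φ η
  χ_support : tsupport χ ⊆ {ξ | ‖ξ‖ ≤ 4 / 3}
  φ_support : tsupport φ ⊆ {ξ | 3 / 4 ≤ ‖ξ‖ ∧ ‖ξ‖ ≤ 8 / 3}
  inhomogeneous_sum : ∀ ξ, HasSum (fun j : ℕ => φ ((2 : ℝ) ^ (-(j : ℤ)) • ξ)) (1 - χ ξ)
  homogeneous_sum : ∀ ξ, ξ ≠ 0 → HasSum (fun j : ℤ => φ ((2 : ℝ) ^ (-j) • ξ)) 1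

/-- The profile of a radial cut-off function. -/
def cutoff (ξ : R3) : ℝ := Real.smoothTransition ((16 / 9 - ‖ξ‖ ^ 2) / (16 / 9 - 9 / 16))

theorem cutoff_eq_one {ξ : R3} (h : ‖ξ‖ ≤ 3 / 4) : cutoff ξ = 1 := by
  apply Real.smoothTransition.one_of_one_le
  rw [one_le_div (by norm_num)]
  nlinarith [norm_nonneg ξ]

theorem cutoff_eq_zero {ξ : R3} (h : 4 / 3 ≤ ‖ξ‖) : cutoff ξ = 0 := by
  apply Real.smoothTransition.zero_of_nonpos
  apply div_nonpos_of_nonpos_of_nonneg _ (by norm_num)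
  nlinarith [norm_nonneg ξ]

theorem cutoff_anti {ξ η : R3} (h : ‖ξ‖ ≤ ‖η‖) : cutoff η ≤ cutoff ξ := by
  apply Real.smoothTransition.monotone
  apply div_le_div_of_nonneg_right _ (by norm_num)
  nlinarith [norm_nonneg ξ]

theorem cutoff_contDiff : ContDiff ℝ ((⊤ : ℕ∞) : WithTop ℕ∞) cutoff := by
  unfold cutoff
  exact Real.smoothTransition.contDiff.comp ((contDiff_const.sub (contDiff_norm_sq ℝ)).div_const _)

theorem tsupport_subset_of {f : R3 → ℝ} {s : Set R3} (hs : IsClosed s)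
    (h : ∀ ξ, ξ ∉ s → f ξ = 0) : tsupport f ⊆ s :=
  closure_minimal (fun ξ hξ => by by_contra hc; exact hξ (h ξ hc)) hs

theorem norm_two_zpow_smul (k : ℤ) (ξ : R3) : ‖(2 : ℝ) ^ k • ξ‖ = 2 ^ k * ‖ξ‖ := by
  rw [norm_smul, Real.norm_of_nonneg (by positivity)]

/-- Littlewood–Paley pairs exist. -/
theorem nonempty_littlewoodPaleyPair : Nonempty LittlewoodPaleyPair := by
  have hχs : tsupport cutoff ⊆ {ξ | ‖ξ‖ ≤ 4 / 3} :=
    tsupport_subset_of (isClosed_le continuous_norm continuous_const)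
      fun ξ hξ => cutoff_eq_zero (le_of_lt (not_le.1 hξ))
  let p : R3 → ℝ := fun ξ => cutoff ((2 : ℝ) ^ (-1 : ℤ) • ξ) - cutoff ξ
  have hps : tsupport p ⊆ {ξ | 3 / 4 ≤ ‖ξ‖ ∧ ‖ξ‖ ≤ 8 / 3} := by
    refine tsupport_subset_of ((isClosed_le continuous_const continuous_norm).inter
      (isClosed_le continuous_norm continuous_const)) fun ξ hξ => ?_
    have hn := norm_two_zpow_smul (-1) ξ
    norm_num at hn
    by_cases h : 3 / 4 ≤ ‖ξ‖
    · have h2 : 8 / 3 < ‖ξ‖ := not_le.1 fun h2 => hξ ⟨h, h2⟩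
      simp only [p]
      rw [cutoff_eq_zero (by norm_num; linarith), cutoff_eq_zero (by linarith), sub_zero]
    · have h2 := not_le.1 h
      simp only [p]
      rw [cutoff_eq_one (by norm_num; linarith [norm_nonneg ξ]), cutoff_eq_one h2.le, sub_self]
  have hpn : ∀ ξ, 0 ≤ p ξ := fun ξ => by
    refine sub_nonneg.2 (cutoff_anti ?_)
    have hn := norm_two_zpow_smul (-1) ξ
    norm_num at hn ⊢
    linarith [norm_nonneg ξ]
  have hcc : HasCompactSupport cutoff := by
    refine (isCompact_closedBall (0 : R3) (4 / 3)).of_isClosed_subset (isClosed_tsupport _) ?_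
    exact fun ξ hξ => mem_closedBall_zero_iff.2 (hχs hξ)
  have hpc : HasCompactSupport p := by
    refine (isCompact_closedBall (0 : R3) (8 / 3)).of_isClosed_subset (isClosed_tsupport _) ?_
    exact fun ξ hξ => mem_closedBall_zero_iff.2 (hps hξ).2
  have hpd : ContDiff ℝ ((⊤ : ℕ∞) : WithTop ℕ∞) p :=
    (cutoff_contDiff.comp (contDiff_const_smul _)).sub cutoff_contDiff
  have hstep : ∀ (k : ℤ) (ξ : R3),
      p ((2 : ℝ) ^ k • ξ) = cutoff ((2 : ℝ) ^ (k - 1) • ξ) - cutoff ((2 : ℝ) ^ k • ξ) := by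
    intro k ξ
    simp only [p, smul_smul]
    rw [← zpow_add₀ (two_ne_zero), neg_add_eq_sub]
  have hpow : Tendsto (fun n : ℕ => (2 : ℝ) ^ n) atTop atTop :=
    tendsto_pow_atTop_atTop_of_one_lt one_lt_two
  have hinh : ∀ ξ, HasSum (fun j : ℕ => p ((2 : ℝ) ^ (-(j : ℤ)) • ξ)) (1 - cutoff ξ) := by
    intro ξ
    rw [hasSum_iff_tendsto_nat_of_nonneg fun j => hpn _]
    have hs : ∀ n : ℕ, ∑ j ∈ Finset.range n, p ((2 : ℝ) ^ (-(j : ℤ)) • ξ)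
        = cutoff ((2 : ℝ) ^ (-(n : ℤ)) • ξ) - cutoff ξ := by
      intro n
      induction n with
      | zero => simp
      | succ n ih =>
        rw [Finset.sum_range_succ, ih, hstep]
        have : -(n : ℤ) - 1 = -((n + 1 : ℕ) : ℤ) := by push_cast; ring
        rw [this]; ring
    simp_rw [hs]
    refine tendsto_const_nhds.congr' ?_
    filter_upwards [hpow.eventually_ge_atTop (‖ξ‖ / (3 / 4))] with n hn
    rw [cutoff_eq_one (ξ := (2 : ℝ) ^ (-(n : ℤ)) • ξ)]
    rw [norm_two_zpow_smul, zpow_neg, zpow_natCast, inv_mul_le_iff₀ (by positivity)]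
    rwa [div_le_iff₀ (by norm_num)] at hn
  have hhom : ∀ ξ, ξ ≠ 0 → HasSum (fun j : ℤ => p ((2 : ℝ) ^ (-j) • ξ)) 1 := by
    intro ξ hξ
    have hneg : HasSum (fun n : ℕ => p ((2 : ℝ) ^ (-(-((n : ℤ) + 1))) • ξ)) (cutoff ξ) := by
      rw [hasSum_iff_tendsto_nat_of_nonneg fun j => hpn _]
      have hs : ∀ n : ℕ, ∑ j ∈ Finset.range n, p ((2 : ℝ) ^ (-(-((j : ℤ) + 1))) • ξ)
          = cutoff ξ - cutoff ((2 : ℝ) ^ n • ξ) := by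
        intro n
        induction n with
        | zero => simp
        | succ n ih =>
          rw [Finset.sum_range_succ, ih, neg_neg, hstep, add_sub_cancel_right, zpow_natCast]
          have : (n : ℤ) + 1 = ((n + 1 : ℕ) : ℤ) := by push_cast; ring
          rw [this, zpow_natCast]; ring
      simp_rw [hs]
      refine tendsto_const_nhds.congr' ?_
      filter_upwards [hpow.eventually_ge_atTop (4 / 3 / ‖ξ‖)] with n hn
      rw [cutoff_eq_zero (ξ := (2 : ℝ) ^ n • ξ), sub_zero]
      have := norm_two_zpow_smul n ξ
      rw [zpow_natCast] at this
      rw [this]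
      rwa [div_le_iff₀ (norm_pos_iff.2 hξ)] at hn
    have := (hinh ξ).of_nat_of_neg_add_one (f := fun j : ℤ => p ((2 : ℝ) ^ (-j) • ξ)) hneg
    simpa using this
  exact ⟨{
    χ := hcc.toSchwartzMap cutoff_contDiff
    φ := hpc.toSchwartzMap hpd
    χ_nonneg := fun ξ => Real.smoothTransition.nonneg _
    φ_nonneg := hpn
    χ_radial := fun ξ η h => le_antisymm (cutoff_anti h.ge) (cutoff_anti h.le)
    φ_radial := fun ξ η h => by
      have h1 : ∀ a b : R3, ‖a‖ = ‖b‖ → cutoff a = cutoff b :=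
        fun a b h => le_antisymm (cutoff_anti h.ge) (cutoff_anti h.le)
      exact congrArg₂ (· - ·) (h1 _ _ (by rw [norm_smul, norm_smul, h])) (h1 _ _ h)
    χ_support := hχs
    φ_support := hps
    inhomogeneous_sum := hinh
    homogeneous_sum := hhom }⟩

/-- The low frequency part `S₀ f = 𝓕⁻¹ (χ f̂)`.  The function under the inverse Fourier transform
is integrable, so the inverse transform is an absolutely convergent integral at every point. -/
def lowFrequency (P : LittlewoodPaleyPair) (f : L2) : R3 → ℂ :=
  𝓕⁻ (fun ξ : R3 => ((P.χ ((2 * Real.pi) • ξ) : ℝ) : ℂ) * fourierL2 f ξ)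

/-- The dyadic block `Δ_j f = 𝓕⁻¹ (φ (2⁻ʲ ·) f̂)`, `j ≥ 0`. -/
def dyadicBlock (P : LittlewoodPaleyPair) (j : ℕ) (f : L2) : R3 → ℂ :=
  𝓕⁻ (fun ξ : R3 =>
    ((P.φ ((2 : ℝ) ^ (-(j : ℤ)) • (2 * Real.pi) • ξ) : ℝ) : ℂ) * fourierL2 f ξ)

/-- The norm of the inhomogeneous Besov space `B^σ_{r,2}(ℝ³)`. -/
def besovENorm (P : LittlewoodPaleyPair) (σ : ℝ) (r : ℝ≥0∞) (f : L2) : ℝ≥0∞ :=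
  (∑' j : ℕ, (ENNReal.ofReal ((2 : ℝ) ^ ((j : ℝ) * σ)) *
      eLpNorm (dyadicBlock P j f) r volume) ^ 2) ^ (1 / 2 : ℝ) +
    eLpNorm (lowFrequency P f) r volume

/-! ### Admissible pairs and resolution spaces -/

/-- `1 / q` as a real number, with `1 / ∞ = 0`. -/
def recip (q : ℝ≥0∞) : ℝ := (q⁻¹).toReal

/-- Admissible pairs `(q, r)` of Lebesgue exponents, for the parameter `θ`. -/
def Admissible (θ : ℝ) (q r : ℝ≥0∞) : Prop :=
  2 ≤ q ∧ 2 ≤ r ∧ ¬ (q = 2 ∧ r = ∞ ∧ θ = 0) ∧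
    recip q + (2 + θ) / 2 * recip r ≤ (2 + θ) / 4

/-- The space `X^μ_θ(I)`: `v ∈ (C ∩ L^∞)(I; H^μ)` and `v ∈ L^q(I; B^σ_{r,2})` for all admissible
pairs `(q, r)`, with `1/q = (3 + θ)(1/2 - 1/r) + σ - μ`. -/
def MemXTheta (P : LittlewoodPaleyPair) (μ θ : ℝ) (I : Set ℝ) (v : ℝ → L2) : Prop :=
  BoundedContinuousIntoSobolev μ I v ∧
    ∀ (q r : ℝ≥0∞) (σ : ℝ), Admissible θ q r →
      recip q = (3 + θ) * (1 / 2 - recip r) + σ - μ →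
      eLpNorm (fun t => besovENorm P σ r (v t)) q (volume.restrict I) < ∞

/-- The resolution space `X^μ(I)`, the intersection of the `X^μ_θ(I)` over `0 ≤ θ ≤ 1`. -/
def MemX (P : LittlewoodPaleyPair) (μ : ℝ) (I : Set ℝ) (v : ℝ → L2) : Prop :=
  ∀ θ : ℝ, 0 ≤ θ → θ ≤ 1 → MemXTheta P μ θ I v

/-! ### The perturbed equation -/

/-- The operator `𝓘 f = |x|^(-γ) * f`. -/
def riesz (γ : ℝ) (f : R3 → ℝ) (x : R3) : ℝ :=
  ∫ y, ‖x - y‖ ^ (-γ) * f y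

/-- The integral that defines `𝓘 f` converges absolutely at almost every point. -/
def RieszConverges (γ : ℝ) (f : R3 → ℝ) : Prop :=
  ∀ᵐ x : R3, Integrable (fun y : R3 => ‖x - y‖ ^ (-γ) * f y) volume

/-- The nonlinear part
`N(u, v) = 𝓘(u²)u + 2𝓘(uv)u + 𝓘(v²)u + 𝓘(u²)v + 2𝓘(uv)v` of the perturbed equation. -/
def nonlinearity (γ : ℝ) (u v : R3 → ℝ) (x : R3) : ℝ :=
  riesz γ (fun y => u y ^ 2) x * u x + 2 * riesz γ (fun y => u y * v y) x * u x
    + riesz γ (fun y => v y ^ 2) x * u x + riesz γ (fun y => u y ^ 2) x * v x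
    + 2 * riesz γ (fun y => u y * v y) x * v x

/-- `u` solves, on `[0, T]` and in the sense of distributions, the Cauchy problem
`∂ₜₜu - Δu + u + N(u, v) = 0`, `u(0) = u₀`, `∂ₜu(0) = u₁`.

The nonlinear part is well defined and lies in `L¹([0, T]; L²)` (it is represented by `F`), and the
equation holds in the form `∂ₜu(t) = u₁ + ∫₀ᵗ (Δu - u - N(u, v)) dτ`, `0 ≤ t ≤ T`, when both sides
are paired with test functions in the Schwartz class of `ℝ³`. -/
def IsSolution (γ T : ℝ) (v : ℝ → L2) (u₀ u₁ : L2) (u : ℝ → L2) : Prop :=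
  u 0 = u₀ ∧
    ∃ F : ℝ → L2, IntegrableOn F (Icc 0 T) volume ∧
      (∀ᵐ t ∂(volume.restrict (Icc 0 T)),
        RieszConverges γ (fun x => u t x ^ 2) ∧ RieszConverges γ (fun x => u t x * v t x) ∧
        RieszConverges γ (fun x => v t x ^ 2) ∧
        ∀ᵐ x : R3, F t x = nonlinearity γ (u t) (v t) x) ∧
      ∀ ψ : 𝓢(R3, ℝ), ∀ t ∈ Icc 0 T,
        HasDerivWithinAt (fun s => ∫ x, u s x * ψ x)
          ((∫ x, u₁ x * ψ x) +
            ∫ τ in (0 : ℝ)..t, ((∫ x, u τ x * (Δ ψ x - ψ x)) - ∫ x, F τ x * ψ x))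
          (Icc 0 T) t

end

end KleinGordonHartree

open KleinGordonHartree

namespace KleinGordonHartree

noncomputable section

/-! ### The Hardy–Littlewood–Sobolev inequality -/

/-! Write u = (1 - Δ)^(-1/2) g. The operator `bessel` = (1 - Δ)^(-1/2) is an isometry of L² onto H¹,
so u ∈ C([0,T]; H¹) means that g is continuous with values in L². With ω = (1 - Δ)^(1/2) the
equation takes the Duhamel form g(t) = cos(tω) g₀ + sin(tω) u₁ - ∫₀ᵗ sin((t-s)ω) N(s) ds. Sines are
contractions of L², so a bound for N in L¹([0,T]; L²) is all that a fixed point argument needs; no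
dispersive estimate for u enters.

Nonlinear estimate. Put ρ = 6/(4-γ), which lies between 3 and 6. In N = 𝓘((u+v)²)u + 𝓘(u(u+2v))v
every product contains a factor u; this factor goes to L⁶ and the other two to L^ρ. The
Hardy–Littlewood–Sobolev inequality between two Hölder inequalities then bounds N in L²
(`exists_trilinear_pair`), and H¹ embeds in L⁶ and in L^ρ (`memLp_bessel`). Hence N is Lipschitz in
g on bounded sets, with a constant at most quadratic in ‖v(t)‖_ρ: it is enough that v ∈ L²([0,T];
L^ρ).

The perturbation. Let β = (γ-1)/3. For θ = 0 the sharp pair 1/q = δ, 1/r = 1/2 - δ has σ = β - 2δ.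
The value δ = β/2 gives σ = 0 and r = ρ, but embedding B⁰_{ρ,2} into L^ρ takes a square function
theorem. The neighbours δ = β/2 ∓ 1/12, with σ = ±1/6 and 1/r₁ + 1/r₂ = 2/ρ, avoid it: v² is
expanded in frequency blocks, each product is estimated by Hölder with the higher frequency in the
norm with σ = 1/6, and the result decays geometrically off the diagonal
(`LittlewoodPaleyPair.exists_eLpNorm_sq_le_besovENorm`). Both values of q exceed 2, so L² in time
follows on bounded intervals. The same summation argument proves H¹ ⊂ L⁶.

Conclusion. A contraction on a short interval gives a Duhamel solution
(`LipschitzSource.exists_mild`), and Gronwall with an integrable weight gives uniqueness among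
Duhamel solutions. The Duhamel formula solves the weak equation (`hasDerivWithinAt_inner_mild`).
Conversely every weak solution in C([0,T]; H¹) is given by it (`eq_mild_of_weak`), since after a
frequency cut-off the difference of two weak solutions with the same data and source solves a linear
ODE with a bounded operator. -/

theorem lintegral_comp_smul_R3 {r : ℝ} (hr : 0 < r) {g : R3 → ℝ≥0∞} (hg : Measurable g) :
    ∫⁻ x, g x = ENNReal.ofReal (r ^ 3) * ∫⁻ x, g (r • x) := by
  have h := Measure.map_addHaar_smul (volume : Measure R3) hr.ne'
  have h2 : ∫⁻ x, g (r • x) = ENNReal.ofReal ((r ^ 3)⁻¹) * ∫⁻ x, g x := by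
    rw [← lintegral_map hg (measurable_const_smul r), h, lintegral_smul_measure]
    simp [abs_of_pos hr]
  rw [h2, ← mul_assoc, ← ENNReal.ofReal_mul (by positivity), mul_inv_cancel₀ (by positivity)]
  simp

/-- The Riesz kernel `‖z‖^(-γ)`, with values in `[0, ∞]`. -/
def rieszKernel (γ : ℝ) (z : R3) : ℝ≥0∞ := ENNReal.ofReal (‖z‖ ^ (-γ))

theorem measurable_rieszKernel (γ : ℝ) : Measurable (rieszKernel γ) := by
  unfold rieszKernel
  fun_prop

theorem rieszKernel_smul (γ : ℝ) {r : ℝ} (hr : 0 < r) (z : R3) :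
    rieszKernel γ (r • z) = ENNReal.ofReal (r ^ (-γ)) * rieszKernel γ z := by
  unfold rieszKernel
  rw [norm_smul, Real.norm_of_nonneg hr.le, Real.mul_rpow hr.le (norm_nonneg _),
    ENNReal.ofReal_mul (by positivity)]

/-- The kernel is homogeneous of degree -γ and Lebesgue measure of degree 3. One statement serves
both for balls and for their complements. -/
theorem setLIntegral_rieszKernel_smul (γ : ℝ) {r : ℝ} (hr : 0 < r) {s t : Set R3}
    (ht : MeasurableSet t) (hst : ∀ z, r • z ∈ t ↔ z ∈ s) :
    ∫⁻ z in t, rieszKernel γ z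
      = ENNReal.ofReal (r ^ (3 - γ)) * ∫⁻ z in s, rieszKernel γ z := by
  have hs : MeasurableSet s := by
    have : s = (fun z : R3 => r • z) ⁻¹' t := by ext z; exact (hst z).symm
    rw [this]; exact measurable_const_smul r ht
  rw [← lintegral_indicator ht, ← lintegral_indicator hs,
    lintegral_comp_smul_R3 hr ((measurable_rieszKernel γ).indicator ht)]
  have : ∀ z, t.indicator (rieszKernel γ) (r • z)
      = ENNReal.ofReal (r ^ (-γ)) * s.indicator (rieszKernel γ) z := by
    intro z
    by_cases hz : z ∈ s
    · rw [indicator_of_mem ((hst z).2 hz), indicator_of_mem hz, rieszKernel_smul γ hr]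
    · rw [indicator_of_notMem (fun h => hz ((hst z).1 h)), indicator_of_notMem hz, mul_zero]
  simp_rw [this]
  rw [lintegral_const_mul _ ((measurable_rieszKernel γ).indicator hs), ← mul_assoc,
    ← ENNReal.ofReal_mul (by positivity), ← Real.rpow_natCast, ← Real.rpow_add hr]
  norm_num [sub_eq_add_neg]

theorem lintegral_rieszKernel_ball (γ : ℝ) {r : ℝ} (hr : 0 < r) :
    ∫⁻ z in Metric.ball 0 r, rieszKernel γ z
      = ENNReal.ofReal (r ^ (3 - γ)) * ∫⁻ z in Metric.ball 0 1, rieszKernel γ z := by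
  refine setLIntegral_rieszKernel_smul γ hr measurableSet_ball fun z => ?_
  simp [norm_smul, abs_of_pos hr, hr]

theorem lintegral_rieszKernel_compl_ball (γ : ℝ) {r : ℝ} (hr : 0 < r) :
    ∫⁻ z in (Metric.ball 0 r)ᶜ, rieszKernel γ z
      = ENNReal.ofReal (r ^ (3 - γ)) * ∫⁻ z in (Metric.ball 0 1)ᶜ, rieszKernel γ z := by
  refine setLIntegral_rieszKernel_smul γ hr measurableSet_ball.compl fun z => ?_
  simp [norm_smul, abs_of_pos hr, hr]

theorem lintegral_rieszKernel_unitBall_lt_top {γ : ℝ} (hγ : γ < 3) :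
    ∫⁻ z in Metric.ball 0 1, rieszKernel γ z < ∞ := by
  have h : IntegrableOn (fun z : R3 => ‖z‖ ^ (-γ)) (Metric.ball 0 1) := by
    refine integrableOn_ball_of_norm_le_rpow (by simp) (C := 1) (α := γ) (by simpa using hγ) ?_ ?_
    · refine Eventually.of_forall fun x => ?_
      rw [one_mul, Real.norm_of_nonneg (by positivity)]
    · exact Measurable.aestronglyMeasurable (by fun_prop)
  have h2 := h.2
  rw [hasFiniteIntegral_iff_ofReal (Eventually.of_forall fun x => by positivity)] at h2
  exact h2

theorem lintegral_rieszKernel_compl_unitBall_lt_top {s : ℝ} (hs : 3 < s) :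
    ∫⁻ z in (Metric.ball 0 1)ᶜ, rieszKernel s z < ∞ := by
  have h : IntegrableOn (fun z : R3 => ‖z‖ ^ (-s)) (Metric.ball 0 1)ᶜ := by
    have h1 : Integrable (fun z : R3 => (Ici 1).indicator (fun t : ℝ => t ^ (-s)) ‖z‖) := by
      rw [integrable_fun_norm_addHaar]
      have h2 : IntegrableOn (fun y : ℝ => y ^ (2 - s)) (Ici 1) := by
        rw [integrableOn_Ici_iff_integrableOn_Ioi]
        exact (integrableOn_Ioi_rpow_iff one_pos).2 (by linarith)
      have h3 : Integrable ((Ici (1 : ℝ)).indicator fun y : ℝ => y ^ (2 - s)) :=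
        (integrable_indicator_iff measurableSet_Ici).2 h2
      refine (h3.integrableOn (s := Ioi 0)).congr_fun (fun y hy => ?_) measurableSet_Ioi
      by_cases h1 : (1 : ℝ) ≤ y
      · simp only [indicator_of_mem (mem_Ici.2 h1), smul_eq_mul]
        simp only [finrank_euclideanSpace, Fintype.card_fin]
        rw [← Real.rpow_natCast, ← Real.rpow_add hy]
        norm_num [sub_eq_add_neg]
      · simp [h1]
    rw [← integrable_indicator_iff measurableSet_ball.compl]
    refine h1.congr (Eventually.of_forall fun z => ?_)
    by_cases hz : 1 ≤ ‖z‖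
    · simp [hz]
    · simp [hz]
  have h2 := h.2
  rw [hasFiniteIntegral_iff_ofReal (Eventually.of_forall fun x => by positivity)] at h2
  exact h2

/-- Layer cake formula for a single value. -/
theorem lintegral_Ioi_rpow_lt {p : ℝ} (hp : 0 < p) {F : ℝ≥0∞} (hF : F ≠ ∞) :
    ∫⁻ t in Ioi (0 : ℝ), {t : ℝ | ENNReal.ofReal t < F}.indicator
      (fun t => ENNReal.ofReal (t ^ (p - 1))) t = F ^ p * ENNReal.ofReal p⁻¹ := by
  obtain ⟨M, hM, rfl⟩ : ∃ M : ℝ, 0 ≤ M ∧ F = ENNReal.ofReal M :=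
    ⟨F.toReal, ENNReal.toReal_nonneg, (ENNReal.ofReal_toReal hF).symm⟩
  have hset : {t : ℝ | ENNReal.ofReal t < ENNReal.ofReal M} ∩ Ioi 0 = Ioo 0 M := by
    ext t
    simp only [mem_inter_iff, mem_ofPred_eq, mem_Ioi, mem_Ioo]
    constructor
    · rintro ⟨h, h0⟩
      exact ⟨h0, (ENNReal.ofReal_lt_ofReal_iff_of_nonneg h0.le).1 h⟩
    · rintro ⟨h0, h⟩
      exact ⟨(ENNReal.ofReal_lt_ofReal_iff_of_nonneg h0.le).2 h, h0⟩
  have hms : MeasurableSet {t : ℝ | ENNReal.ofReal t < ENNReal.ofReal M} :=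
    measurableSet_lt (by fun_prop) (by fun_prop)
  rw [lintegral_indicator hms, Measure.restrict_restrict hms, hset]
  have hi : IntegrableOn (fun t : ℝ => t ^ (p - 1)) (Ioo 0 M) := by
    rcases hM.eq_or_lt with rfl | h
    · simp
    · exact (intervalIntegral.integrableOn_Ioo_rpow_iff h).2 (by linarith)
  rw [← ofReal_integral_eq_lintegral_ofReal hi, ← integral_Ioc_eq_integral_Ioo,
    ← intervalIntegral.integral_of_le hM, integral_rpow (Or.inl (by linarith)),
    ENNReal.ofReal_rpow_of_nonneg hM hp.le, ← ENNReal.ofReal_mul (by positivity)]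
  · simp [Real.zero_rpow hp.ne', div_eq_mul_inv]
  · filter_upwards [self_mem_ae_restrict measurableSet_Ioo] with t ht
    exact Real.rpow_nonneg ht.1.le _

theorem rpow_le_lintegral_Ioi {p : ℝ} (hp : 0 < p) (F : ℝ≥0∞) :
    F ^ p * ENNReal.ofReal p⁻¹ ≤ ∫⁻ t in Ioi (0 : ℝ), {t : ℝ | ENNReal.ofReal t < F}.indicator
      (fun t => ENNReal.ofReal (t ^ (p - 1))) t := by
  by_cases hF : F = ∞
  · subst hF
    have h : ∀ n : ℕ, (n : ℝ≥0∞) ^ p * ENNReal.ofReal p⁻¹ ≤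
        ∫⁻ t in Ioi (0 : ℝ), {t : ℝ | ENNReal.ofReal t < ∞}.indicator
          (fun t => ENNReal.ofReal (t ^ (p - 1))) t := fun n => by
      rw [← lintegral_Ioi_rpow_lt hp (ENNReal.natCast_ne_top n)]
      refine lintegral_mono fun t => ?_
      exact indicator_le_indicator_of_subset
        (fun t (ht : ENNReal.ofReal t < n) => show ENNReal.ofReal t < ∞ from lt_of_lt_of_le ht le_top) (fun _ => zero_le) t
    have ht : Tendsto (fun n : ℕ => (n : ℝ≥0∞) ^ p * ENNReal.ofReal p⁻¹) atTop
        (𝓝 (∞ ^ p * ENNReal.ofReal p⁻¹)) := by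
      refine ENNReal.Tendsto.mul_const ?_ (Or.inr ENNReal.ofReal_ne_top)
      exact (ENNReal.continuous_rpow_const.tendsto _).comp ENNReal.tendsto_nat_nhds_top
    exact le_of_tendsto' ht h
  · exact (lintegral_Ioi_rpow_lt hp hF).ge

/-- The Riesz potential of a function with values in `[0, ∞]`. -/
def rieszPotential (γ : ℝ) (f : R3 → ℝ≥0∞) (x : R3) : ℝ≥0∞ :=
  ∫⁻ y, rieszKernel γ (x - y) * f y

theorem measurable_rieszPotential (γ : ℝ) {f : R3 → ℝ≥0∞} (hf : Measurable f) :
    Measurable (rieszPotential γ f) := by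
  have hK := measurable_rieszKernel γ
  exact Measurable.lintegral_prod_right' (f := fun p : R3 × R3 => rieszKernel γ (p.1 - p.2) * f p.2)
    (by fun_prop)

theorem lintegral_comp_sub_left (g : R3 → ℝ≥0∞) (x : R3) :
    ∫⁻ y, g (x - y) = ∫⁻ y, g y :=
  MeasureTheory.lintegral_sub_left_eq_self g x

/-- The far part of the kernel is paired with f by Hölder, and the near part with the values f ≤ μ
by the supremum bound; only near kernel against large values is left over. The two bounds are
hypotheses so that r and μ can be adapted to the level c. -/
theorem rieszPotential_le_of_near_far {γ a c μ r : ℝ} (ha : 1 < a) {f : R3 → ℝ≥0∞} (hf : Measurable f) (hfa : ∫⁻ y, f y ^ a ≤ 1)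
    (hfar : (∫⁻ z in (Metric.ball 0 r)ᶜ, rieszKernel (γ * (a / (a - 1))) z) ^ ((a - 1) / a)
      ≤ ENNReal.ofReal c)
    (hnear : ENNReal.ofReal μ * (∫⁻ z in Metric.ball 0 r, rieszKernel γ z) ≤ ENNReal.ofReal c)
    (x : R3) :
    rieszPotential γ f x ≤ ENNReal.ofReal c + ENNReal.ofReal c +
      ∫⁻ y, (Metric.ball 0 r).indicator (rieszKernel γ) (x - y) *
        {y | ENNReal.ofReal μ < f y}.indicator f y := by
  have hK := measurable_rieszKernel γ
  have hb : MeasurableSet (Metric.ball (0 : R3) r) := measurableSet_ball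
  have hset : MeasurableSet {y | ENNReal.ofReal μ < f y} := measurableSet_lt measurable_const hf
  have hpq : (a / (a - 1)).HolderConjugate a := by
    have := (Real.HolderConjugate.conjExponent ha).symm
    rwa [Real.conjExponent] at this
  have hmK : Measurable fun y => (Metric.ball 0 r)ᶜ.indicator (rieszKernel γ) (x - y) :=
    (hK.indicator hb.compl).comp (measurable_const.sub measurable_id)
  have hmK' : Measurable fun y => (Metric.ball 0 r).indicator (rieszKernel γ) (x - y) :=
    (hK.indicator hb).comp (measurable_const.sub measurable_id)
  have h1 : ∫⁻ y, (Metric.ball 0 r)ᶜ.indicator (rieszKernel γ) (x - y) * f y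
      ≤ ENNReal.ofReal c := by
    refine (ENNReal.lintegral_mul_le_Lp_mul_Lq volume hpq hmK.aemeasurable hf.aemeasurable).trans ?_
    have h2 : ∫⁻ y, ((Metric.ball 0 r)ᶜ.indicator (rieszKernel γ) (x - y)) ^ (a / (a - 1))
        = ∫⁻ z in (Metric.ball 0 r)ᶜ, rieszKernel (γ * (a / (a - 1))) z := by
      rw [lintegral_comp_sub_left
        (fun z => ((Metric.ball 0 r)ᶜ.indicator (rieszKernel γ) z) ^ (a / (a - 1))) x,
        ← lintegral_indicator hb.compl]
      refine lintegral_congr fun z => ?_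
      by_cases hz : z ∈ (Metric.ball (0 : R3) r)ᶜ
      · simp only [indicator_of_mem hz, rieszKernel]
        rw [ENNReal.ofReal_rpow_of_nonneg (by positivity) hpq.pos.le, ← Real.rpow_mul (norm_nonneg _)]
        ring_nf
      · simp only [indicator_of_notMem hz, ENNReal.zero_rpow_of_pos hpq.pos]
    rw [h2]
    have h3 : (1 : ℝ) / (a / (a - 1)) = (a - 1) / a := by rw [one_div_div]
    rw [h3]
    calc _ ≤ ENNReal.ofReal c * 1 := mul_le_mul' hfar
          (ENNReal.rpow_le_one hfa (by positivity))
      _ = _ := mul_one _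
  have h2 : ∫⁻ y, (Metric.ball 0 r).indicator (rieszKernel γ) (x - y) *
        {y | ENNReal.ofReal μ < f y}ᶜ.indicator f y ≤ ENNReal.ofReal c := by
    calc _ ≤ ∫⁻ y, (Metric.ball 0 r).indicator (rieszKernel γ) (x - y) * ENNReal.ofReal μ := by
          refine lintegral_mono fun y => mul_le_mul' le_rfl ?_
          by_cases hy : y ∈ {y | ENNReal.ofReal μ < f y}ᶜ
          · rw [indicator_of_mem hy]; exact not_lt.1 hy
          · rw [indicator_of_notMem hy]; exact zero_le
      _ = ENNReal.ofReal μ * (∫⁻ z in Metric.ball 0 r, rieszKernel γ z) := by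
          rw [lintegral_mul_const _ hmK', lintegral_comp_sub_left
            (fun z => (Metric.ball 0 r).indicator (rieszKernel γ) z) x, lintegral_indicator hb,
            mul_comm]
      _ ≤ _ := hnear
  calc rieszPotential γ f x
      = ∫⁻ y, ((Metric.ball 0 r)ᶜ.indicator (rieszKernel γ) (x - y) * f y +
          (Metric.ball 0 r).indicator (rieszKernel γ) (x - y) *
            {y | ENNReal.ofReal μ < f y}ᶜ.indicator f y) +
          (Metric.ball 0 r).indicator (rieszKernel γ) (x - y) *
            {y | ENNReal.ofReal μ < f y}.indicator f y := by
        refine lintegral_congr fun y => ?_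
        have e1 : rieszKernel γ (x - y) = (Metric.ball 0 r)ᶜ.indicator (rieszKernel γ) (x - y) +
            (Metric.ball 0 r).indicator (rieszKernel γ) (x - y) :=
          (congrFun (indicator_compl_add_self (Metric.ball 0 r) (rieszKernel γ)) (x - y)).symm
        have e2 : f y = {y | ENNReal.ofReal μ < f y}ᶜ.indicator f y +
            {y | ENNReal.ofReal μ < f y}.indicator f y :=
          (congrFun (indicator_compl_add_self {y | ENNReal.ofReal μ < f y} f) y).symm
        rw [add_assoc, ← mul_add, ← e2, ← add_mul, ← e1]
    _ = _ := by
        have m1 : Measurable fun y => (Metric.ball 0 r)ᶜ.indicator (rieszKernel γ) (x - y) * f y :=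
          hmK.mul hf
        have m2 : Measurable fun y => (Metric.ball 0 r).indicator (rieszKernel γ) (x - y) *
            {y | ENNReal.ofReal μ < f y}ᶜ.indicator f y := hmK'.mul (hf.indicator hset.compl)
        exact (lintegral_add_left (m1.add m2) _).trans
          (congrArg (· + _) (lintegral_add_left m1 _))
    _ ≤ _ := add_le_add (add_le_add h1 h2) le_rfl

/-- Marcinkiewicz interpolation done by hand. At each level t the radius and the height of
truncation are tuned to t, so that Chebyshev needs only the L¹ norm of the large part of f.
Integrating over t and exchanging the integrals restores exactly ∫ f^a. -/
theorem lintegral_rpow_rieszPotential_le {γ a b : ℝ} (hγ3 : γ < 3) (ha : 1 < a)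
    (hb : 0 < b) (hab : 1 / b = 1 / a - 1 + γ / 3) :
    ∃ C : ℝ≥0∞, C ≠ ∞ ∧ ∀ f : R3 → ℝ≥0∞, Measurable f → ∫⁻ y, f y ^ a ≤ 1 →
      ∫⁻ x, rieszPotential γ f x ^ b ≤ C := by
  have ha0 : 0 < a := by linarith
  have hab' : a = b * (a * (γ / 3) - a + 1) := by
    field_simp at hab ⊢; linarith
  obtain ⟨c₁, hc₁, hc₁'⟩ : ∃ c₁ : ℝ, 0 ≤ c₁ ∧
      ∫⁻ z in Metric.ball 0 1, rieszKernel γ z = ENNReal.ofReal c₁ :=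
    ⟨_, ENNReal.toReal_nonneg,
      (ENNReal.ofReal_toReal (lintegral_rieszKernel_unitBall_lt_top hγ3).ne).symm⟩
  -- Positivity of 1/b is exactly integrability of the conjugate power of the kernel at infinity.
  have hs : 3 < γ * (a / (a - 1)) := by
    have : 0 < 1 / b := by positivity
    rw [hab] at this
    rw [mul_div_assoc', lt_div_iff₀ (by linarith)]
    field_simp at this
    linarith
  obtain ⟨c₂, hc₂, hc₂'⟩ : ∃ c₂ : ℝ, 0 ≤ c₂ ∧
      ∫⁻ z in (Metric.ball 0 1)ᶜ, rieszKernel (γ * (a / (a - 1))) z = ENNReal.ofReal c₂ :=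
    ⟨_, ENNReal.toReal_nonneg,
      (ENNReal.ofReal_toReal (lintegral_rieszKernel_compl_unitBall_lt_top hs).ne).symm⟩
  -- A fixes the radius A t^(-b/3) so that the far part is at most t/4; then m fixes the height m
  -- t^(b/a) so that the near part of the small values is at most t/4.
  obtain ⟨A, hA, hA'⟩ : ∃ A : ℝ, 0 < A ∧ A ^ (-3 / b) * c₂ ^ ((a - 1) / a) ≤ 1 / 4 := by
    refine ⟨(4 * (c₂ ^ ((a - 1) / a) + 1)) ^ (b / 3), by positivity, ?_⟩
    rw [← Real.rpow_mul (by positivity)]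
    have : b / 3 * (-3 / b) = -1 := by field_simp
    rw [this, Real.rpow_neg_one, inv_mul_le_iff₀ (by positivity)]
    linarith
  obtain ⟨m, hm, hm'⟩ : ∃ m : ℝ, 0 < m ∧ m * (A ^ (3 - γ) * c₁) ≤ 1 / 4 := by
    refine ⟨(4 * (A ^ (3 - γ) * c₁ + 1))⁻¹, by positivity, ?_⟩
    rw [inv_mul_le_iff₀ (by positivity)]
    linarith
  set e : ℝ := b * (1 - 1 / a) with he
  have he0 : 0 < e := by
    have : 1 / a < 1 := by rw [div_lt_one ha0]; exact ha
    have : 0 < 1 - 1 / a := by linarith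
    positivity
  set D : ℝ := 2 * A ^ (3 - γ) * c₁ with hD
  -- the weak type bound
  have key : ∀ f : R3 → ℝ≥0∞, Measurable f → ∫⁻ y, f y ^ a ≤ 1 → ∀ t : ℝ, 0 < t →
      ENNReal.ofReal (t ^ (b - 1)) * volume {x | ENNReal.ofReal t < rieszPotential γ f x} ≤
        ENNReal.ofReal D * (ENNReal.ofReal (t ^ (e - 1)) *
          ∫⁻ y, {y | ENNReal.ofReal (m * t ^ (b / a)) < f y}.indicator f y) := by
    intro f hf hfa t ht
    -- This power makes the far bound, of order r^(-3/b), linear in t. The near bound, of order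
    -- t^(b/a) r^(3-γ), is then linear in t as well, by the relation between a and b.
    set r := A * t ^ (-b / 3) with hr
    have hr0 : 0 < r := by positivity
    have hnear : ∫⁻ z in Metric.ball 0 r, rieszKernel γ z =
        ENNReal.ofReal (r ^ (3 - γ) * c₁) := by
      rw [lintegral_rieszKernel_ball γ hr0, hc₁', ENNReal.ofReal_mul (by positivity)]
    have hrγ : r ^ (3 - γ) = A ^ (3 - γ) * t ^ (-b / 3 * (3 - γ)) := by
      rw [hr, Real.mul_rpow hA.le (by positivity), ← Real.rpow_mul ht.le]
    have hset : MeasurableSet {y | ENNReal.ofReal (m * t ^ (b / a)) < f y} :=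
      measurableSet_lt measurable_const hf
    have hpt := rieszPotential_le_of_near_far (r := r) (μ := m * t ^ (b / a)) (c := t / 4) ha hf hfa
      (by
        rw [lintegral_rieszKernel_compl_ball _ hr0, hc₂', ← ENNReal.ofReal_mul (by positivity),
          ENNReal.ofReal_rpow_of_nonneg (by positivity) (div_nonneg (by linarith) ha0.le)]
        refine ENNReal.ofReal_le_ofReal ?_
        rw [Real.mul_rpow (by positivity) hc₂, ← Real.rpow_mul hr0.le]
        have : (3 - γ * (a / (a - 1))) * ((a - 1) / a) = -3 / b := by
          have h1 : a - 1 ≠ 0 := by linarith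
          have h2 : -3 / b = -3 * (1 / b) := by ring
          rw [h2, hab]
          field_simp
          ring
        rw [this, hr, Real.mul_rpow hA.le (by positivity), ← Real.rpow_mul ht.le]
        have : -b / 3 * (-3 / b) = 1 := by field_simp
        rw [this, Real.rpow_one]
        nlinarith)
      (by
        rw [hnear, ← ENNReal.ofReal_mul (by positivity)]
        refine ENNReal.ofReal_le_ofReal ?_
        rw [hrγ]
        have : t ^ (b / a) * t ^ (-b / 3 * (3 - γ)) = t := by
          rw [← Real.rpow_add ht]
          conv_rhs => rw [← Real.rpow_one t]
          congr 1
          have : (1 : ℝ) = b * (1 / b) := by field_simp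
          rw [this, hab]
          ring
        calc m * t ^ (b / a) * (A ^ (3 - γ) * t ^ (-b / 3 * (3 - γ)) * c₁)
            = (m * (A ^ (3 - γ) * c₁)) * (t ^ (b / a) * t ^ (-b / 3 * (3 - γ))) := by ring
          _ ≤ t / 4 := by rw [this]; nlinarith)
    set g : R3 → ℝ≥0∞ := {y | ENNReal.ofReal (m * t ^ (b / a)) < f y}.indicator f with hg
    have hgm : Measurable g := hf.indicator hset
    set h : R3 → ℝ≥0∞ := fun x => ∫⁻ y, (Metric.ball 0 r).indicator (rieszKernel γ) (x - y) * g y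
      with hh
    have hKm : Measurable ((Metric.ball (0 : R3) r).indicator (rieszKernel γ)) :=
      (measurable_rieszKernel γ).indicator measurableSet_ball
    have hhm : Measurable h := by
      refine Measurable.lintegral_prod_right' (f := fun p : R3 × R3 =>
        (Metric.ball 0 r).indicator (rieszKernel γ) (p.1 - p.2) * g p.2) ?_
      exact (hKm.comp (measurable_fst.sub measurable_snd)).mul (hgm.comp measurable_snd)
    have hint : ∫⁻ x, h x = ENNReal.ofReal (r ^ (3 - γ) * c₁) * ∫⁻ y, g y := by
      rw [← hnear, ← lintegral_indicator measurableSet_ball]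
      simp only [hh]
      rw [lintegral_lintegral_swap]
      · rw [← lintegral_const_mul _ hgm]
        refine lintegral_congr fun y => ?_
        rw [lintegral_mul_const]
        · rw [MeasureTheory.lintegral_sub_right_eq_self
            (fun z => (Metric.ball 0 r).indicator (rieszKernel γ) z) y]
        · exact hKm.comp (measurable_id.sub measurable_const)
      · exact ((hKm.comp (measurable_fst.sub measurable_snd)).mul
          (hgm.comp measurable_snd)).aemeasurable
    -- Two quarters of the level t are used up, so the remaining part h carries at least t/2.
    have hsub : {x | ENNReal.ofReal t < rieszPotential γ f x} ⊆ {x | ENNReal.ofReal (t / 2) ≤ h x} := by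
      intro x hx
      by_contra hcon
      have hx' : h x < ENNReal.ofReal (t / 2) := not_le.1 hcon
      have : rieszPotential γ f x ≤ ENNReal.ofReal t := by
        refine (hpt x).trans ?_
        refine (add_le_add le_rfl hx'.le).trans ?_
        rw [← ENNReal.ofReal_add (by positivity) (by positivity),
          ← ENNReal.ofReal_add (by positivity) (by positivity)]
        exact ENNReal.ofReal_le_ofReal (by linarith)
      exact absurd hx (not_lt.2 this)
    have hcheb : ENNReal.ofReal (t / 2) * volume {x | ENNReal.ofReal t < rieszPotential γ f x}
        ≤ ENNReal.ofReal (r ^ (3 - γ) * c₁) * ∫⁻ y, g y := by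
      rw [← hint]
      exact (mul_le_mul' le_rfl (measure_mono hsub)).trans (mul_meas_ge_le_lintegral hhm _)
    have h1 : t ^ (b - 1) = 2 * t ^ (b - 2) * (t / 2) := by
      have : b - 1 = (b - 2) + 1 := by ring
      rw [this, Real.rpow_add ht, Real.rpow_one]; ring
    have h2 : 2 * t ^ (b - 2) * (r ^ (3 - γ) * c₁) = D * t ^ (e - 1) := by
      have : t ^ (e - 1) = t ^ (b - 2) * t ^ (-b / 3 * (3 - γ)) := by
        rw [← Real.rpow_add ht]
        congr 1
        rw [he]
        have : (1 : ℝ) = b * (1 / b) := by field_simp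
        rw [hab] at this
        linear_combination (1 : ℝ) * this
      rw [hrγ, this, hD]; ring
    calc _ = ENNReal.ofReal (2 * t ^ (b - 2)) * (ENNReal.ofReal (t / 2) *
          volume {x | ENNReal.ofReal t < rieszPotential γ f x}) := by
          rw [← mul_assoc, ← ENNReal.ofReal_mul (by positivity), ← h1]
      _ ≤ ENNReal.ofReal (2 * t ^ (b - 2)) * (ENNReal.ofReal (r ^ (3 - γ) * c₁) * ∫⁻ y, g y) :=
          mul_le_mul' le_rfl hcheb
      _ = _ := by
          rw [← mul_assoc, ← ENNReal.ofReal_mul (by positivity), h2,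
            ENNReal.ofReal_mul (by positivity), mul_assoc]
  have hbinv : ENNReal.ofReal b * ENNReal.ofReal b⁻¹ = 1 := by
    rw [← ENNReal.ofReal_mul hb.le, mul_inv_cancel₀ hb.ne', ENNReal.ofReal_one]
  refine ⟨ENNReal.ofReal b * (ENNReal.ofReal D * (ENNReal.ofReal ((m⁻¹) ^ (a / b * e)) *
    ENNReal.ofReal e⁻¹)), by
      exact (ENNReal.mul_lt_top ENNReal.ofReal_lt_top (ENNReal.mul_lt_top ENNReal.ofReal_lt_top
        (ENNReal.mul_lt_top ENNReal.ofReal_lt_top ENNReal.ofReal_lt_top))).ne, ?_⟩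
  intro f hf hfa
  have hIf := measurable_rieszPotential γ hf
  have hsF : MeasurableSet {p : R3 × ℝ | ENNReal.ofReal p.2 < rieszPotential γ f p.1} :=
    measurableSet_lt (by fun_prop) (hIf.comp measurable_fst)
  have hsG : MeasurableSet {p : R3 × ℝ | ENNReal.ofReal (m * p.2 ^ (b / a)) < f p.1} :=
    measurableSet_lt (by fun_prop) (hf.comp measurable_fst)
  have hfin : ∀ᵐ y, f y ≠ ∞ := by
    have : ∀ᵐ y, f y ^ a < ∞ := ae_lt_top (by fun_prop) (hfa.trans_lt ENNReal.one_lt_top).ne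
    filter_upwards [this] with y hy h
    rw [h, ENNReal.top_rpow_of_pos ha0] at hy
    exact lt_irrefl _ hy
  -- swap the integrals on the left
  have hleft : ∫⁻ x, rieszPotential γ f x ^ b * ENNReal.ofReal b⁻¹ ≤
      ∫⁻ t in Ioi (0 : ℝ), ENNReal.ofReal (t ^ (b - 1)) *
        volume {x | ENNReal.ofReal t < rieszPotential γ f x} := by
    calc _ ≤ ∫⁻ x, ∫⁻ t in Ioi (0 : ℝ), {t : ℝ | ENNReal.ofReal t < rieszPotential γ f x}.indicator
          (fun t => ENNReal.ofReal (t ^ (b - 1))) t :=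
          lintegral_mono fun x => rpow_le_lintegral_Ioi hb _
      _ = ∫⁻ t in Ioi (0 : ℝ), ∫⁻ x, {t : ℝ | ENNReal.ofReal t < rieszPotential γ f x}.indicator
          (fun t => ENNReal.ofReal (t ^ (b - 1))) t := by
          refine lintegral_lintegral_swap (Measurable.aemeasurable ?_)
          have : (Function.uncurry fun (x : R3) (t : ℝ) =>
              {t : ℝ | ENNReal.ofReal t < rieszPotential γ f x}.indicator
                (fun t => ENNReal.ofReal (t ^ (b - 1))) t) =
              {p : R3 × ℝ | ENNReal.ofReal p.2 < rieszPotential γ f p.1}.indicator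
                (fun p => ENNReal.ofReal (p.2 ^ (b - 1))) := by
            ext ⟨x, t⟩; rfl
          rw [this]
          exact Measurable.indicator (by fun_prop) hsF
      _ = _ := by
          refine lintegral_congr fun t => ?_
          have hst : MeasurableSet {x | ENNReal.ofReal t < rieszPotential γ f x} :=
            measurableSet_lt measurable_const hIf
          rw [← lintegral_indicator_const hst]
          rfl
  -- With t integrated first, the condition m t^(b/a) < f(y) means t < (f(y)/m)^(a/b). The inner
  -- integral is a multiple of f(y)^(ae/b) = f(y)^(a-1), and the factor f(y) completes it to f(y)^a.
  have hright : ∫⁻ t in Ioi (0 : ℝ), ENNReal.ofReal (t ^ (e - 1)) *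
        (∫⁻ y, {y | ENNReal.ofReal (m * t ^ (b / a)) < f y}.indicator f y) ≤
      ENNReal.ofReal ((m⁻¹) ^ (a / b * e)) * ENNReal.ofReal e⁻¹ := by
    calc _ = ∫⁻ t in Ioi (0 : ℝ), ∫⁻ y, {p : R3 × ℝ | ENNReal.ofReal (m * p.2 ^ (b / a)) < f p.1}.indicator
            (fun p => f p.1 * ENNReal.ofReal (p.2 ^ (e - 1))) (y, t) := by
          refine lintegral_congr fun t => ?_
          have hst : MeasurableSet {y | ENNReal.ofReal (m * t ^ (b / a)) < f y} :=
            measurableSet_lt measurable_const hf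
          rw [← lintegral_const_mul _ (hf.indicator hst)]
          refine lintegral_congr fun y => ?_
          by_cases hy : ENNReal.ofReal (m * t ^ (b / a)) < f y
          · simp only [indicator, mem_ofPred_eq, hy, if_true]; rw [mul_comm]
          · simp only [indicator, mem_ofPred_eq, hy, if_false, mul_zero]
      _ = ∫⁻ y, ∫⁻ t in Ioi (0 : ℝ), {p : R3 × ℝ | ENNReal.ofReal (m * p.2 ^ (b / a)) < f p.1}.indicator
            (fun p => f p.1 * ENNReal.ofReal (p.2 ^ (e - 1))) (y, t) := by
          refine lintegral_lintegral_swap (Measurable.aemeasurable ?_)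
          have : Measurable ({p : R3 × ℝ | ENNReal.ofReal (m * p.2 ^ (b / a)) < f p.1}.indicator
            (fun p => f p.1 * ENNReal.ofReal (p.2 ^ (e - 1)))) :=
            Measurable.indicator (by fun_prop) hsG
          exact this.comp measurable_swap
      _ ≤ ∫⁻ y, ENNReal.ofReal ((m⁻¹) ^ (a / b * e)) * ENNReal.ofReal e⁻¹ * f y ^ a := by
          refine lintegral_mono_ae ?_
          filter_upwards [hfin] with y hy
          obtain ⟨w, hw, hwf⟩ : ∃ w : ℝ, 0 ≤ w ∧ f y = ENNReal.ofReal w :=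
            ⟨_, ENNReal.toReal_nonneg, (ENNReal.ofReal_toReal hy).symm⟩
          have hmw : 0 ≤ m⁻¹ * w := by positivity
          have hiff : ∀ t : ℝ, 0 < t → (ENNReal.ofReal (m * t ^ (b / a)) < f y ↔
              ENNReal.ofReal t < ENNReal.ofReal ((m⁻¹ * w) ^ (a / b))) := by
            intro t ht
            rw [hwf, ENNReal.ofReal_lt_ofReal_iff_of_nonneg (by positivity),
              ENNReal.ofReal_lt_ofReal_iff_of_nonneg ht.le, ← lt_inv_mul_iff₀ hm]
            have h1 : t = (t ^ (b / a)) ^ (a / b) := by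
              rw [← Real.rpow_mul ht.le]
              have : b / a * (a / b) = 1 := by field_simp
              rw [this, Real.rpow_one]
            conv_rhs => rw [h1]
            exact (Real.rpow_lt_rpow_iff (by positivity) hmw (by positivity)).symm
          calc _ = ∫⁻ t in Ioi (0 : ℝ), f y * {t : ℝ | ENNReal.ofReal t <
                ENNReal.ofReal ((m⁻¹ * w) ^ (a / b))}.indicator
                (fun t => ENNReal.ofReal (t ^ (e - 1))) t := by
                refine setLIntegral_congr_fun measurableSet_Ioi fun t ht => ?_
                have := hiff t ht
                by_cases hyt : ENNReal.ofReal (m * t ^ (b / a)) < f y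
                · simp only [indicator, mem_ofPred_eq, hyt, this.1 hyt, if_true]
                · have h2 : ¬ (ENNReal.ofReal t < ENNReal.ofReal ((m⁻¹ * w) ^ (a / b))) :=
                    fun h => hyt (this.2 h)
                  simp only [indicator, mem_ofPred_eq, hyt, h2, if_false, mul_zero]
            _ = f y * (ENNReal.ofReal ((m⁻¹ * w) ^ (a / b)) ^ e * ENNReal.ofReal e⁻¹) := by
                rw [lintegral_const_mul, lintegral_Ioi_rpow_lt he0 ENNReal.ofReal_ne_top]
                exact Measurable.indicator (by fun_prop) (measurableSet_lt (by fun_prop) (by fun_prop))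
            _ ≤ ENNReal.ofReal ((m⁻¹) ^ (a / b * e)) * ENNReal.ofReal e⁻¹ * f y ^ a := by
                refine le_of_eq ?_
                rw [hwf, ENNReal.ofReal_rpow_of_nonneg (by positivity) he0.le,
                  ENNReal.ofReal_rpow_of_nonneg hw ha0.le, ← ENNReal.ofReal_mul (by positivity),
                  ← ENNReal.ofReal_mul hw, ← ENNReal.ofReal_mul (by positivity),
                  ← ENNReal.ofReal_mul (by positivity)]
                congr 1
                rw [← Real.rpow_mul hmw, Real.mul_rpow (by positivity) hw]
                have h3 : a / b * e = a - 1 := by rw [he]; field_simp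
                have h4 : w ^ a = w * w ^ (a - 1) := by
                  rcases hw.eq_or_lt with rfl | hw
                  · simp [Real.zero_rpow ha0.ne']
                  · rw [← Real.rpow_one_add' hw.le (by linarith)]
                    ring_nf
                rw [h4, h3]
                ring
      _ = ENNReal.ofReal ((m⁻¹) ^ (a / b * e)) * ENNReal.ofReal e⁻¹ * ∫⁻ y, f y ^ a :=
          lintegral_const_mul _ (by fun_prop)
      _ ≤ _ := by
          conv_rhs => rw [← mul_one (ENNReal.ofReal _ * ENNReal.ofReal _)]
          exact mul_le_mul' le_rfl hfa
  calc ∫⁻ x, rieszPotential γ f x ^ b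
      = ENNReal.ofReal b * ∫⁻ x, rieszPotential γ f x ^ b * ENNReal.ofReal b⁻¹ := by
        rw [lintegral_mul_const _ (by fun_prop), mul_comm (∫⁻ x, _), ← mul_assoc, hbinv, one_mul]
    _ ≤ ENNReal.ofReal b * ∫⁻ t in Ioi (0 : ℝ), ENNReal.ofReal D * (ENNReal.ofReal (t ^ (e - 1)) *
          ∫⁻ y, {y | ENNReal.ofReal (m * t ^ (b / a)) < f y}.indicator f y) :=
        mul_le_mul' le_rfl (hleft.trans (setLIntegral_mono' measurableSet_Ioi
          fun t ht => key f hf hfa t ht))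
    _ ≤ _ := by
        rw [lintegral_const_mul' _ _ ENNReal.ofReal_ne_top]
        exact mul_le_mul' le_rfl (mul_le_mul' le_rfl hright)

/-- The Hardy–Littlewood–Sobolev inequality. -/
theorem eLpNorm_rieszPotential_le {γ a b : ℝ} (hγ3 : γ < 3) (ha : 1 < a)
    (hb : 0 < b) (hab : 1 / b = 1 / a - 1 + γ / 3) :
    ∃ C : ℝ≥0∞, C ≠ ∞ ∧ ∀ f : R3 → ℝ≥0∞, Measurable f →
      eLpNorm (rieszPotential γ f) (ENNReal.ofReal b) volume ≤
        C * eLpNorm f (ENNReal.ofReal a) volume := by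
  obtain ⟨C, hC, h⟩ := lintegral_rpow_rieszPotential_le hγ3 ha hb hab
  have ha0 : 0 < a := by linarith
  have ea : ∀ f : R3 → ℝ≥0∞, eLpNorm f (ENNReal.ofReal a) volume = (∫⁻ x, f x ^ a) ^ (1 / a) := by
    intro f
    rw [eLpNorm_eq_lintegral_rpow_enorm_toReal (by simpa using ha0) ENNReal.ofReal_ne_top,
      ENNReal.toReal_ofReal ha0.le]
    simp
  have eb : ∀ f : R3 → ℝ≥0∞, eLpNorm f (ENNReal.ofReal b) volume = (∫⁻ x, f x ^ b) ^ (1 / b) := by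
    intro f
    rw [eLpNorm_eq_lintegral_rpow_enorm_toReal (by simpa using hb) ENNReal.ofReal_ne_top,
      ENNReal.toReal_ofReal hb.le]
    simp
  -- The summand 1 keeps the constant nonzero, so that the bound is trivial when the norm of f is
  -- infinite.
  refine ⟨C ^ (1 / b) + 1, ?_, fun f hf => ?_⟩
  · exact ENNReal.add_ne_top.2 ⟨ENNReal.rpow_ne_top_of_nonneg (by positivity) hC, ENNReal.one_ne_top⟩
  rw [ea, eb]
  set N := (∫⁻ x, f x ^ a) ^ (1 / a) with hN
  by_cases hN0 : N = 0
  · have h0 : ∀ᵐ y, f y = 0 := by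
      rw [hN, ENNReal.rpow_eq_zero_iff_of_pos (by positivity), lintegral_eq_zero_iff (by fun_prop)]
        at hN0
      filter_upwards [hN0] with y hy
      exact (ENNReal.rpow_eq_zero_iff_of_pos ha0).1 hy
    have h1 : ∀ x, rieszPotential γ f x = 0 := fun x => by
      unfold rieszPotential
      rw [lintegral_congr_ae (g := fun _ => 0)]
      · simp
      · filter_upwards [h0] with y hy
        rw [hy, mul_zero]
    simp [h1, ENNReal.zero_rpow_of_pos hb, hb]
  by_cases hNt : N = ∞
  · rw [hNt, ENNReal.mul_top (by simp)]
    exact le_top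
  have hscale : ∀ x, rieszPotential γ f x = N * rieszPotential γ (fun y => N⁻¹ * f y) x := by
    intro x
    unfold rieszPotential
    rw [← lintegral_const_mul' _ _ hNt]
    refine lintegral_congr fun y => ?_
    calc _ = (N * N⁻¹) * (rieszKernel γ (x - y) * f y) := by
          rw [ENNReal.mul_inv_cancel hN0 hNt, one_mul]
      _ = _ := by ring
  have hnorm : ∫⁻ y, (N⁻¹ * f y) ^ a ≤ 1 := by
    simp_rw [ENNReal.mul_rpow_of_nonneg _ _ ha0.le]
    rw [lintegral_const_mul _ (by fun_prop)]
    have : ∫⁻ x, f x ^ a = N ^ a := by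
      rw [hN, ← ENNReal.rpow_mul, one_div_mul_cancel ha0.ne', ENNReal.rpow_one]
    rw [this, ← ENNReal.mul_rpow_of_nonneg _ _ ha0.le, ENNReal.inv_mul_cancel hN0 hNt,
      ENNReal.one_rpow]
  have hgm : Measurable fun y => N⁻¹ * f y := by fun_prop
  simp_rw [hscale, ENNReal.mul_rpow_of_nonneg _ _ hb.le]
  rw [lintegral_const_mul _ ((measurable_rieszPotential γ hgm).pow_const b),
    ENNReal.mul_rpow_of_nonneg _ _ (by positivity), ← ENNReal.rpow_mul,
    mul_one_div_cancel hb.ne', ENNReal.rpow_one, mul_comm]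
  refine mul_le_mul' ?_ le_rfl
  exact (ENNReal.rpow_le_rpow (h _ hgm hnorm) (by positivity)).trans le_self_add

/-! ### The trilinear estimates -/

theorem riesz_congr {γ : ℝ} {f g : R3 → ℝ} (h : f =ᵐ[volume] g) (x : R3) :
    riesz γ f x = riesz γ g x := by
  refine integral_congr_ae ?_
  filter_upwards [h] with y hy
  rw [hy]

theorem RieszConverges.congr {γ : ℝ} {f g : R3 → ℝ} (hf : RieszConverges γ f)
    (h : f =ᵐ[volume] g) : RieszConverges γ g := by
  filter_upwards [hf] with x hx
  refine hx.congr ?_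
  filter_upwards [h] with y hy
  rw [hy]

theorem enorm_rieszKernel_mul (γ : ℝ) (f : R3 → ℝ) (x y : R3) :
    ‖‖x - y‖ ^ (-γ) * f y‖ₑ = rieszKernel γ (x - y) * ‖f y‖ₑ := by
  rw [enorm_mul, rieszKernel, Real.enorm_of_nonneg (by positivity)]

theorem enorm_riesz_le (γ : ℝ) (f : R3 → ℝ) (x : R3) :
    ‖riesz γ f x‖ₑ ≤ rieszPotential γ (fun y => ‖f y‖ₑ) x := by
  refine (enorm_integral_le_lintegral_enorm _).trans ?_
  simp_rw [enorm_rieszKernel_mul]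
  exact le_rfl

theorem stronglyMeasurable_riesz {γ : ℝ} {f : R3 → ℝ} (hf : StronglyMeasurable f) :
    StronglyMeasurable (riesz γ f) := by
  refine StronglyMeasurable.integral_prod_right'
    (f := fun p : R3 × R3 => ‖p.1 - p.2‖ ^ (-γ) * f p.2) ?_
  refine StronglyMeasurable.mul ?_ (hf.comp_measurable measurable_snd)
  exact Measurable.stronglyMeasurable (by fun_prop)

/-- The Riesz potential as a bounded operator between Lebesgue spaces. -/
theorem exists_rieszCLM {γ a b : ℝ} (hγ3 : γ < 3) (ha : 1 < a) (hb : 0 < b)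
    (hab : 1 / b = 1 / a - 1 + γ / 3) {pa pb : ℝ≥0∞} [Fact (1 ≤ pa)] [Fact (1 ≤ pb)]
    (hpa : pa = ENNReal.ofReal a) (hpb : pb = ENNReal.ofReal b) :
    ∃ J : Lp ℝ pa (volume : Measure R3) →L[ℝ] Lp ℝ pb (volume : Measure R3),
      ∀ f : Lp ℝ pa (volume : Measure R3), RieszConverges γ f ∧ J f =ᵐ[volume] riesz γ f := by
  obtain ⟨C, hC, h⟩ := eLpNorm_rieszPotential_le hγ3 ha hb hab
  rw [← hpa, ← hpb] at h
  have hpb0 : pb ≠ 0 := (zero_lt_one.trans_le (Fact.out : 1 ≤ pb)).ne'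
  have hbound : ∀ f : Lp ℝ pa (volume : Measure R3),
      eLpNorm (rieszPotential γ fun y => ‖f y‖ₑ) pb volume ≤ C * eLpNorm f pa volume := fun f => by
    have := h (fun y => ‖f y‖ₑ) (Lp.stronglyMeasurable f).enorm
    simpa using this
  have hmeas : ∀ f : Lp ℝ pa (volume : Measure R3),
      Measurable (rieszPotential γ fun y => ‖f y‖ₑ) := fun f =>
    measurable_rieszPotential γ (Lp.stronglyMeasurable f).enorm
  have hlt : ∀ f : Lp ℝ pa (volume : Measure R3),
      eLpNorm (rieszPotential γ fun y => ‖f y‖ₑ) pb volume < ∞ := fun f =>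
    (hbound f).trans_lt (ENNReal.mul_lt_top hC.lt_top (Lp.eLpNorm_lt_top f))
  -- The potential of |f| has finite L^b norm, hence is finite almost everywhere. This gives
  -- absolute convergence, without which the Bochner integral in `riesz` would not be additive.
  have hconv : ∀ f : Lp ℝ pa (volume : Measure R3), RieszConverges γ f := fun f => by
    have h1 : ∫⁻ x, (rieszPotential γ (fun y => ‖f y‖ₑ) x) ^ b < ∞ := by
      have := lintegral_rpow_enorm_lt_top_of_eLpNorm_lt_top hpb0 (by rw [hpb]; simp) (hlt f)
      rw [hpb, ENNReal.toReal_ofReal hb.le] at this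
      simpa using this
    have h2 := ae_lt_top ((hmeas f).pow_const b) h1.ne
    filter_upwards [h2] with x hx
    refine ⟨?_, ?_⟩
    · refine AEStronglyMeasurable.mul ?_ (Lp.aestronglyMeasurable f)
      exact Measurable.aestronglyMeasurable (by fun_prop)
    · rw [HasFiniteIntegral]
      simp_rw [enorm_rieszKernel_mul]
      by_contra hcon
      have : rieszPotential γ (fun y => ‖f y‖ₑ) x = ∞ := not_lt_top_iff.1 hcon
      rw [this, ENNReal.top_rpow_of_pos hb] at hx
      exact lt_irrefl _ hx
  have hle : ∀ f : Lp ℝ pa (volume : Measure R3),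
      eLpNorm (riesz γ f) pb volume ≤ C * eLpNorm f pa volume := fun f => by
    refine (eLpNorm_mono_enorm (g := rieszPotential γ fun y => ‖f y‖ₑ) fun x => ?_).trans (hbound f)
    simpa using enorm_riesz_le γ f x
  have hmem : ∀ f : Lp ℝ pa (volume : Measure R3), MemLp (riesz γ f) pb volume := fun f =>
    ⟨(stronglyMeasurable_riesz (Lp.stronglyMeasurable f)).aestronglyMeasurable,
      (hle f).trans_lt (ENNReal.mul_lt_top hC.lt_top (Lp.eLpNorm_lt_top f))⟩
  let L : Lp ℝ pa (volume : Measure R3) →ₗ[ℝ] Lp ℝ pb (volume : Measure R3) :=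
    { toFun := fun f => (hmem f).toLp _
      map_add' := fun f g => by
        rw [← MemLp.toLp_add]
        refine MemLp.toLp_congr _ _ ?_
        filter_upwards [hconv f, hconv g] with x hf hg
        rw [riesz_congr (Lp.coeFn_add f g)]
        simp only [Pi.add_apply, riesz, mul_add]
        exact integral_add hf hg
      map_smul' := fun c f => by
        rw [RingHom.id_apply, ← MemLp.toLp_const_smul]
        refine MemLp.toLp_congr _ _ (Eventually.of_forall fun x => ?_)
        rw [riesz_congr (Lp.coeFn_smul c f)]
        simp only [Pi.smul_apply, riesz, smul_eq_mul]
        rw [← integral_const_mul]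
        congr 1
        ext y
        ring }
  refine ⟨L.mkContinuous C.toReal fun f => ?_, fun f => ⟨hconv f, (hmem f).coeFn_toLp⟩⟩
  change ‖(hmem f).toLp _‖ ≤ _
  rw [Lp.norm_toLp, Lp.norm_def, ← ENNReal.toReal_mul]
  exact ENNReal.toReal_mono (ENNReal.mul_ne_top hC (Lp.eLpNorm_lt_top f).ne) (hle f)

/-- Hölder, then the Riesz potential, then Hölder again; as a composition of bounded (bi)linear maps
the result is automatically continuous and trilinear. -/
theorem exists_riesz_trilinear {γ a b : ℝ} (hγ3 : γ < 3) (ha : 1 < a) (hb : 0 < b)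
    (hab : 1 / b = 1 / a - 1 + γ / 3) {pa pb p₁ p₂ p₃ : ℝ≥0∞} [Fact (1 ≤ p₁)]
    [Fact (1 ≤ p₂)] [Fact (1 ≤ p₃)] (hpa : pa = ENNReal.ofReal a) (hpb : pb = ENNReal.ofReal b)
    (h1pb : 1 ≤ pb) [ENNReal.HolderTriple p₁ p₂ pa] [ENNReal.HolderTriple pb p₃ 2] :
    ∃ T : Lp ℝ p₁ (volume : Measure R3) →L[ℝ] Lp ℝ p₂ (volume : Measure R3) →L[ℝ]
        Lp ℝ p₃ (volume : Measure R3) →L[ℝ] L2,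
      ∀ f g h, RieszConverges γ (fun x => f x * g x) ∧
        T f g h =ᵐ[volume] fun x => riesz γ (fun y => f y * g y) x * h x := by
  have : Fact (1 ≤ pa) := ⟨by rw [hpa]; simpa using ha.le⟩
  have : Fact (1 ≤ pb) := ⟨h1pb⟩
  obtain ⟨J, hJ⟩ := exists_rieszCLM hγ3 ha hb hab hpa hpb
  let M₁ := (ContinuousLinearMap.mul ℝ ℝ).holderL (volume : Measure R3) p₁ p₂ pa
  let M₂ := (ContinuousLinearMap.mul ℝ ℝ).holderL (volume : Measure R3) pb p₃ 2
  let A := (ContinuousLinearMap.compL ℝ _ _ _ J).comp M₁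
  refine ⟨(ContinuousLinearMap.compL ℝ _ _ _ M₂).comp A, fun f g h => ?_⟩
  have h1 : M₁ f g =ᵐ[volume] fun x => f x * g x :=
    (ContinuousLinearMap.mul ℝ ℝ).coeFn_holder f g
  refine ⟨(hJ (M₁ f g)).1.congr h1, ?_⟩
  have h2 : M₂ (J (M₁ f g)) h =ᵐ[volume] fun x => J (M₁ f g) x * h x :=
    (ContinuousLinearMap.mul ℝ ℝ).coeFn_holder _ _
  refine EventuallyEq.trans h2 ?_
  filter_upwards [(hJ (M₁ f g)).2] with x hx
  rw [hx, riesz_congr h1]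

instance fact_one_le_six : Fact ((1 : ℝ≥0∞) ≤ 6) := ⟨by norm_num⟩

/-- The exponent `6 / (4 - γ)` of the Lebesgue space that contains `v(t)`. -/
def rhoExp (γ : ℝ) : ℝ≥0∞ := ENNReal.ofReal (6 / (4 - γ))

/-- Two factors in L^ρ and one in L⁶, with the L⁶ factor outside or inside the convolution. The
exponents follow 2/ρ = (4-γ)/3 ↦ 1/3, with 1/3 + 1/6 = 1/2, and 1/6 + 1/ρ = (5-γ)/6 ↦ (γ-1)/6, with
(γ-1)/6 + 1/ρ = 1/2, where the arrow adds γ/3 - 1. -/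
theorem exists_trilinear_pair {γ : ℝ} (hγ₂ : 2 < γ) (hγ₃ : γ < 3) [Fact (1 ≤ rhoExp γ)] :
    (∃ T : Lp ℝ (rhoExp γ) (volume : Measure R3) →L[ℝ] Lp ℝ (rhoExp γ) (volume : Measure R3) →L[ℝ]
        Lp ℝ 6 (volume : Measure R3) →L[ℝ] L2,
      ∀ f g h, RieszConverges γ (fun x => f x * g x) ∧
        T f g h =ᵐ[volume] fun x => riesz γ (fun y => f y * g y) x * h x) ∧
    ∃ T : Lp ℝ 6 (volume : Measure R3) →L[ℝ] Lp ℝ (rhoExp γ) (volume : Measure R3) →L[ℝ]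
        Lp ℝ (rhoExp γ) (volume : Measure R3) →L[ℝ] L2,
      ∀ f g h, RieszConverges γ (fun x => f x * g x) ∧
        T f g h =ᵐ[volume] fun x => riesz γ (fun y => f y * g y) x * h x := by
  have h4 : 0 < 4 - γ := by linarith
  have h5 : 0 < 5 - γ := by linarith
  have h1 : 0 < γ - 1 := by linarith
  have hr : (ENNReal.ofReal (6 / (4 - γ))).toReal = 6 / (4 - γ) :=
    ENNReal.toReal_ofReal (by positivity)
  constructor
  · have : ENNReal.HolderTriple (rhoExp γ) (rhoExp γ) (ENNReal.ofReal (3 / (4 - γ))) := by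
      refine ENNReal.HolderTriple.of_toReal ?_
      rw [rhoExp, hr, ENNReal.toReal_ofReal (by positivity)]
      exact ⟨by field_simp; norm_num, by positivity, by positivity⟩
    have : ENNReal.HolderTriple 3 6 2 := by
      refine ENNReal.HolderTriple.of_toReal ?_
      exact ⟨by norm_num, by norm_num, by norm_num⟩
    exact exists_riesz_trilinear (a := 3 / (4 - γ)) (b := 3) (pb := 3) hγ₃
      (by rw [lt_div_iff₀ h4]; linarith) (by norm_num) (by field_simp; ring) rfl (by simp)
      (by norm_num)
  · have : ENNReal.HolderTriple 6 (rhoExp γ) (ENNReal.ofReal (6 / (5 - γ))) := by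
      refine ENNReal.HolderTriple.of_toReal ?_
      rw [rhoExp, hr, ENNReal.toReal_ofReal (by positivity)]
      exact ⟨by simp; field_simp; ring, by norm_num, by positivity⟩
    have : ENNReal.HolderTriple (ENNReal.ofReal (6 / (γ - 1))) (rhoExp γ) 2 := by
      refine ENNReal.HolderTriple.of_toReal ?_
      rw [rhoExp, hr, ENNReal.toReal_ofReal (by positivity)]
      exact ⟨by simp; field_simp; ring, by positivity, by positivity⟩
    exact exists_riesz_trilinear (a := 6 / (5 - γ)) (b := 6 / (γ - 1)) hγ₃
      (by rw [lt_div_iff₀ h5]; linarith) (by positivity) (by field_simp; ring) rfl rfl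
      (by rw [ENNReal.one_le_ofReal, le_div_iff₀ h1]; linarith)

/-- Algebraic form of the nonlinearity: `N(u, v) = 𝓘((u + v)²) u + 𝓘(u (u + 2 v)) v`. -/
theorem nonlinearity_eq_of_integrable {γ : ℝ} {u v : R3 → ℝ} {x : R3}
    (huu : Integrable fun y => ‖x - y‖ ^ (-γ) * (u y ^ 2))
    (huv : Integrable fun y => ‖x - y‖ ^ (-γ) * (u y * v y))
    (hvv : Integrable fun y => ‖x - y‖ ^ (-γ) * (v y ^ 2)) :
    nonlinearity γ u v x = riesz γ (fun y => (u y + v y) * (u y + v y)) x * u x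
      + riesz γ (fun y => u y * (u y + 2 * v y)) x * v x := by
  have e1 : riesz γ (fun y => (u y + v y) * (u y + v y)) x = riesz γ (fun y => u y ^ 2) x +
      2 * riesz γ (fun y => u y * v y) x + riesz γ (fun y => v y ^ 2) x := by
    unfold riesz
    rw [← integral_const_mul]
    refine Eq.trans ?_ ((integral_add (huu.add (huv.const_mul 2)) hvv).trans
      (congrArg (· + _) (integral_add huu (huv.const_mul 2))))
    congr 1; ext y; simp only [Pi.add_apply]; ring
  have e2 : riesz γ (fun y => u y * (u y + 2 * v y)) x = riesz γ (fun y => u y ^ 2) x +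
      2 * riesz γ (fun y => u y * v y) x := by
    unfold riesz
    rw [← integral_const_mul, ← integral_add huu (huv.const_mul 2)]
    congr 1; ext y; ring
  rw [e1, e2, nonlinearity]
  ring

/-- In the two-term form the factor u stands outside the first convolution and inside the second. It
is therefore always available for the L⁶ slot. -/
theorem nonlinearity_ae_eq {γ : ℝ} {p q : ℝ≥0∞} [Fact (1 ≤ p)] [Fact (1 ≤ q)]
    {T₁ : Lp ℝ p (volume : Measure R3) →L[ℝ] Lp ℝ p (volume : Measure R3) →L[ℝ]
        Lp ℝ q (volume : Measure R3) →L[ℝ] L2}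
    {T₂ : Lp ℝ q (volume : Measure R3) →L[ℝ] Lp ℝ p (volume : Measure R3) →L[ℝ]
        Lp ℝ p (volume : Measure R3) →L[ℝ] L2}
    (hT₁ : ∀ f g h, RieszConverges γ (fun x => f x * g x) ∧
        T₁ f g h =ᵐ[volume] fun x => riesz γ (fun y => f y * g y) x * h x)
    (hT₂ : ∀ f g h, RieszConverges γ (fun x => f x * g x) ∧
        T₂ f g h =ᵐ[volume] fun x => riesz γ (fun y => f y * g y) x * h x)
    {u v : R3 → ℝ} {up vp : Lp ℝ p (volume : Measure R3)} {uq : Lp ℝ q (volume : Measure R3)}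
    (hup : up =ᵐ[volume] u) (huq : uq =ᵐ[volume] u) (hvp : vp =ᵐ[volume] v) :
    RieszConverges γ (fun x => u x ^ 2) ∧ RieszConverges γ (fun x => u x * v x) ∧
      RieszConverges γ (fun x => v x ^ 2) ∧
      ∀ᵐ x, (T₁ (up + vp) (up + vp) uq + T₂ uq (up + (2 : ℝ) • vp) vp : L2) x
        = nonlinearity γ u v x := by
  -- Convergence concerns only the first two arguments of the trilinear map, so the third may be 0.
  have huu : RieszConverges γ (fun x => u x ^ 2) := (hT₁ up up 0).1.congr (by
    filter_upwards [hup] with x hx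
    rw [hx, sq])
  have huv : RieszConverges γ (fun x => u x * v x) := (hT₁ up vp 0).1.congr (by
    filter_upwards [hup, hvp] with x hx hy
    rw [hx, hy])
  have hvv : RieszConverges γ (fun x => v x ^ 2) := (hT₁ vp vp 0).1.congr (by
    filter_upwards [hvp] with x hx
    rw [hx, sq])
  refine ⟨huu, huv, hvv, ?_⟩
  have e1 : (fun y => (up + vp : Lp ℝ p (volume : Measure R3)) y *
      (up + vp : Lp ℝ p (volume : Measure R3)) y) =ᵐ[volume]
      fun y => (u y + v y) * (u y + v y) := by
    filter_upwards [Lp.coeFn_add up vp, hup, hvp] with x h1 h2 h3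
    rw [h1, Pi.add_apply, h2, h3]
  have e2 : (fun y => uq y * (up + (2 : ℝ) • vp : Lp ℝ p (volume : Measure R3)) y) =ᵐ[volume]
      fun y => u y * (u y + 2 * v y) := by
    filter_upwards [Lp.coeFn_add up ((2 : ℝ) • vp), Lp.coeFn_smul (2 : ℝ) vp, hup, hvp, huq]
      with x h1 h2 h3 h4 h5
    rw [h1, Pi.add_apply, h2, Pi.smul_apply, h3, h4, h5, smul_eq_mul]
  filter_upwards [huu, huv, hvv, (hT₁ (up + vp) (up + vp) uq).2,
    (hT₂ uq (up + (2 : ℝ) • vp) vp).2, huq, hvp,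
    Lp.coeFn_add (T₁ (up + vp) (up + vp) uq) (T₂ uq (up + (2 : ℝ) • vp) vp)]
    with x h1 h2 h3 h4 h5 h6 h7 h8
  rw [h8, Pi.add_apply, h4, h5, riesz_congr e1, riesz_congr e2, h6, h7,
    nonlinearity_eq_of_integrable h1 h2 h3]

/-! ### Fourier multipliers on real `L²` -/

/-- The complex space `L²(ℝ³)`. -/
abbrev CL2 : Type := Lp ℂ 2 (volume : Measure R3)

theorem norm_ofReal_compLp (f : L2) : ‖Complex.ofRealCLM.compLp f‖ = ‖f‖ := by
  refine le_antisymm (Lp.norm_le_norm_of_ae_le ?_) (Lp.norm_le_norm_of_ae_le ?_)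
  all_goals
    filter_upwards [Complex.ofRealCLM.coeFn_compLp f] with x hx
    rw [hx]; simp

/-- The Fourier transform as a real linear isometry. -/
def fourierIso : L2 →ₗᵢ[ℝ] CL2 where
  toFun := fourierL2
  map_add' f g := by
    unfold fourierL2
    rw [← FourierTransform.fourier_add]
    congr 1
    exact (Complex.ofRealCLM.compLpₗ 2 volume).map_add f g
  map_smul' c f := by
    unfold fourierL2
    have : Complex.ofRealCLM.compLp (c • f) = (c : ℂ) • Complex.ofRealCLM.compLp f := by
      refine ((Complex.ofRealCLM.compLpₗ 2 volume).map_smul c f).trans ?_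
      refine Lp.ext ?_
      filter_upwards [Lp.coeFn_smul (c : ℂ) (Complex.ofRealCLM.compLp f),
        Lp.coeFn_smul c (Complex.ofRealCLM.compLp f)] with x h1 h2
      rw [h1]
      exact h2
    rw [this, FourierTransform.fourier_smul]
    refine Lp.ext ?_
    filter_upwards [Lp.coeFn_smul (c : ℂ) (𝓕 (Complex.ofRealCLM.compLp f)),
      Lp.coeFn_smul c (𝓕 (Complex.ofRealCLM.compLp f))] with x h1 h2
    rw [h1]
    exact h2.symm
  norm_map' f := by
    change ‖fourierL2 f‖ = _
    unfold fourierL2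
    rw [Lp.norm_fourier_eq, norm_ofReal_compLp]

theorem fourierIso_apply (f : L2) : fourierIso f = fourierL2 f := rfl

/-- Complex conjugation on `L²`. -/
def conjL : CL2 →L[ℝ] CL2 := (Complex.conjCLE : ℂ →L[ℝ] ℂ).compLpL 2 volume

theorem conjL_ae (g : CL2) : conjL g =ᵐ[volume] fun x => starRingEnd ℂ (g x) :=
  (Complex.conjCLE : ℂ →L[ℝ] ℂ).coeFn_compLpL g

/-- The reflection `g ↦ g(-·)` on `L²`. -/
def reflectL (g : CL2) : CL2 :=
  Lp.compMeasurePreserving (fun x : R3 => -x) (Measure.measurePreserving_neg volume) g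

theorem reflectL_ae (g : CL2) : reflectL g =ᵐ[volume] fun x => g (-x) :=
  Lp.coeFn_compMeasurePreserving g (Measure.measurePreserving_neg volume)

theorem continuous_reflectL : Continuous reflectL :=
  (Lp.isometry_compMeasurePreserving (Measure.measurePreserving_neg volume)).continuous

/-- For Schwartz functions this is conjugation under the Fourier integral; both sides are continuous
on L² and Schwartz functions are dense. -/
theorem fourier_conjL (g : CL2) : 𝓕 (conjL g) = conjL (reflectL (𝓕 g)) := by
  refine DenseRange.induction_on (p := fun g : CL2 => 𝓕 (conjL g) = conjL (reflectL (𝓕 g)))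
    (SchwartzMap.denseRange_toLpCLM (E := R3) (F := ℂ) (μ := volume) (p := 2)
      ENNReal.ofNat_ne_top) g ?_ ?_
  · refine isClosed_eq ?_ ?_
    · exact (Lp.fourierTransformₗᵢ R3 ℂ).continuous.comp conjL.continuous
    · exact conjL.continuous.comp (continuous_reflectL.comp (Lp.fourierTransformₗᵢ R3 ℂ).continuous)
  · intro f
    change 𝓕 (conjL (f.toLp 2 volume)) = conjL (reflectL (𝓕 (f.toLp 2 volume)))
    set h : 𝓢(R3, ℂ) := f.postcompCLM (Complex.conjCLE : ℂ →L[ℝ] ℂ) with hh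
    have h1 : conjL (f.toLp 2 volume) = h.toLp 2 volume := by
      refine Lp.ext ?_
      filter_upwards [conjL_ae (f.toLp 2 volume), f.coeFn_toLp 2 volume, h.coeFn_toLp 2 volume]
        with x e1 e2 e3
      rw [e1, e2, e3]
      rfl
    rw [h1, SchwartzMap.toLp_fourier_eq, SchwartzMap.toLp_fourier_eq]
    refine Lp.ext ?_
    have e3 : ∀ᵐ x : R3, ((𝓕 f).toLp 2 volume : CL2) (-x) = (𝓕 f) (-x) :=
      (Measure.measurePreserving_neg (volume : Measure R3)).quasiMeasurePreserving.ae
        ((𝓕 f).coeFn_toLp 2 volume)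
    filter_upwards [conjL_ae (reflectL ((𝓕 f).toLp 2 volume)),
      reflectL_ae ((𝓕 f).toLp 2 volume), e3, (𝓕 h).coeFn_toLp 2 volume] with x e1 e2 e3 e4
    rw [e1, e2, e3, e4, SchwartzMap.fourier_coe, SchwartzMap.fourier_coe, Real.fourier_eq,
      Real.fourier_eq, ← integral_conj]
    refine integral_congr_ae (Eventually.of_forall fun v => ?_)
    simp only [Circle.smul_def, smul_eq_mul, map_mul, inner_neg_right, neg_neg]
    congr 1
    rw [← Circle.coe_inv_eq_conj, ← AddChar.map_neg_eq_inv]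

/-- A function in `L²` is the Fourier transform of a real function if it is Hermitian. -/
theorem exists_fourierL2_eq {G : CL2} (hG : ∀ᵐ ξ : R3, G (-ξ) = starRingEnd ℂ (G ξ)) :
    ∃ g : L2, fourierL2 g = G := by
  set k : CL2 := 𝓕⁻ G with hk
  have hkG : 𝓕 k = G := FourierTransform.fourier_fourierInv_eq G
  have hconj : conjL k = k := by
    have : 𝓕 (conjL k) = 𝓕 k := by
      rw [fourier_conjL, hkG]
      refine Lp.ext ?_
      filter_upwards [conjL_ae (reflectL G), reflectL_ae G, hG] with ξ e1 e2 e3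
      rw [e1, e2, e3, Complex.conj_conj]
    exact (Lp.fourierTransformₗᵢ R3 ℂ).injective this
  refine ⟨Complex.reCLM.compLp k, ?_⟩
  unfold fourierL2
  rw [← hkG]
  congr 1
  refine Lp.ext ?_
  filter_upwards [Complex.ofRealCLM.coeFn_compLp (Complex.reCLM.compLp k),
    Complex.reCLM.coeFn_compLp k, conjL_ae k] with x e1 e2 e3
  rw [hconj] at e3
  rw [e1, e2]
  exact (Complex.conj_eq_iff_re.1 e3.symm)

theorem fourierL2_neg_ae (f : L2) :
    ∀ᵐ ξ : R3, fourierL2 f (-ξ) = starRingEnd ℂ (fourierL2 f ξ) := by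
  have h1 : conjL (Complex.ofRealCLM.compLp f) = Complex.ofRealCLM.compLp f := by
    refine Lp.ext ?_
    filter_upwards [conjL_ae (Complex.ofRealCLM.compLp f), Complex.ofRealCLM.coeFn_compLp f]
      with x e1 e2
    rw [e1, e2]
    simp
  have h2 := fourier_conjL (Complex.ofRealCLM.compLp f)
  rw [h1] at h2
  change fourierL2 f = conjL (reflectL (fourierL2 f)) at h2
  filter_upwards [conjL_ae (reflectL (fourierL2 f)), reflectL_ae (fourierL2 f)] with ξ e1 e2
  rw [← h2, e2] at e1
  rw [e1, Complex.conj_conj]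

/-- Bounded even real symbols. -/
structure IsSymbol (m : R3 → ℝ) (C : ℝ) : Prop where
  measurable : Measurable m
  even : ∀ ξ, m (-ξ) = m ξ
  bound : ∀ ξ, |m ξ| ≤ C

theorem IsSymbol.nonneg {m : R3 → ℝ} {C : ℝ} (hm : IsSymbol m C) : 0 ≤ C :=
  (abs_nonneg _).trans (hm.bound 0)

theorem memLp_ofReal_mul {m : R3 → ℝ} {C : ℝ} (hm : IsSymbol m C) (G : CL2) :
    MemLp (fun ξ => (m ξ : ℂ) * G ξ) 2 volume := by
  refine (Lp.memLp G).of_le_mul (c := C) ?_ (Eventually.of_forall fun ξ => ?_)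
  · exact (Complex.measurable_ofReal.comp hm.measurable).aestronglyMeasurable.mul
      (Lp.aestronglyMeasurable G)
  · rw [norm_mul, Complex.norm_real]
    exact mul_le_mul_of_nonneg_right (hm.bound ξ) (norm_nonneg _)

/-- A real even symbol preserves the Hermitian symmetry of f̂, so the multiplier stays within real
functions. The symbol may be unbounded, which is needed to invert `bessel` on H¹. -/
theorem exists_fourierL2_eq_mul {m : R3 → ℝ} (heven : ∀ ξ, m (-ξ) = m ξ)
    (f : L2) (hf : MemLp (fun ξ => (m ξ : ℂ) * fourierL2 f ξ) 2 volume) :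
    ∃ g : L2, fourierL2 g =ᵐ[volume] fun ξ => (m ξ : ℂ) * fourierL2 f ξ := by
  obtain ⟨g, hg⟩ := exists_fourierL2_eq (G := hf.toLp _) (by
    have h1 := hf.coeFn_toLp
    have h2 : ∀ᵐ ξ : R3, (hf.toLp _ : CL2) (-ξ) = (m (-ξ) : ℂ) * fourierL2 f (-ξ) :=
      (Measure.measurePreserving_neg (volume : Measure R3)).quasiMeasurePreserving.ae h1
    filter_upwards [h1, h2, fourierL2_neg_ae f] with ξ e1 e2 e3
    rw [e1, e2, e3, heven]
    simp)
  exact ⟨g, by rw [hg]; exact hf.coeFn_toLp⟩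

theorem exists_mult {m : R3 → ℝ} {C : ℝ} (hm : IsSymbol m C) :
    ∃ A : L2 →L[ℝ] L2, (∀ f, fourierL2 (A f) =ᵐ[volume] fun ξ => (m ξ : ℂ) * fourierL2 f ξ) ∧
      ∀ f, ‖A f‖ ≤ C * ‖f‖ := by
  choose A hA using fun f : L2 =>
    exists_fourierL2_eq_mul hm.even f (memLp_ofReal_mul hm (fourierL2 f))
  have hb : ∀ f, ‖A f‖ ≤ C * ‖f‖ := fun f => by
    rw [← fourierIso.norm_map (A f), ← fourierIso.norm_map f]
    refine Lp.norm_le_mul_norm_of_ae_le_mul ?_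
    filter_upwards [hA f] with ξ h
    rw [fourierIso_apply, fourierIso_apply, h, norm_mul, Complex.norm_real]
    exact mul_le_mul_of_nonneg_right (hm.bound ξ) (norm_nonneg _)
  let L : L2 →ₗ[ℝ] L2 :=
    { toFun := A
      map_add' := fun f g => by
        apply fourierIso.injective
        rw [map_add]
        refine Lp.ext ?_
        filter_upwards [hA (f + g), hA f, hA g, Lp.coeFn_add (fourierL2 f) (fourierL2 g),
          Lp.coeFn_add (fourierIso (A f)) (fourierIso (A g))] with ξ e1 e2 e3 e4 e5
        rw [e5, Pi.add_apply, fourierIso_apply, fourierIso_apply, fourierIso_apply, e1, e2, e3,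
          ← fourierIso_apply, map_add, fourierIso_apply, fourierIso_apply, e4, Pi.add_apply,
          mul_add]
      map_smul' := fun c f => by
        apply fourierIso.injective
        rw [RingHom.id_apply, map_smul]
        refine Lp.ext ?_
        filter_upwards [hA (c • f), hA f, Lp.coeFn_smul c (fourierL2 f),
          Lp.coeFn_smul c (fourierIso (A f))] with ξ e1 e2 e3 e4
        rw [e4, Pi.smul_apply, fourierIso_apply, fourierIso_apply, e1, e2, ← fourierIso_apply,
          map_smul, fourierIso_apply, e3, Pi.smul_apply, mul_smul_comm] }
  exact ⟨L.mkContinuous C hb, hA, hb⟩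

open Classical in
/-- The Fourier multiplier with symbol `m` on real `L²`. -/
def mult (m : R3 → ℝ) : L2 →L[ℝ] L2 :=
  if h : ∃ C, IsSymbol m C then (exists_mult h.choose_spec).choose else 0

theorem fourierL2_mult {m : R3 → ℝ} {C : ℝ} (hm : IsSymbol m C) (f : L2) :
    fourierL2 (mult m f) =ᵐ[volume] fun ξ => (m ξ : ℂ) * fourierL2 f ξ := by
  have h : ∃ C, IsSymbol m C := ⟨C, hm⟩
  rw [mult, dif_pos h]
  exact (exists_mult h.choose_spec).choose_spec.1 f

theorem eq_of_fourierL2_ae {f g : L2} (h : fourierL2 f =ᵐ[volume] fourierL2 g) : f = g :=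
  fourierIso.injective (Lp.ext h)

theorem norm_mult_le {m : R3 → ℝ} {C : ℝ} (hm : IsSymbol m C) (f : L2) :
    ‖mult m f‖ ≤ C * ‖f‖ := by
  rw [← fourierIso.norm_map (mult m f), ← fourierIso.norm_map f]
  refine Lp.norm_le_mul_norm_of_ae_le_mul ?_
  filter_upwards [fourierL2_mult hm f] with ξ h
  rw [fourierIso_apply, fourierIso_apply, h, norm_mul, Complex.norm_real]
  exact mul_le_mul_of_nonneg_right (hm.bound ξ) (norm_nonneg _)

theorem IsSymbol.mul {m n : R3 → ℝ} {C D : ℝ} (hm : IsSymbol m C) (hn : IsSymbol n D) :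
    IsSymbol (fun ξ => m ξ * n ξ) (C * D) where
  measurable := hm.measurable.mul hn.measurable
  even ξ := by rw [hm.even, hn.even]
  bound ξ := by
    rw [abs_mul]
    exact mul_le_mul (hm.bound ξ) (hn.bound ξ) (abs_nonneg _) hm.nonneg

theorem IsSymbol.sub {m n : R3 → ℝ} {C D : ℝ} (hm : IsSymbol m C) (hn : IsSymbol n D) :
    IsSymbol (fun ξ => m ξ - n ξ) (C + D) where
  measurable := hm.measurable.sub hn.measurable
  even ξ := by rw [hm.even, hn.even]
  bound ξ := (abs_sub _ _).trans (add_le_add (hm.bound ξ) (hn.bound ξ))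

theorem mult_mult {m n : R3 → ℝ} {C D : ℝ} (hm : IsSymbol m C) (hn : IsSymbol n D) (f : L2) :
    mult m (mult n f) = mult (fun ξ => m ξ * n ξ) f := by
  apply eq_of_fourierL2_ae
  filter_upwards [fourierL2_mult hm (mult n f), fourierL2_mult hn f,
    fourierL2_mult (hm.mul hn) f] with ξ e1 e2 e3
  rw [e1, e2, e3]
  push_cast
  ring

theorem mult_sub_apply {m n : R3 → ℝ} {C D : ℝ} (hm : IsSymbol m C) (hn : IsSymbol n D) (f : L2) :
    mult m f - mult n f = mult (fun ξ => m ξ - n ξ) f := by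
  apply eq_of_fourierL2_ae
  rw [← fourierIso_apply, map_sub, fourierIso_apply, fourierIso_apply]
  filter_upwards [fourierL2_mult hm f, fourierL2_mult hn f,
    fourierL2_mult (hm.sub hn) f, Lp.coeFn_sub (fourierL2 (mult m f)) (fourierL2 (mult n f))]
    with ξ e1 e2 e3 e4
  rw [e4, Pi.sub_apply, e1, e2, e3]
  push_cast
  ring

theorem smul_mult {m : R3 → ℝ} {C : ℝ} (hm : IsSymbol m C) (c : ℝ) (f : L2) :
    c • mult m f = mult (fun ξ => c * m ξ) f := by
  have hcm : IsSymbol (fun ξ => c * m ξ) (|c| * C) :=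
    ⟨hm.measurable.const_mul c, fun ξ => by rw [hm.even], fun ξ => by
      rw [abs_mul]; exact mul_le_mul_of_nonneg_left (hm.bound ξ) (abs_nonneg _)⟩
  apply eq_of_fourierL2_ae
  rw [← fourierIso_apply, map_smul, fourierIso_apply]
  filter_upwards [fourierL2_mult hm f, fourierL2_mult hcm f,
    Lp.coeFn_smul c (fourierL2 (mult m f))] with ξ e1 e2 e3
  rw [e3, Pi.smul_apply, e1, e2]
  push_cast
  rw [Complex.real_smul, mul_assoc]

theorem inner_mult_left {m : R3 → ℝ} {C : ℝ} (hm : IsSymbol m C) (f g : L2) :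
    inner ℝ (mult m f) g = inner ℝ f (mult m g) := by
  have key : ∀ a b : L2, inner ℝ a b = (∫ ξ, inner ℝ (fourierL2 a ξ) (fourierL2 b ξ)) := by
    intro a b
    have h1 := fourierIso.inner_map_map a b
    rw [← h1]
    exact L2.inner_def _ _
  rw [key, key]
  refine integral_congr_ae ?_
  filter_upwards [fourierL2_mult hm f, fourierL2_mult hm g] with ξ e1 e2
  rw [e1, e2, ← Complex.real_smul, ← Complex.real_smul, real_inner_smul_left,
    real_inner_smul_right]

theorem enorm_sq_eq_lintegral (f : L2) : ‖f‖ₑ ^ 2 = ∫⁻ ξ, ‖fourierL2 f ξ‖ₑ ^ 2 := by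
  have h : ‖f‖ₑ = eLpNorm (fourierL2 f) 2 volume := by
    rw [← Lp.enorm_def, ← fourierIso_apply, ← ofReal_norm, ← ofReal_norm, fourierIso.norm_map]
  rw [h, eLpNorm_eq_lintegral_rpow_enorm_toReal (by norm_num) (by norm_num)]
  rw [← ENNReal.rpow_natCast, ← ENNReal.rpow_mul]
  simp

/-- Dominated convergence for Fourier multipliers. -/
theorem tendsto_mult {ι : Type*} {l : Filter ι} [l.IsCountablyGenerated] {m : ι → R3 → ℝ}
    {n : R3 → ℝ} {C : ℝ} (hm : ∀ᶠ i in l, IsSymbol (m i) C) (hn : IsSymbol n C)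
    (hlim : ∀ ξ, Tendsto (fun i => m i ξ) l (𝓝 (n ξ))) (f : L2) :
    Tendsto (fun i => mult (m i) f) l (𝓝 (mult n f)) := by
  rw [tendsto_iff_edist_tendsto_0]
  have h1 : Tendsto (fun i => edist (mult (m i) f) (mult n f) ^ 2) l (𝓝 0) := by
    have h2 : Tendsto (fun i => ∫⁻ ξ : R3, ‖((m i ξ - n ξ : ℝ) : ℂ) * fourierL2 f ξ‖ₑ ^ 2) l
        (𝓝 (∫⁻ _ : R3, 0)) := by
      -- Both symbols are bounded by C, so (2C)²|f̂|² dominates.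
      refine tendsto_lintegral_filter_of_dominated_convergence
        (fun ξ => (ENNReal.ofReal (C + C)) ^ 2 * ‖fourierL2 f ξ‖ₑ ^ 2) ?_ ?_ ?_ ?_
      · filter_upwards [hm] with i hi
        have : Measurable fun ξ => ((m i ξ - n ξ : ℝ) : ℂ) * fourierL2 f ξ :=
          (Complex.measurable_ofReal.comp (hi.measurable.sub hn.measurable)).mul
            (Lp.stronglyMeasurable (fourierL2 f)).measurable
        exact this.enorm.pow_const 2
      · filter_upwards [hm] with i hi
        refine Eventually.of_forall fun ξ => ?_
        simp only [enorm_mul, mul_pow]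
        refine mul_le_mul' (pow_le_pow_left' ?_ 2) le_rfl
        rw [← ofReal_norm, Complex.norm_real]
        exact ENNReal.ofReal_le_ofReal ((hi.sub hn).bound ξ)
      · rw [lintegral_const_mul' _ _ (by simp), ← enorm_sq_eq_lintegral]
        exact ENNReal.mul_ne_top (by simp) (by simp)
      · refine Eventually.of_forall fun ξ => ?_
        have : Tendsto (fun i => ‖((m i ξ - n ξ : ℝ) : ℂ) * fourierL2 f ξ‖ₑ ^ 2) l
            (𝓝 (‖((n ξ - n ξ : ℝ) : ℂ) * fourierL2 f ξ‖ₑ ^ 2)) := by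
          refine ENNReal.Tendsto.pow (Tendsto.enorm ?_)
          refine Tendsto.mul_const _ ?_
          exact (Complex.continuous_ofReal.tendsto _).comp ((hlim ξ).sub_const _)
        simpa using this
    rw [lintegral_zero] at h2
    refine h2.congr' ?_
    filter_upwards [hm] with i hi
    rw [edist_eq_enorm_sub, mult_sub_apply hi hn, enorm_sq_eq_lintegral]
    refine lintegral_congr_ae ?_
    filter_upwards [fourierL2_mult (hi.sub hn) f] with ξ e
    rw [e]
  have h3 := h1.ennrpow_const (1 / 2)
  have e0 : ((0 : ℝ≥0∞) ^ (1 / 2 : ℝ)) = 0 := by simp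
  rw [e0] at h3
  refine h3.congr fun i => ?_
  rw [← ENNReal.rpow_natCast, ← ENNReal.rpow_mul]
  norm_num

theorem continuous_mult {m : ℝ → R3 → ℝ} {C : ℝ} (hm : ∀ t, IsSymbol (m t) C)
    (hc : ∀ ξ, Continuous fun t => m t ξ) (f : L2) : Continuous fun t => mult (m t) f :=
  continuous_iff_continuousAt.2 fun t =>
    tendsto_mult (Eventually.of_forall hm) (hm t) (fun ξ => (hc ξ).tendsto t) f

/-- The difference quotients are multipliers whose symbols are bounded by C, by the mean value
inequality, and converge pointwise to m'. Dominated convergence finishes. The bound D only makes the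
multipliers themselves bounded. -/
theorem hasDerivAt_mult {m m' : ℝ → R3 → ℝ} {C D : ℝ} (hm : ∀ t, IsSymbol (m t) D)
    (hm' : ∀ t, IsSymbol (m' t) C) (hd : ∀ ξ t, HasDerivAt (fun t => m t ξ) (m' t ξ) t)
    (f : L2) (t : ℝ) : HasDerivAt (fun t => mult (m t) f) (mult (m' t) f) t := by
  rw [hasDerivAt_iff_tendsto_slope]
  have h1 : ∀ s, slope (fun t => mult (m t) f) t s
      = mult (fun ξ => (s - t)⁻¹ * (m s ξ - m t ξ)) f := fun s => by
    rw [slope_def_module, mult_sub_apply (hm s) (hm t), smul_mult ((hm s).sub (hm t))]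
  simp_rw [funext h1]
  refine tendsto_mult (C := C) ?_ (hm' t) (fun ξ => ?_) f
  · filter_upwards [self_mem_nhdsWithin] with s hs
    refine ⟨((hm s).measurable.sub (hm t).measurable).const_mul _, fun ξ => by
      rw [(hm s).even, (hm t).even], fun ξ => ?_⟩
    have := convex_univ.norm_image_sub_le_of_norm_hasDerivWithin_le (f := fun t => m t ξ)
      (f' := fun t => m' t ξ) (C := C) (x := t) (y := s)
      (fun x _ => (hd ξ x).hasDerivWithinAt) (fun x _ => (hm' x).bound ξ) (mem_univ _) (mem_univ _)
    rw [abs_mul, abs_inv, inv_mul_le_iff₀ (abs_pos.2 (sub_ne_zero.2 hs)), mul_comm]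
    exact this
  · have := (hasDerivAt_iff_tendsto_slope.1 (hd ξ t))
    refine this.congr fun s => ?_
    rw [slope_def_module, smul_eq_mul]

/-! ### The Klein–Gordon propagators -/

/-- The symbol `(1 + |ξ|²)^(1/2)`, where the frequency is `2πξ`. -/
def omega (ξ : R3) : ℝ := (1 + (2 * Real.pi * ‖ξ‖) ^ 2) ^ ((1 : ℝ) / 2)

theorem one_le_omega (ξ : R3) : 1 ≤ omega ξ :=
  Real.one_le_rpow (by nlinarith [sq_nonneg (2 * Real.pi * ‖ξ‖)]) (by norm_num)

theorem omega_pos (ξ : R3) : 0 < omega ξ := one_pos.trans_le (one_le_omega ξ)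

theorem omega_sq (ξ : R3) : omega ξ ^ 2 = 1 + (2 * Real.pi * ‖ξ‖) ^ 2 := by
  rw [omega, ← Real.rpow_natCast, ← Real.rpow_mul (by positivity)]
  norm_num

theorem measurable_omega : Measurable omega := by unfold omega; fun_prop

theorem omega_neg (ξ : R3) : omega (-ξ) = omega ξ := by simp [omega]

theorem isSymbol_cos (t : ℝ) : IsSymbol (fun ξ => Real.cos (t * omega ξ)) 1 where
  measurable := Real.measurable_cos.comp (measurable_omega.const_mul t)
  even ξ := by rw [omega_neg]
  bound ξ := Real.abs_cos_le_one _

theorem isSymbol_sin (t : ℝ) : IsSymbol (fun ξ => Real.sin (t * omega ξ)) 1 where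
  measurable := Real.measurable_sin.comp (measurable_omega.const_mul t)
  even ξ := by rw [omega_neg]
  bound ξ := Real.abs_sin_le_one _

theorem isSymbol_bessel : IsSymbol (fun ξ => (omega ξ)⁻¹) 1 where
  measurable := measurable_omega.inv
  even ξ := by rw [omega_neg]
  bound ξ := by
    rw [abs_of_pos (inv_pos.2 (omega_pos ξ))]
    exact inv_le_one_of_one_le₀ (one_le_omega ξ)

/-- `cos (t (1 - Δ)^(1/2))`. -/
def kgCos (t : ℝ) : L2 →L[ℝ] L2 := mult fun ξ => Real.cos (t * omega ξ)

/-- `sin (t (1 - Δ)^(1/2))`. -/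
def kgSin (t : ℝ) : L2 →L[ℝ] L2 := mult fun ξ => Real.sin (t * omega ξ)

/-- `(1 - Δ)^(-1/2)`. -/
def bessel : L2 →L[ℝ] L2 := mult fun ξ => (omega ξ)⁻¹

theorem fourierL2_kgCos (t : ℝ) (f : L2) : fourierL2 (kgCos t f) =ᵐ[volume]
    fun ξ => (Real.cos (t * omega ξ) : ℂ) * fourierL2 f ξ := fourierL2_mult (isSymbol_cos t) f

theorem fourierL2_kgSin (t : ℝ) (f : L2) : fourierL2 (kgSin t f) =ᵐ[volume]
    fun ξ => (Real.sin (t * omega ξ) : ℂ) * fourierL2 f ξ := fourierL2_mult (isSymbol_sin t) f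

theorem fourierL2_bessel (f : L2) : fourierL2 (bessel f) =ᵐ[volume]
    fun ξ => (((omega ξ)⁻¹ : ℝ) : ℂ) * fourierL2 f ξ := fourierL2_mult isSymbol_bessel f

theorem norm_kgCos_le (t : ℝ) (f : L2) : ‖kgCos t f‖ ≤ ‖f‖ :=
  (norm_mult_le (isSymbol_cos t) f).trans_eq (one_mul _)

theorem norm_kgSin_le (t : ℝ) (f : L2) : ‖kgSin t f‖ ≤ ‖f‖ :=
  (norm_mult_le (isSymbol_sin t) f).trans_eq (one_mul _)

theorem continuous_kgCos (f : L2) : Continuous fun t => kgCos t f :=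
  continuous_mult isSymbol_cos (fun ξ => by fun_prop) f

theorem continuous_kgSin (f : L2) : Continuous fun t => kgSin t f :=
  continuous_mult isSymbol_sin (fun ξ => by fun_prop) f

theorem inner_kgCos (t : ℝ) (f g : L2) : inner ℝ (kgCos t f) g = inner ℝ f (kgCos t g) :=
  inner_mult_left (isSymbol_cos t) f g

theorem inner_kgSin (t : ℝ) (f g : L2) : inner ℝ (kgSin t f) g = inner ℝ f (kgSin t g) :=
  inner_mult_left (isSymbol_sin t) f g

theorem inner_bessel (f g : L2) : inner ℝ (bessel f) g = inner ℝ f (bessel g) :=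
  inner_mult_left isSymbol_bessel f g

theorem kgCos_kgSin_comm (s t : ℝ) (f : L2) : kgCos t (kgSin s f) = kgSin s (kgCos t f) := by
  unfold kgCos kgSin
  rw [mult_mult (isSymbol_cos t) (isSymbol_sin s), mult_mult (isSymbol_sin s) (isSymbol_cos t)]
  simp_rw [mul_comm]

theorem kgCos_zero (f : L2) : kgCos 0 f = f := by
  apply eq_of_fourierL2_ae
  filter_upwards [fourierL2_kgCos 0 f] with ξ e
  rw [e]
  simp

theorem kgSin_zero (f : L2) : kgSin 0 f = 0 := by
  apply eq_of_fourierL2_ae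
  rw [← fourierIso_apply 0, map_zero]
  filter_upwards [fourierL2_kgSin 0 f, Lp.coeFn_zero ℂ 2 (volume : Measure R3)]
    with ξ e e0
  rw [e, e0]
  simp

theorem kgSin_sub (t s : ℝ) (f : L2) :
    kgSin (t - s) f = kgSin t (kgCos s f) - kgCos t (kgSin s f) := by
  unfold kgCos kgSin
  rw [mult_mult (isSymbol_sin t) (isSymbol_cos s), mult_mult (isSymbol_cos t) (isSymbol_sin s),
    mult_sub_apply ((isSymbol_sin t).mul (isSymbol_cos s)) ((isSymbol_cos t).mul (isSymbol_sin s))]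
  simp_rw [sub_mul, Real.sin_sub]

theorem kgCos_sq_add_kgSin_sq (t : ℝ) (f : L2) : kgCos t (kgCos t f) + kgSin t (kgSin t f) = f := by
  apply eq_of_fourierL2_ae
  rw [← fourierIso_apply, map_add, fourierIso_apply, fourierIso_apply]
  filter_upwards [fourierL2_kgCos t f, fourierL2_kgSin t f,
    fourierL2_kgCos t (kgCos t f), fourierL2_kgSin t (kgSin t f),
    Lp.coeFn_add (fourierL2 (kgCos t (kgCos t f))) (fourierL2 (kgSin t (kgSin t f)))]
    with ξ e1 e2 e3 e4 e5
  rw [e5, Pi.add_apply, e3, e4, e1, e2, ← mul_assoc, ← mul_assoc,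
    ← add_mul, ← Complex.ofReal_mul, ← Complex.ofReal_mul, ← Complex.ofReal_add, ← sq, ← sq,
    Real.cos_sq_add_sin_sq]
  simp

/-- A time derivative costs one factor ω, which `bessel` absorbs: after one smoothing the
propagators are norm differentiable on all of L². -/
theorem hasDerivAt_kgCos_bessel (f : L2) (t : ℝ) :
    HasDerivAt (fun t => kgCos t (bessel f)) (-(kgSin t f)) t := by
  have h := hasDerivAt_mult (m := fun t ξ => Real.cos (t * omega ξ) * (omega ξ)⁻¹)
    (m' := fun t ξ => (-1) * Real.sin (t * omega ξ)) (C := 1) (D := 1 * 1)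
    (fun t => (isSymbol_cos t).mul isSymbol_bessel)
    (fun t => ⟨(isSymbol_sin t).measurable.const_mul _, fun ξ => by rw [omega_neg], fun ξ => by
      rw [abs_mul, abs_neg, abs_one, one_mul]; exact (isSymbol_sin t).bound ξ⟩)
    (fun ξ t => by
      have h1 : HasDerivAt (fun t => t * omega ξ) (omega ξ) t := by
        simpa using (hasDerivAt_id t).mul_const (omega ξ)
      have := (h1.cos).mul_const (omega ξ)⁻¹
      convert! this using 1
      rw [mul_assoc, mul_inv_cancel₀ (omega_pos ξ).ne']
      ring) f t
  rw [← smul_mult (isSymbol_sin t), neg_one_smul] at h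
  simp_rw [← mult_mult (isSymbol_cos _) isSymbol_bessel] at h
  exact h

theorem hasDerivAt_kgSin_bessel (f : L2) (t : ℝ) :
    HasDerivAt (fun t => kgSin t (bessel f)) (kgCos t f) t := by
  have h := hasDerivAt_mult (m := fun t ξ => Real.sin (t * omega ξ) * (omega ξ)⁻¹)
    (m' := fun t ξ => Real.cos (t * omega ξ)) (C := 1) (D := 1 * 1)
    (fun t => (isSymbol_sin t).mul isSymbol_bessel) isSymbol_cos
    (fun ξ t => by
      have h1 : HasDerivAt (fun t => t * omega ξ) (omega ξ) t := by
        simpa using (hasDerivAt_id t).mul_const (omega ξ)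
      have := (h1.sin).mul_const (omega ξ)⁻¹
      convert! this using 1
      rw [mul_assoc, mul_inv_cancel₀ (omega_pos ξ).ne', mul_one]) f t
  simp_rw [← mult_mult (isSymbol_sin _) isSymbol_bessel] at h
  exact h

/-! ### Frequency cut-offs -/

theorem isSymbol_cutoff (n : ℕ) : IsSymbol (fun ξ => if omega ξ ≤ n then 1 else 0) 1 where
  measurable := Measurable.ite (measurableSet_le measurable_omega measurable_const)
    measurable_const measurable_const
  even ξ := by rw [omega_neg]
  bound ξ := by split_ifs <;> simp

theorem isSymbol_cutoff_omega_sq (n : ℕ) :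
    IsSymbol (fun ξ => if omega ξ ≤ n then omega ξ ^ 2 else 0) (n ^ 2) where
  measurable := Measurable.ite (measurableSet_le measurable_omega measurable_const)
    (measurable_omega.pow_const 2) measurable_const
  even ξ := by rw [omega_neg]
  bound ξ := by
    split_ifs with h
    · rw [abs_of_nonneg (by positivity)]
      exact pow_le_pow_left₀ (omega_pos ξ).le h 2
    · simp

/-- The projection onto the frequencies with `(1 + |ξ|²)^(1/2) ≤ n`. -/
def freqCut (n : ℕ) : L2 →L[ℝ] L2 := mult fun ξ => if omega ξ ≤ n then 1 else 0

/-- The operator `1 - Δ`, restricted to the frequencies with `(1 + |ξ|²)^(1/2) ≤ n`. -/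
def freqCutHelmholtz (n : ℕ) : L2 →L[ℝ] L2 := mult fun ξ => if omega ξ ≤ n then omega ξ ^ 2 else 0

/-- Cutting the frequencies makes 1 - Δ bounded while it still inverts (1 - Δ)^(-1) on what remains.
This reduces weak uniqueness to an ODE. -/
theorem freqCutHelmholtz_bessel_bessel (n : ℕ) (f : L2) :
    freqCutHelmholtz n (bessel (bessel f)) = freqCut n f := by
  unfold freqCutHelmholtz bessel freqCut
  rw [mult_mult isSymbol_bessel isSymbol_bessel,
    mult_mult (isSymbol_cutoff_omega_sq n) (isSymbol_bessel.mul isSymbol_bessel)]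
  congr 2
  ext ξ
  have := (omega_pos ξ).ne'
  split_ifs
  · field_simp
  · simp

theorem freqCutHelmholtz_freqCut (n : ℕ) (f : L2) :
    freqCutHelmholtz n (freqCut n f) = freqCutHelmholtz n f := by
  unfold freqCutHelmholtz freqCut
  rw [mult_mult (isSymbol_cutoff_omega_sq n) (isSymbol_cutoff n)]
  congr 2
  ext ξ
  split_ifs <;> simp

theorem eq_zero_of_freqCut_eq_zero {f : L2} (h : ∀ n, freqCut n f = 0) : f = 0 := by
  apply eq_of_fourierL2_ae
  rw [← fourierIso_apply 0, map_zero]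
  have h1 : ∀ n : ℕ, ∀ᵐ ξ : R3, omega ξ ≤ n → fourierL2 f ξ = 0 := fun n => by
    have h2 := fourierL2_mult (isSymbol_cutoff n) f
    change fourierL2 (freqCut n f) =ᵐ[volume] _ at h2
    rw [h n, ← fourierIso_apply, map_zero] at h2
    filter_upwards [h2, Lp.coeFn_zero ℂ 2 (volume : Measure R3)] with ξ e1 e2 hξ
    rw [e2] at e1
    simpa [hξ] using e1.symm
  filter_upwards [ae_all_iff.2 h1, Lp.coeFn_zero ℂ 2 (volume : Measure R3)] with ξ e1 e2
  obtain ⟨n, hn⟩ := exists_nat_ge (omega ξ)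
  rw [e1 n hn, e2]
  rfl

/-! ### The space `H¹` -/

theorem sobolevENorm_one_bessel (g : L2) : sobolevENorm 1 (bessel g) = ‖g‖ₑ := by
  have h : eLpNorm (fourierL2 g) 2 volume = ‖g‖ₑ := by
    rw [← Lp.enorm_def, ← fourierIso_apply, ← ofReal_norm, ← ofReal_norm, fourierIso.norm_map]
  rw [← h, sobolevENorm]
  refine eLpNorm_congr_ae ?_
  filter_upwards [fourierL2_bessel g] with ξ e
  rw [e, ← mul_assoc, ← Complex.ofReal_mul]
  -- The weight of the norm of H¹ is `omega` by definition.
  change ((omega ξ * (omega ξ)⁻¹ : ℝ) : ℂ) * _ = _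
  rw [mul_inv_cancel₀ (omega_pos ξ).ne']
  simp

theorem exists_bessel_eq {f : L2} (hf : sobolevENorm 1 f < ∞) : ∃ g, bessel g = f := by
  have hmem : MemLp (fun ξ => (omega ξ : ℂ) * fourierL2 f ξ) 2 volume := by
    refine ⟨?_, hf⟩
    exact (Complex.measurable_ofReal.comp measurable_omega).aestronglyMeasurable.mul
      (Lp.aestronglyMeasurable _)
  obtain ⟨g, hg⟩ := exists_fourierL2_eq_mul omega_neg f hmem
  refine ⟨g, eq_of_fourierL2_ae ?_⟩
  filter_upwards [hg, fourierL2_bessel g] with ξ e1 e2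
  rw [e2, e1, ← mul_assoc, ← Complex.ofReal_mul, inv_mul_cancel₀ (omega_pos ξ).ne']
  simp

theorem continuousIntoSobolev_one_bessel {I : Set ℝ} {g : ℝ → L2} (hg : ContinuousOn g I) :
    ContinuousIntoSobolev 1 I fun t => bessel (g t) := by
  refine ⟨fun t _ => ?_, fun t ht => ?_⟩
  · rw [sobolevENorm_one_bessel]; exact enorm_lt_top
  · simp_rw [← map_sub, sobolevENorm_one_bessel, ← edist_eq_enorm_sub]
    exact tendsto_iff_edist_tendsto_0.1 (hg t ht)

/-- As `bessel` is an isometry of L² onto H¹, continuity of u in H¹ is continuity of its preimage in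
L². -/
theorem ContinuousIntoSobolev.exists_bessel_eq {I : Set ℝ} {u : ℝ → L2}
    (hu : ContinuousIntoSobolev 1 I u) :
    ∃ g : ℝ → L2, ContinuousOn g I ∧ ∀ t ∈ I, u t = bessel (g t) := by
  have h : ∀ t, ∃ g, t ∈ I → u t = bessel g := fun t => by
    by_cases ht : t ∈ I
    · obtain ⟨g, hg⟩ := KleinGordonHartree.exists_bessel_eq (hu.1 t ht)
      exact ⟨g, fun _ => hg.symm⟩
    · exact ⟨0, fun h => absurd h ht⟩
  choose g hg using h
  refine ⟨g, fun t ht => ?_, hg⟩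
  rw [ContinuousWithinAt, tendsto_iff_edist_tendsto_0]
  refine (hu.2 t ht).congr' ?_
  filter_upwards [self_mem_nhdsWithin] with s hs
  rw [hg s hs, hg t ht, ← map_sub, sobolevENorm_one_bessel, edist_eq_enorm_sub]

/-! ### Schwartz test functions -/

theorem fourier_laplacian_apply (f : 𝓢(R3, ℂ)) (ξ : R3) :
    𝓕 (Δ f) ξ = ((-(2 * Real.pi * ‖ξ‖) ^ 2 : ℝ) : ℂ) * 𝓕 f ξ := by
  rw [SchwartzMap.laplacian_eq_fourierMultiplierCLM, FourierTransform.fourier_smul,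
    SchwartzMap.fourierMultiplierCLM_apply, FourierTransform.fourier_fourierInv_eq,
    smul_apply, SchwartzMap.smulLeftCLM_apply_apply (by fun_prop)]
  simp only [Complex.real_smul]
  push_cast
  ring

theorem fourier_sub_schwartz (f g : 𝓢(R3, ℂ)) : 𝓕 (f - g) = 𝓕 f - 𝓕 g :=
  (FourierTransform.fourierCLM ℂ 𝓢(R3, ℂ)).map_sub f g

theorem laplacian_postcompCLM {F G : Type*} [NormedAddCommGroup F] [NormedSpace ℝ F]
    [NormedAddCommGroup G] [NormedSpace ℝ G] (L : F →L[ℝ] G) (f : 𝓢(R3, F)) :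
    Δ (f.postcompCLM L) = (Δ f).postcompCLM L := by
  ext x
  rw [SchwartzMap.laplacian_apply, SchwartzMap.postcompCLM_apply, SchwartzMap.laplacian_apply]
  exact ((f.smooth 2).contDiffAt).laplacian_CLM_comp_left

theorem fourierL2_toLp (ψ : 𝓢(R3, ℝ)) :
    fourierL2 (ψ.toLp 2 volume) =ᵐ[volume]
    fun ξ => 𝓕 (ψ.postcompCLM Complex.ofRealCLM) ξ := by
  have h : Complex.ofRealCLM.compLp (ψ.toLp 2 volume)
      = (ψ.postcompCLM Complex.ofRealCLM).toLp 2 volume := by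
    refine Lp.ext ?_
    filter_upwards [Complex.ofRealCLM.coeFn_compLp (ψ.toLp 2 volume), ψ.coeFn_toLp 2 volume,
      (ψ.postcompCLM Complex.ofRealCLM).coeFn_toLp 2 volume] with x e1 e2 e3
    rw [e1, e2, e3]
    rfl
  rw [fourierL2, h, SchwartzMap.toLp_fourier_eq]
  exact SchwartzMap.coeFn_toLp _ 2 volume

/-- `ψ - Δψ` as an element of `L²`. -/
def helmholtz (ψ : 𝓢(R3, ℝ)) : L2 := (ψ - Δ ψ).toLp 2 volume

/-- Thanks to this identity the weak formulation involves only bounded operators: with h = ψ - Δψ,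
pairing with ψ is pairing with (1 - Δ)^(-1) h, and pairing with Δψ - ψ is pairing with -h. -/
theorem bessel_bessel_helmholtz (ψ : 𝓢(R3, ℝ)) :
    bessel (bessel (helmholtz ψ)) = ψ.toLp 2 volume := by
  apply eq_of_fourierL2_ae
  filter_upwards [fourierL2_bessel (helmholtz ψ),
    fourierL2_bessel (bessel (helmholtz ψ)), fourierL2_toLp ψ,
    fourierL2_toLp (ψ - Δ ψ)] with ξ e1 e2 e3 e4
  rw [e2, e1, e3, helmholtz, e4, map_sub, ← laplacian_postcompCLM,
    fourier_sub_schwartz, sub_apply, fourier_laplacian_apply]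
  have h1 : (omega ξ : ℂ) ^ 2 = 1 + (2 * Real.pi * ‖ξ‖) ^ 2 := by
    exact_mod_cast congrArg (fun x : ℝ => (x : ℂ)) (omega_sq ξ)
  have h2 : (omega ξ : ℂ) ≠ 0 := by exact_mod_cast (omega_pos ξ).ne'
  push_cast
  field_simp
  rw [h1]
  ring

theorem integral_mul_eq_inner (u : L2) (ψ : 𝓢(R3, ℝ)) :
    ∫ x, u x * ψ x = inner ℝ u (ψ.toLp 2 volume) := by
  rw [L2.inner_def]
  refine integral_congr_ae ?_
  filter_upwards [ψ.coeFn_toLp 2 volume] with x e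
  rw [e]
  simp [mul_comm]

theorem integral_mul_laplacian_sub (u : L2) (ψ : 𝓢(R3, ℝ)) :
    ∫ x, u x * (Δ ψ x - ψ x) = -inner ℝ u (helmholtz ψ) := by
  rw [helmholtz, ← integral_mul_eq_inner, ← integral_neg]
  congr 1
  ext x
  rw [sub_apply]
  ring

/-- 1 - Δ is onto the Schwartz class: its inverse multiplies the Fourier transform by (1 +
|2πξ|²)^(-1), a function of temperate growth. The solution found is complex, and taking the real
part commutes with Δ. -/
theorem exists_helmholtz_eq (φ : 𝓢(R3, ℝ)) : ∃ ψ, helmholtz ψ = φ.toLp 2 volume := by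
  set φc := φ.postcompCLM Complex.ofRealCLM with hφc
  have hg : Function.HasTemperateGrowth fun ξ : R3 => (1 + ‖(2 * Real.pi) • ξ‖ ^ 2) ^ (-1 : ℝ) := by
    have h1 := Function.hasTemperateGrowth_one_add_norm_sq_rpow R3 (-1)
    have h2 : Function.HasTemperateGrowth fun ξ : R3 => (2 * Real.pi) • ξ :=
      ((2 * Real.pi) • ContinuousLinearMap.id ℝ R3).hasTemperateGrowth
    exact h1.comp h2
  set ψc : 𝓢(R3, ℂ) := 𝓕⁻ (SchwartzMap.smulLeftCLM ℂ
    (fun ξ : R3 => (1 + ‖(2 * Real.pi) • ξ‖ ^ 2) ^ (-1 : ℝ)) (𝓕 φc)) with hψc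
  have key : ψc - Δ ψc = φc := by
    have h1 : 𝓕 (ψc - Δ ψc) = 𝓕 φc := by
      ext ξ
      rw [fourier_sub_schwartz, sub_apply, fourier_laplacian_apply, hψc,
        FourierTransform.fourier_fourierInv_eq, SchwartzMap.smulLeftCLM_apply_apply hg,
        Complex.real_smul, Real.rpow_neg_one, norm_smul, Real.norm_of_nonneg (by positivity)]
      have h2 : ((1 + (2 * Real.pi * ‖ξ‖) ^ 2 : ℝ) : ℂ) ≠ 0 := by
        exact_mod_cast (by positivity : (1 + (2 * Real.pi * ‖ξ‖) ^ 2 : ℝ) ≠ 0)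
      have h3 : (((1 + (2 * Real.pi * ‖ξ‖) ^ 2)⁻¹ : ℝ) : ℂ) = ((1 + (2 * Real.pi * ‖ξ‖) ^ 2 : ℝ) : ℂ)⁻¹ :=
        Complex.ofReal_inv _
      have h4 : ((-(2 * Real.pi * ‖ξ‖) ^ 2 : ℝ) : ℂ)
          = 1 - ((1 + (2 * Real.pi * ‖ξ‖) ^ 2 : ℝ) : ℂ) := by push_cast; ring
      rw [h3, h4, sub_mul, one_mul, mul_inv_cancel_left₀ h2, sub_sub_cancel]
    have h2 := congrArg (fun f : 𝓢(R3, ℂ) => 𝓕⁻ f) h1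
    simpa [FourierTransform.fourierInv_fourier_eq] using h2
  refine ⟨ψc.postcompCLM Complex.reCLM, ?_⟩
  rw [helmholtz]
  congr 1
  rw [laplacian_postcompCLM, ← map_sub, key]
  ext x
  simp [hφc]

/-- By surjectivity of 1 - Δ on Schwartz functions, the functions ψ - Δψ are dense in L². -/
theorem eq_zero_of_inner_helmholtz {z : L2} (h : ∀ ψ, inner ℝ z (helmholtz ψ) = 0) : z = 0 := by
  have h1 : ∀ f : L2, inner ℝ z f = 0 := fun f => by
    refine DenseRange.induction_on (p := fun f : L2 => inner ℝ z f = 0)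
      (SchwartzMap.denseRange_toLpCLM (E := R3) (F := ℝ) (μ := volume) (p := 2)
      ENNReal.ofNat_ne_top) f (isClosed_eq (by fun_prop) continuous_const) fun φ => ?_
    obtain ⟨ψ, hψ⟩ := exists_helmholtz_eq φ
    rw [SchwartzMap.toLpCLM_apply, ← hψ]
    exact h ψ
  exact inner_self_eq_zero.1 (h1 z)

attribute [irreducible] kgCos kgSin bessel freqCut freqCutHelmholtz

/-! ### Integration by parts and Gronwall's inequality -/

section Abstract

variable {E : Type*} [NormedAddCommGroup E] [InnerProductSpace ℝ E]

theorem intervalIntegrable_inner_of_continuous {H k : ℝ → E} (hH : Integrable H)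
    (hk : Continuous k) (a b : ℝ) :
    IntervalIntegrable (fun s => inner ℝ (H s) (k s)) volume a b := by
  rw [intervalIntegrable_iff]
  obtain ⟨M, hM⟩ := (isCompact_uIcc (a := a) (b := b)).exists_bound_of_continuousOn hk.continuousOn
  refine Integrable.mono' (g := fun s => ‖H s‖ * M) (hH.norm.mul_const M).integrableOn
    ((hH.1.inner hk.aestronglyMeasurable).restrict) ?_
  filter_upwards [ae_restrict_mem measurableSet_uIoc] with s hs
  exact (norm_inner_le_norm _ _).trans
    (mul_le_mul_of_nonneg_left (hM s (uIoc_subset_uIcc hs)) (norm_nonneg _))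

theorem continuous_primitive_of_integrable {H : ℝ → E} (hH : Integrable H) :
    Continuous fun t => ∫ s in (0 : ℝ)..t, H s :=
  intervalIntegral.continuous_primitive (fun _ _ => hH.intervalIntegrable) 0

/-- Strong continuity and a bound uniform in t give joint continuity, and with it the measurability
of s ↦ A s (F s). -/
theorem continuous_uncurry_of_contraction {A : ℝ → E →L[ℝ] E} (hA : ∀ t f, ‖A t f‖ ≤ ‖f‖)
    (hc : ∀ f, Continuous fun t => A t f) : Continuous fun p : ℝ × E => A p.1 p.2 :=
  continuous_prod_of_continuous_lipschitzWith' (fun p : ℝ × E => A p.1 p.2) 1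
    (fun t => LipschitzWith.of_dist_le_mul fun f g => by
      rw [dist_eq_norm, ← map_sub, dist_eq_norm, NNReal.coe_one, one_mul]
      exact hA t _) fun f => hc f

theorem integrable_apply_of_contraction {A : ℝ → E →L[ℝ] E} (hA : ∀ t f, ‖A t f‖ ≤ ‖f‖)
    (hc : ∀ f, Continuous fun t => A t f) {F : ℝ → E} (hF : Integrable F) :
    Integrable fun s => A s (F s) :=
  hF.mono ((continuous_uncurry_of_contraction hA hc).comp_aestronglyMeasurable
    (aestronglyMeasurable_id.prodMk hF.1)) (Eventually.of_forall fun s => hA s _)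

theorem continuous_apply_primitive {A : ℝ → E →L[ℝ] E} (hA : ∀ t f, ‖A t f‖ ≤ ‖f‖)
    (hc : ∀ f, Continuous fun t => A t f) (e : E) {H : ℝ → E} (hH : Integrable H) :
    Continuous fun t => A t (e + ∫ s in (0 : ℝ)..t, H s) :=
  (continuous_uncurry_of_contraction hA hc).comp
    (continuous_id.prodMk (continuous_const.add (continuous_primitive_of_integrable hH)))

variable [CompleteSpace E]

theorem inner_intervalIntegral_left {f : ℝ → E} {a b : ℝ} (hf : IntervalIntegrable f volume a b)
    (c : E) : inner ℝ (∫ x in a..b, f x) c = ∫ x in a..b, inner ℝ (f x) c := by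
  rw [real_inner_comm, ← innerSL_apply_apply ℝ, ← (innerSL ℝ c).intervalIntegral_comp_comm hf]
  simp_rw [innerSL_apply_apply, real_inner_comm]

theorem inner_intervalIntegral_right {f : ℝ → E} {a b : ℝ} (hf : IntervalIntegrable f volume a b)
    (c : E) : inner ℝ c (∫ x in a..b, f x) = ∫ x in a..b, inner ℝ c (f x) := by
  rw [← innerSL_apply_apply ℝ, ← (innerSL ℝ c).intervalIntegral_comp_comm hf]
  simp_rw [innerSL_apply_apply]

/-- H is only integrable, so its primitive need not be differentiable at every point. Instead both
sides are compared by Fubini on the triangle r ≤ s ≤ t, and the fundamental theorem of calculus is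
applied to k alone. -/
theorem inner_primitive_eq {H k k' : ℝ → E} (hH : Integrable H)
    (hk : ∀ t, HasDerivAt k (k' t) t) (hk' : Continuous k') {t : ℝ} (ht : 0 ≤ t) :
    inner ℝ (∫ s in (0 : ℝ)..t, H s) (k t) = (∫ s in (0 : ℝ)..t, inner ℝ (H s) (k s)) +
      ∫ s in (0 : ℝ)..t, inner ℝ (∫ r in (0 : ℝ)..s, H r) (k' s) := by
  have hkc : Continuous k := continuous_iff_continuousAt.2 fun t => (hk t).continuousAt
  have hftc : ∀ r, r ∈ Ioc 0 t → ∫ s in r..t, k' s = k t - k r := fun r _ =>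
    intervalIntegral.integral_eq_sub_of_hasDerivAt (fun x _ => hk x) (hk'.intervalIntegrable _ _)
  have e1 : ∫ s in (0 : ℝ)..t, inner ℝ (∫ r in (0 : ℝ)..s, H r) (k' s)
      = ∫ s in Ioc 0 t, ∫ r in Ioc 0 t, (if r ≤ s then inner ℝ (H r) (k' s) else 0) := by
    rw [intervalIntegral.integral_of_le ht]
    refine setIntegral_congr_fun measurableSet_Ioc fun s hs => ?_
    rw [inner_intervalIntegral_left hH.intervalIntegrable, intervalIntegral.integral_of_le hs.1.le]
    have : (fun r => if r ≤ s then inner ℝ (H r) (k' s) else 0)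
        = (Iic s).indicator fun r => inner ℝ (H r) (k' s) := by
      ext r; simp [indicator]
    rw [this, setIntegral_indicator measurableSet_Iic, Ioc_inter_Iic, min_eq_right hs.2]
  have e2 : ∫ s in Ioc 0 t, ∫ r in Ioc 0 t, (if r ≤ s then inner ℝ (H r) (k' s) else 0)
      = ∫ r in Ioc 0 t, ∫ s in Ioc 0 t, (if r ≤ s then inner ℝ (H r) (k' s) else 0) := by
    refine integral_integral_swap ?_
    obtain ⟨M, hM⟩ := (isCompact_Icc (a := (0 : ℝ)) (b := t)).exists_bound_of_continuousOn
      hk'.continuousOn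
    have hd : Integrable (fun p : ℝ × ℝ => M * ‖H p.2‖)
        ((volume.restrict (Ioc 0 t)).prod (volume.restrict (Ioc 0 t))) := by
      have : Integrable (fun _ : ℝ => M) (volume.restrict (Ioc 0 t)) := integrable_const M
      exact this.mul_prod hH.norm.restrict
    refine hd.mono' ?_ ?_
    · have h1 : AEStronglyMeasurable (fun p : ℝ × ℝ => inner ℝ (H p.2) (k' p.1))
          ((volume.restrict (Ioc 0 t)).prod (volume.restrict (Ioc 0 t))) :=
        (hH.1.restrict.comp_snd).inner (hk'.comp continuous_fst).aestronglyMeasurable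
      have h2 : MeasurableSet {p : ℝ × ℝ | p.2 ≤ p.1} :=
        measurableSet_le measurable_snd measurable_fst
      refine (h1.indicator h2).congr (Eventually.of_forall fun p => ?_)
      simp [indicator, Function.uncurry]
    · have h1 : ∀ᵐ p : ℝ × ℝ ∂((volume.restrict (Ioc 0 t)).prod (volume.restrict (Ioc 0 t))),
          p ∈ Ioc 0 t ×ˢ Ioc 0 t := by
        rw [Measure.prod_restrict]
        exact ae_restrict_mem (measurableSet_Ioc.prod measurableSet_Ioc)
      filter_upwards [h1] with p hp
      have hM' := hM p.1 (Ioc_subset_Icc_self hp.1)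
      simp only [Function.uncurry]
      split_ifs
      · rw [mul_comm]
        exact (norm_inner_le_norm _ _).trans (mul_le_mul_of_nonneg_left hM' (norm_nonneg _))
      · rw [norm_zero]
        exact mul_nonneg ((norm_nonneg _).trans hM') (norm_nonneg _)
  have e3 : ∫ r in Ioc 0 t, ∫ s in Ioc 0 t, (if r ≤ s then inner ℝ (H r) (k' s) else 0)
      = ∫ r in (0 : ℝ)..t, (inner ℝ (H r) (k t) - inner ℝ (H r) (k r)) := by
    rw [intervalIntegral.integral_of_le ht]
    refine setIntegral_congr_fun measurableSet_Ioc fun r hr => ?_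
    have : (fun s => if r ≤ s then inner ℝ (H r) (k' s) else 0)
        = (Ici r).indicator fun s => inner ℝ (H r) (k' s) := by
      ext s; simp [indicator]
    have hset : Ioc 0 t ∩ Ici r = Icc r t := by
      ext s
      simp only [mem_inter_iff, mem_Ioc, mem_Ici, mem_Icc]
      exact ⟨fun h => ⟨h.2, h.1.2⟩, fun h => ⟨⟨hr.1.trans_le h.1, h.2⟩, h.1⟩⟩
    rw [this, setIntegral_indicator measurableSet_Ici, hset, integral_Icc_eq_integral_Ioc,
      ← intervalIntegral.integral_of_le hr.2,
      ← inner_intervalIntegral_right (hk'.intervalIntegrable _ _), hftc r hr, inner_sub_right]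
  rw [e1, e2, e3, intervalIntegral.integral_sub
    (intervalIntegrable_inner_of_continuous hH continuous_const 0 t)
    (intervalIntegrable_inner_of_continuous hH hkc 0 t),
    ← inner_intervalIntegral_left hH.intervalIntegrable]
  ring

/-- Integration by parts for a primitive of an integrable function and a `C¹` function. -/
theorem inner_add_primitive_eq {H k k' : ℝ → E} (hH : Integrable H)
    (hk : ∀ t, HasDerivAt k (k' t) t) (hk' : Continuous k') (e : E) {t : ℝ} (ht : 0 ≤ t) :
    inner ℝ (e + ∫ s in (0 : ℝ)..t, H s) (k t) = inner ℝ e (k 0) +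
      (∫ s in (0 : ℝ)..t, inner ℝ (H s) (k s)) +
      ∫ s in (0 : ℝ)..t, inner ℝ (e + ∫ r in (0 : ℝ)..s, H r) (k' s) := by
  have h1 : k t = k 0 + ∫ s in (0 : ℝ)..t, k' s := by
    rw [intervalIntegral.integral_eq_sub_of_hasDerivAt (fun x _ => hk x)
      (hk'.intervalIntegrable _ _)]
    abel
  have h2 : inner ℝ e (k t) = inner ℝ e (k 0) + ∫ s in (0 : ℝ)..t, inner ℝ e (k' s) := by
    rw [h1, inner_add_right, inner_intervalIntegral_right (hk'.intervalIntegrable _ _)]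
  have hc := continuous_primitive_of_integrable hH
  simp_rw [inner_add_left]
  rw [h2, inner_primitive_eq hH hk hk' ht, intervalIntegral.integral_add]
  · ring
  · exact (continuous_const.inner hk').intervalIntegrable _ _
  · exact (hc.inner hk').intervalIntegrable _ _

theorem intervalIntegral_clm_sub_clm {A B : E →L[ℝ] E} {H K : ℝ → E} (hH : Integrable H)
    (hK : Integrable K) (a b : ℝ) : ∫ s in a..b, (A (H s) - B (K s)) =
      A (∫ s in a..b, H s) - B (∫ s in a..b, K s) := by
  rw [← A.intervalIntegral_comp_comm hH.intervalIntegrable,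
    ← B.intervalIntegral_comp_comm hK.intervalIntegrable]
  exact intervalIntegral.integral_sub (A.integrable_comp hH).intervalIntegrable
    (B.integrable_comp hK).intervalIntegrable

end Abstract

/-- A form of Gronwall's inequality with an integrable weight. -/
theorem eq_zero_of_le_integral_mul {φ w : ℝ → ℝ} {T : ℝ} (hφ : ContinuousOn φ (Icc 0 T))
    (hφ0 : ∀ t ∈ Icc 0 T, 0 ≤ φ t) (hw : IntegrableOn w (Icc 0 T)) (hw0 : ∀ t, 0 ≤ w t)
    (h : ∀ t ∈ Icc 0 T, φ t ≤ ∫ s in (0 : ℝ)..t, w s * φ s) : ∀ t ∈ Icc 0 T, φ t = 0 := by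
  rcases lt_or_ge T 0 with hT | hT
  · intro t ht
    exact absurd (ht.1.trans ht.2) (not_le.2 hT)
  set W : ℝ → ℝ := (Icc 0 T).indicator w with hW
  have hWi : Integrable W := (integrable_indicator_iff measurableSet_Icc).2 hw
  have hW0 : ∀ t, 0 ≤ W t := fun t => indicator_nonneg (fun t _ => hw0 t) t
  have hWφ : Integrable ((Icc 0 T).indicator fun s : ℝ => w s * φ s) := by
    rw [integrable_indicator_iff measurableSet_Icc]
    exact hw.mul_continuousOn hφ isCompact_Icc
  set m : ℝ → ℝ := fun t => ∫ s in (0 : ℝ)..t, (Icc (0 : ℝ) T).indicator (fun s : ℝ => w s * φ s) s with hm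
  have hpos : ∀ s, 0 ≤ (Icc (0 : ℝ) T).indicator (fun s : ℝ => w s * φ s) s := fun s =>
    indicator_nonneg (fun s hs => mul_nonneg (hw0 s) (hφ0 s hs)) s
  have hmc : Continuous m := continuous_primitive_of_integrable hWφ
  have hmon : ∀ a b, a ≤ b → m a ≤ m b := fun a b hab => by
    have : m b - m a = ∫ s in a..b, (Icc (0 : ℝ) T).indicator (fun s : ℝ => w s * φ s) s :=
      intervalIntegral.integral_interval_sub_left hWφ.intervalIntegrable hWφ.intervalIntegrable
    have h2 := intervalIntegral.integral_nonneg hab (μ := volume) fun s _ => hpos s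
    linarith
  have hle : ∀ t ∈ Icc 0 T, φ t ≤ m t := fun t ht => by
    refine (h t ht).trans_eq ?_
    refine intervalIntegral.integral_congr fun s hs => ?_
    rw [uIcc_of_le ht.1] at hs
    have hsT : s ∈ Icc 0 T := ⟨hs.1, hs.2.trans ht.2⟩
    simp [hsT]
  -- Continuous induction. From x with m(x) = 0 move to z with ∫ₓᶻ w < 1/2. At the maximum p of φ on
  -- [x, z] one has φ(p) ≤ m(p) ≤ m(z) ≤ φ(p)/2, so φ(p) = 0 and m(z) = 0.
  have key : Icc 0 T ⊆ {t | m t = 0} := by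
    refine IsClosed.Icc_subset_of_forall_exists_gt
      ((isClosed_singleton.preimage hmc).inter isClosed_Icc) (by simp only [hm]; exact intervalIntegral.integral_same) ?_
    rintro x ⟨hx, hx0, hxT⟩ y hy
    have hWc : Continuous fun t => ∫ s in x..t, W s :=
      intervalIntegral.continuous_primitive (fun _ _ => hWi.intervalIntegrable) x
    have hev : ∀ᶠ t in 𝓝[>] x, ∫ s in x..t, W s < 1 / 2 := by
      have h1 : Tendsto (fun t => ∫ s in x..t, W s) (𝓝[>] x) (𝓝 (∫ s in x..x, W s)) :=
        (hWc.tendsto x).mono_left nhdsWithin_le_nhds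
      rw [intervalIntegral.integral_same] at h1
      exact h1.eventually (gt_mem_nhds (by norm_num))
    have hev2 : ∀ᶠ t in 𝓝[>] x, t ∈ Ioc x (min y T) :=
      Ioc_mem_nhdsGT (lt_min hy hxT)
    obtain ⟨z, hz1, hz2, hz3⟩ := (hev.and hev2).exists
    have hzT : z ≤ T := hz3.trans (min_le_right _ _)
    have hsub : Icc x z ⊆ Icc 0 T := fun t ht => ⟨hx0.trans ht.1, ht.2.trans hzT⟩
    obtain ⟨p, hp, hpmax⟩ := isCompact_Icc.exists_isMaxOn (nonempty_Icc.2 hz2.le)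
      (hφ.mono hsub)
    have hmz : m z ≤ 1 / 2 * φ p := by
      have e1 : m z = ∫ s in x..z, (Icc (0 : ℝ) T).indicator (fun s : ℝ => w s * φ s) s := by
        rw [← intervalIntegral.integral_interval_sub_left (a := 0) hWφ.intervalIntegrable
          hWφ.intervalIntegrable]
        have : m x = 0 := hx
        simp only [hm] at this ⊢
        rw [this, sub_zero]
      have e2 : ∫ s in x..z, (Icc (0 : ℝ) T).indicator (fun s : ℝ => w s * φ s) s
          ≤ ∫ s in x..z, W s * φ p := by
        refine intervalIntegral.integral_mono_on hz2.le hWφ.intervalIntegrable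
          (hWi.mul_const _).intervalIntegrable fun s hs => ?_
        simp only [hW]
        rw [indicator_of_mem (hsub hs), indicator_of_mem (hsub hs)]
        exact mul_le_mul_of_nonneg_left (hpmax hs) (hw0 s)
      rw [e1]
      refine e2.trans ?_
      rw [intervalIntegral.integral_mul_const]
      exact mul_le_mul_of_nonneg_right hz1.le (hφ0 p (hsub hp))
    have hmp : φ p ≤ 1 / 2 * φ p := (hle p (hsub hp)).trans ((hmon p z hp.2).trans hmz)
    have hp0 : φ p = 0 := le_antisymm (by linarith) (hφ0 p (hsub hp))
    have hm0 : 0 ≤ m z := by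
      have h1 := hmon x z hz2.le
      have h2 : m x = 0 := hx
      rwa [h2] at h1
    refine ⟨z, le_antisymm (by rw [hp0] at hmz; linarith) hm0, hz2, hz3.trans (min_le_left _ _)⟩
  intro t ht
  exact le_antisymm ((hle t ht).trans_eq (key ht)) (hφ0 t ht)

/-! ### The Duhamel formula -/

theorem continuous_kgSin_uncurry : Continuous fun p : ℝ × L2 => kgSin p.1 p.2 :=
  continuous_uncurry_of_contraction norm_kgSin_le continuous_kgSin

theorem integrable_kgCos {F : ℝ → L2} (hF : Integrable F) : Integrable fun s => kgCos s (F s) :=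
  integrable_apply_of_contraction norm_kgCos_le continuous_kgCos hF

theorem integrable_kgSin {F : ℝ → L2} (hF : Integrable F) : Integrable fun s => kgSin s (F s) :=
  integrable_apply_of_contraction norm_kgSin_le continuous_kgSin hF

/-- The energy-space profile `(1 - Δ)^(1/2) u(t)` of the solution of the linear Klein–Gordon
equation with source `-F`. -/
def mild (g₀ u₁ : L2) (F : ℝ → L2) (t : ℝ) : L2 :=
  kgCos t (g₀ + ∫ s in (0 : ℝ)..t, kgSin s (F s)) +
    kgSin t (u₁ + ∫ s in (0 : ℝ)..t, -kgCos s (F s))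

/-- The addition formula for sin((t-s)ω) links the usual Duhamel integral to the definition, whose
integrands do not depend on t. The usual form gives estimates, the other one continuity and
integration by parts. -/
theorem mild_eq {g₀ u₁ : L2} {F : ℝ → L2} (hF : Integrable F) (t : ℝ) :
    mild g₀ u₁ F t = kgCos t g₀ + kgSin t u₁ - ∫ s in (0 : ℝ)..t, kgSin (t - s) (F s) := by
  have h1 : ∫ s in (0 : ℝ)..t, kgSin (t - s) (F s)
      = kgSin t (∫ s in (0 : ℝ)..t, kgCos s (F s)) - kgCos t (∫ s in (0 : ℝ)..t, kgSin s (F s)) := by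
    simp_rw [kgSin_sub]
    exact intervalIntegral_clm_sub_clm (integrable_kgCos hF) (integrable_kgSin hF) 0 t
  rw [mild, h1, intervalIntegral.integral_neg, map_add, map_add, map_neg]
  abel

theorem continuous_mild (g₀ u₁ : L2) {F : ℝ → L2} (hF : Integrable F) :
    Continuous (mild g₀ u₁ F) := by
  exact (continuous_apply_primitive norm_kgCos_le continuous_kgCos g₀ (integrable_kgSin hF)).add
    (continuous_apply_primitive norm_kgSin_le continuous_kgSin u₁
      (H := fun s => -kgCos s (F s)) (integrable_kgCos hF).neg)

/-- The energy estimate: as the sine propagators are contractions, the L¹ norm in time of the source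
controls the profile uniformly. -/
theorem norm_mild_sub_le (g₀ u₁ : L2) {F G : ℝ → L2} (hF : Integrable F) (hG : Integrable G)
    {t : ℝ} (ht : 0 ≤ t) :
    ‖mild g₀ u₁ F t - mild g₀ u₁ G t‖ ≤ ∫ s in (0 : ℝ)..t, ‖F s - G s‖ := by
  have hi : ∀ {H : ℝ → L2}, Integrable H →
      IntervalIntegrable (fun s => kgSin (t - s) (H s)) volume 0 t := fun {H} hH => by
    refine Integrable.intervalIntegrable (hH.mono ?_
      (Eventually.of_forall fun s => norm_kgSin_le (t - s) _))
    exact continuous_kgSin_uncurry.comp_aestronglyMeasurable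
      ((continuous_const.sub continuous_id).aestronglyMeasurable.prodMk hH.1)
  rw [mild_eq hF, mild_eq hG, sub_sub_sub_cancel_left, ← intervalIntegral.integral_sub (hi hG) (hi hF)]
  refine intervalIntegral.norm_integral_le_of_norm_le ht (Eventually.of_forall fun s _ => ?_)
    (hF.sub hG).norm.intervalIntegrable
  rw [← map_sub, norm_sub_rev (F s)]
  exact norm_kgSin_le _ _

theorem norm_mild_le (g₀ u₁ : L2) {F : ℝ → L2} (hF : Integrable F) {t : ℝ} (ht : 0 ≤ t) :
    ‖mild g₀ u₁ F t‖ ≤ ‖g₀‖ + ‖u₁‖ + ∫ s in (0 : ℝ)..t, ‖F s‖ := by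
  have h1 := norm_mild_sub_le g₀ u₁ hF (integrable_zero ℝ L2 volume) ht
  have h2 : mild g₀ u₁ 0 t = kgCos t g₀ + kgSin t u₁ := by simp [mild]
  have h3 : ‖kgCos t g₀ + kgSin t u₁‖ ≤ ‖g₀‖ + ‖u₁‖ :=
    (norm_add_le _ _).trans (add_le_add (norm_kgCos_le t _) (norm_kgSin_le t _))
  rw [h2] at h1
  simp only [Pi.zero_apply, sub_zero] at h1
  have h4 := norm_sub_norm_le (mild g₀ u₁ F t) (kgCos t g₀ + kgSin t u₁)
  linarith

theorem mild_zero (g₀ u₁ : L2) (F : ℝ → L2) : mild g₀ u₁ F 0 = g₀ := by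
  simp [mild, kgCos_zero, kgSin_zero]

theorem inner_mild (g₀ u₁ : L2) (F : ℝ → L2) (t : ℝ) (f : L2) :
    inner ℝ (mild g₀ u₁ F t) f = inner ℝ (g₀ + ∫ s in (0 : ℝ)..t, kgSin s (F s)) (kgCos t f) +
      inner ℝ (u₁ + ∫ s in (0 : ℝ)..t, -kgCos s (F s)) (kgSin t f) := by
  rw [mild, inner_add_left, inner_kgCos, inner_kgSin]

/-- The Duhamel formula solves the equation in the sense of distributions. -/
theorem hasDerivWithinAt_inner_mild {g₀ u₁ : L2} {F : ℝ → L2} (hF : Integrable F) (h : L2)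
    {t : ℝ} (ht : 0 ≤ t) :
    HasDerivWithinAt (fun s => inner ℝ (bessel (mild g₀ u₁ F s)) (bessel (bessel h)))
      (inner ℝ u₁ (bessel (bessel h)) + ∫ τ in (0 : ℝ)..t,
        (-inner ℝ (bessel (mild g₀ u₁ F τ)) h - inner ℝ (F τ) (bessel (bessel h)))) (Ici 0) t := by
  have hS := integrable_kgSin hF
  have hC : Integrable fun s => -kgCos s (F s) := (integrable_kgCos hF).neg
  set A : ℝ → L2 := fun t => g₀ + ∫ s in (0 : ℝ)..t, kgSin s (F s) with hA
  set B : ℝ → L2 := fun t => u₁ + ∫ s in (0 : ℝ)..t, -kgCos s (F s) with hB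
  have hAc : Continuous A := continuous_const.add (continuous_primitive_of_integrable hS)
  have hBc : Continuous B := continuous_const.add (continuous_primitive_of_integrable hC)
  -- integration by parts for one pair of propagators
  have key : ∀ (f : L2) (t : ℝ), 0 ≤ t →
      inner ℝ (A t) (kgCos t (bessel f)) + inner ℝ (B t) (kgSin t (bessel f))
        = inner ℝ g₀ (bessel f) +
          ∫ s in (0 : ℝ)..t, (-inner ℝ (A s) (kgSin s f) + inner ℝ (B s) (kgCos s f)) := by
    intro f t ht
    have e1 := inner_add_primitive_eq (k := fun t => kgCos t (bessel f)) hS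
      (fun t => hasDerivAt_kgCos_bessel f t) (continuous_kgSin f).neg g₀ ht
    have e2 := inner_add_primitive_eq (k := fun t => kgSin t (bessel f)) hC
      (fun t => hasDerivAt_kgSin_bessel f t) (continuous_kgCos f) u₁ ht
    -- Sine and cosine are commuting self-adjoint operators, so the contributions of F cancel: the
    -- first time derivative does not see the source.
    have e3 : (∫ s in (0 : ℝ)..t, inner ℝ (kgSin s (F s)) (kgCos s (bessel f))) +
        ∫ s in (0 : ℝ)..t, inner ℝ (-kgCos s (F s)) (kgSin s (bessel f)) = 0 := by
      rw [← intervalIntegral.integral_add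
        (intervalIntegrable_inner_of_continuous hS (continuous_kgCos _) 0 t)
        (intervalIntegrable_inner_of_continuous hC (continuous_kgSin _) 0 t)]
      refine (intervalIntegral.integral_congr (g := fun _ => (0 : ℝ)) fun s _ => ?_).trans
        intervalIntegral.integral_zero
      simp only
      rw [inner_neg_left, inner_kgSin, inner_kgCos, kgCos_kgSin_comm, add_neg_cancel]
    rw [intervalIntegral.integral_add]
    · simp only [hA, hB, inner_neg_right, kgCos_zero, kgSin_zero, inner_zero_right] at e1 e2 e3 ⊢
      rw [e1, e2]
      linarith
    · exact ((hAc.inner (continuous_kgSin f)).neg).intervalIntegrable _ _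
    · exact (hBc.inner (continuous_kgCos f)).intervalIntegrable _ _
  -- and for the other one
  have key2 : ∀ (f : L2) (t : ℝ), 0 ≤ t →
      -inner ℝ (A t) (kgSin t (bessel f)) + inner ℝ (B t) (kgCos t (bessel f))
        = inner ℝ u₁ (bessel f) +
          ∫ s in (0 : ℝ)..t, (-(inner ℝ (A s) (kgCos s f) + inner ℝ (B s) (kgSin s f))
            - inner ℝ (F s) (bessel f)) := by
    intro f t ht
    have e1 := inner_add_primitive_eq (k := fun t => kgSin t (bessel f)) hS
      (fun t => hasDerivAt_kgSin_bessel f t) (continuous_kgCos f) g₀ ht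
    have e2 := inner_add_primitive_eq (k := fun t => kgCos t (bessel f)) hC
      (fun t => hasDerivAt_kgCos_bessel f t) (continuous_kgSin f).neg u₁ ht
    -- Here the contributions of F add up, and cos² + sin² = 1 leaves F itself: this is where the
    -- source enters the second derivative.
    have e3 : -(∫ s in (0 : ℝ)..t, inner ℝ (kgSin s (F s)) (kgSin s (bessel f))) +
        ∫ s in (0 : ℝ)..t, inner ℝ (-kgCos s (F s)) (kgCos s (bessel f))
        = -∫ s in (0 : ℝ)..t, inner ℝ (F s) (bessel f) := by
      have hi : IntervalIntegrable
          (fun s => -inner ℝ (kgSin s (F s)) (kgSin s (bessel f))) volume 0 t :=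
        (intervalIntegrable_inner_of_continuous hS (continuous_kgSin _) 0 t).neg
      rw [← intervalIntegral.integral_neg, ← intervalIntegral.integral_neg,
        ← intervalIntegral.integral_add hi
        (intervalIntegrable_inner_of_continuous hC (continuous_kgCos _) 0 t)]
      refine intervalIntegral.integral_congr fun s _ => ?_
      rw [inner_neg_left, inner_kgSin, inner_kgCos, ← neg_add, ← inner_add_right, add_comm,
        kgCos_sq_add_kgSin_sq]
    rw [intervalIntegral.integral_sub, intervalIntegral.integral_neg,
      intervalIntegral.integral_add]
    · simp only [hA, hB, inner_neg_right, kgCos_zero, kgSin_zero, inner_zero_right,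
        intervalIntegral.integral_neg] at e1 e2 e3 ⊢
      rw [e1, e2]
      linarith
    · exact (hAc.inner (continuous_kgCos f)).intervalIntegrable _ _
    · exact (hBc.inner (continuous_kgSin f)).intervalIntegrable _ _
    · exact ((hAc.inner (continuous_kgCos f)).add
        (hBc.inner (continuous_kgSin f))).neg.intervalIntegrable _ _
    · exact intervalIntegrable_inner_of_continuous hF continuous_const 0 t
  -- q is the time derivative of the pairing: by `key` the pairing is a primitive of q, and by
  -- `key2` q has the prescribed value. As q is continuous, the derivative exists at every t.
  set q : ℝ → ℝ := fun t => -inner ℝ (A t) (kgSin t (bessel (bessel h))) +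
    inner ℝ (B t) (kgCos t (bessel (bessel h))) with hq
  have hqc : Continuous q :=
    (hAc.inner (continuous_kgSin _)).neg.add (hBc.inner (continuous_kgCos _))
  have hp : ∀ s ∈ Ici (0 : ℝ), inner ℝ (bessel (mild g₀ u₁ F s)) (bessel (bessel h))
      = inner ℝ g₀ (bessel (bessel (bessel h))) + ∫ τ in (0 : ℝ)..s, q τ := fun s hs => by
    rw [inner_bessel, inner_mild]
    exact key (bessel (bessel h)) s hs
  have hval : q t = inner ℝ u₁ (bessel (bessel h)) + ∫ τ in (0 : ℝ)..t,
      (-inner ℝ (bessel (mild g₀ u₁ F τ)) h - inner ℝ (F τ) (bessel (bessel h))) := by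
    rw [hq]
    simp only
    rw [key2 (bessel h) t ht]
    congr 1
    refine intervalIntegral.integral_congr fun s _ => ?_
    rw [inner_bessel, inner_mild]
  rw [← hval]
  have hd : HasDerivAt (fun s => inner ℝ g₀ (bessel (bessel (bessel h))) + ∫ τ in (0 : ℝ)..s, q τ)
      (q t) t :=
    (intervalIntegral.integral_hasDerivAt_right (hqc.intervalIntegrable _ _)
      (hqc.stronglyMeasurableAtFilter _ _) hqc.continuousAt).const_add _
  exact hd.hasDerivWithinAt.congr hp (hp t ht)

/-! ### Uniqueness of weak solutions of the linear equation -/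

theorem eq_zero_of_bessel_eq_zero {f : L2} (h : bessel f = 0) : f = 0 := by
  have h1 := sobolevENorm_one_bessel f
  have h2 := sobolevENorm_one_bessel 0
  rw [map_zero, enorm_zero] at h2
  rw [h, h2] at h1
  exact enorm_eq_zero.1 h1.symm

/-- This is y'' = -A y with zero data and bounded A, in integrated form. The outer integration costs
at most a factor T, and Gronwall applies with weight T‖A‖. -/
theorem eq_zero_of_clm_eq_double_integral {E : Type*} [NormedAddCommGroup E] [NormedSpace ℝ E]
    [CompleteSpace E] {A : E →L[ℝ] E} {y : ℝ → E} (hy : Continuous y) {T : ℝ}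
    (h : ∀ t ∈ Icc 0 T, y t = -∫ s in (0 : ℝ)..t, ∫ r in (0 : ℝ)..s, A (y r)) :
    ∀ t ∈ Icc 0 T, y t = 0 := by
  have hAy : Continuous fun r => A (y r) := A.continuous.comp hy
  intro t ht
  have hT : 0 ≤ T := ht.1.trans ht.2
  refine norm_eq_zero.1 (eq_zero_of_le_integral_mul (φ := fun t => ‖y t‖)
    (w := fun _ => T * ‖A‖) hy.norm.continuousOn (fun _ _ => norm_nonneg _)
    (continuous_const.integrableOn_Icc) (fun _ => by positivity) (fun t ht => ?_) t ht)
  rw [h t ht, norm_neg]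
  have h1 : ∀ s ∈ uIoc (0 : ℝ) t, ‖∫ r in (0 : ℝ)..s, A (y r)‖ ≤ ∫ r in (0 : ℝ)..t, ‖A‖ * ‖y r‖ := by
    intro s hs
    rw [uIoc_of_le ht.1] at hs
    refine (intervalIntegral.norm_integral_le_of_norm_le hs.1.le
      (Eventually.of_forall fun r _ => A.le_opNorm (y r))
      ((continuous_const.mul hy.norm).intervalIntegrable _ _)).trans ?_
    refine intervalIntegral.integral_mono_interval le_rfl hs.1.le hs.2
      (Eventually.of_forall fun r => by positivity)
      ((continuous_const.mul hy.norm).intervalIntegrable _ _)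
  refine (intervalIntegral.norm_integral_le_of_norm_le_const h1).trans ?_
  rw [sub_zero, abs_of_nonneg ht.1, intervalIntegral.integral_const_mul,
    intervalIntegral.integral_const_mul, mul_comm, mul_assoc]
  gcongr
  · exact mul_nonneg (norm_nonneg _)
      (intervalIntegral.integral_nonneg ht.1 fun _ _ => norm_nonneg _)
  · exact ht.2

/-- Integrating the weak equation and using the density of the functions ψ - Δψ gives (1 - Δ)^(-1) z
= -∫∫ z as an identity in L². Projected to frequencies at most n it becomes an ODE with a bounded
operator, so every projection of z vanishes. -/
theorem eq_zero_of_weak_zero {T : ℝ} {d : ℝ → L2} (hd : Continuous d) (h0 : d 0 = 0)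
    (hw : ∀ ψ : 𝓢(R3, ℝ), ∀ t ∈ Icc 0 T,
      HasDerivWithinAt (fun s => inner ℝ (bessel (d s)) (bessel (bessel (helmholtz ψ))))
        (∫ τ in (0 : ℝ)..t, -inner ℝ (bessel (d τ)) (helmholtz ψ)) (Icc 0 T) t) :
    ∀ t ∈ Icc 0 T, d t = 0 := by
  set z : ℝ → L2 := fun t => bessel (d t) with hz
  have hzc : Continuous z := bessel.continuous.comp hd
  have hY : Continuous fun s => ∫ r in (0 : ℝ)..s, z r :=
    intervalIntegral.continuous_primitive (fun _ _ => hzc.intervalIntegrable _ _) 0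
  have h1 : ∀ t ∈ Icc 0 T, bessel (bessel (z t)) = -∫ s in (0 : ℝ)..t, ∫ r in (0 : ℝ)..s, z r := by
    intro t ht
    rw [← sub_eq_zero, sub_neg_eq_add]
    refine eq_zero_of_inner_helmholtz fun ψ => ?_
    have e := intervalIntegral.integral_eq_sub_of_hasDerivAt_of_le ht.1
      (f := fun s => inner ℝ (z s) (bessel (bessel (helmholtz ψ))))
      (f' := fun s => ∫ τ in (0 : ℝ)..s, -inner ℝ (z τ) (helmholtz ψ))
      (hzc.inner continuous_const).continuousOn
      (fun x hx => (hw ψ x ⟨hx.1.le, hx.2.le.trans ht.2⟩).hasDerivAt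
        (Icc_mem_nhds hx.1 (hx.2.trans_le ht.2)))
      ((intervalIntegral.continuous_primitive (fun _ _ =>
        ((hzc.inner continuous_const).neg).intervalIntegrable _ _) 0).intervalIntegrable _ _)
    have hz0 : z 0 = 0 := by simp only [hz, h0, map_zero]
    rw [hz0, inner_zero_left, sub_zero] at e
    rw [inner_add_left, inner_bessel, inner_bessel, ← e,
      inner_intervalIntegral_left (hY.intervalIntegrable _ _)]
    simp_rw [inner_intervalIntegral_left (hzc.intervalIntegrable _ _),
      intervalIntegral.integral_neg]
    exact neg_add_cancel _
  intro t ht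
  refine eq_zero_of_bessel_eq_zero (eq_zero_of_freqCut_eq_zero fun n => ?_)
  refine eq_zero_of_clm_eq_double_integral (A := freqCutHelmholtz n) (y := fun t => freqCut n (z t))
    ((freqCut n).continuous.comp hzc) (fun t ht => ?_) t ht
  simp_rw [freqCutHelmholtz_freqCut]
  rw [← freqCutHelmholtz_bessel_bessel, h1 t ht, map_neg,
    ← (freqCutHelmholtz n).intervalIntegral_comp_comm (hY.intervalIntegrable _ _)]
  simp_rw [← (freqCutHelmholtz n).intervalIntegral_comp_comm (hzc.intervalIntegrable _ _)]

/-- The difference from the Duhamel solution with the same source satisfies the homogeneous weak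
equation with zero data, since F drops out. -/
theorem eq_mild_of_weak {T : ℝ} {g₀ u₁ : L2} {F : ℝ → L2} (hF : Integrable F)
    {g : ℝ → L2} (hg : ContinuousOn g (Icc 0 T)) (h0 : g 0 = g₀)
    (hw : ∀ ψ : 𝓢(R3, ℝ), ∀ t ∈ Icc 0 T,
      HasDerivWithinAt (fun s => inner ℝ (bessel (g s)) (bessel (bessel (helmholtz ψ))))
        (inner ℝ u₁ (bessel (bessel (helmholtz ψ))) + ∫ τ in (0 : ℝ)..t,
          (-inner ℝ (bessel (g τ)) (helmholtz ψ)
            - inner ℝ (F τ) (bessel (bessel (helmholtz ψ))))) (Icc 0 T) t) :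
    ∀ t ∈ Icc 0 T, g t = mild g₀ u₁ F t := by
  intro t ht
  have hT : 0 ≤ T := ht.1.trans ht.2
  -- A continuous extension of g to all times; only its values on [0, T] matter.
  set e : ℝ → L2 := IccExtend hT ((Icc 0 T).domRestrict g) with he
  have hec : Continuous e := hg.domRestrict.Icc_extend'
  have heq : ∀ s ∈ Icc 0 T, e s = g s := fun s hs => by
    rw [he, IccExtend_of_mem hT _ hs, domRestrict_apply]
  have hm := continuous_mild g₀ u₁ hF
  rw [← heq t ht]
  refine sub_eq_zero.1 (eq_zero_of_weak_zero (d := fun t => e t - mild g₀ u₁ F t)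
    (hec.sub hm) ?_ (fun ψ t ht => ?_) t ht)
  · rw [heq 0 ⟨le_rfl, hT⟩, mild_zero, h0, sub_self]
  have h1 := (hw ψ t ht).sub
    ((hasDerivWithinAt_inner_mild (g₀ := g₀) (u₁ := u₁) hF (helmholtz ψ) ht.1).mono
      Icc_subset_Ici_self)
  have hsub : uIcc 0 t ⊆ Icc 0 T := by
    rw [uIcc_of_le ht.1]
    exact Icc_subset_Icc_right ht.2
  have h2 : ∫ τ in (0 : ℝ)..t, (-inner ℝ (bessel (g τ)) (helmholtz ψ)
      - inner ℝ (F τ) (bessel (bessel (helmholtz ψ))))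
      = ∫ τ in (0 : ℝ)..t, (-inner ℝ (bessel (e τ)) (helmholtz ψ)
      - inner ℝ (F τ) (bessel (bessel (helmholtz ψ)))) :=
    intervalIntegral.integral_congr fun s hs => by simp only [heq s (hsub hs)]
  have hi : ∀ {k : ℝ → L2}, Continuous k → IntervalIntegrable (fun τ =>
      -inner ℝ (bessel (k τ)) (helmholtz ψ)
        - inner ℝ (F τ) (bessel (bessel (helmholtz ψ)))) volume 0 t := fun {k} hk =>
    (((bessel.continuous.comp hk).inner continuous_const).neg.intervalIntegrable _ _).sub
      (intervalIntegrable_inner_of_continuous hF continuous_const 0 t)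
  rw [h2, add_sub_add_left_eq_sub, ← intervalIntegral.integral_sub (hi hec) (hi hm)] at h1
  have h3 : ∫ τ in (0 : ℝ)..t, -inner ℝ (bessel (e τ - mild g₀ u₁ F τ)) (helmholtz ψ)
      = ∫ τ in (0 : ℝ)..t, ((-inner ℝ (bessel (e τ)) (helmholtz ψ)
          - inner ℝ (F τ) (bessel (bessel (helmholtz ψ))))
        - (-inner ℝ (bessel (mild g₀ u₁ F τ)) (helmholtz ψ)
          - inner ℝ (F τ) (bessel (bessel (helmholtz ψ))))) :=
    intervalIntegral.integral_congr fun s _ => by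
      rw [map_sub, inner_sub_left]
      ring
  rw [h3]
  refine h1.congr (fun s hs => ?_) ?_
  · rw [map_sub, inner_sub_left, heq s hs]; rfl
  · rw [map_sub, inner_sub_left, heq t ht]; rfl

/-! ### The semilinear equation -/

/-- A time-dependent source term `Φ` that is Lipschitz on bounded sets, with a Lipschitz constant
that is integrable in time. -/
structure LipschitzSource (Φ : ℝ → L2 → L2) (w : ℝ → ℝ → ℝ) (T : ℝ) : Prop where
  zero : ∀ s, Φ s 0 = 0
  nonneg : ∀ c s, 0 ≤ w c s
  integrableOn : ∀ c, IntegrableOn (w c) (Icc 0 T)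
  norm_sub_le : ∀ c s f g, ‖f‖ ≤ c → ‖g‖ ≤ c → ‖Φ s f - Φ s g‖ ≤ w c s * ‖f - g‖
  aestronglyMeasurable : ∀ g : ℝ → L2, Continuous g →
    AEStronglyMeasurable (fun s => Φ s (g s)) (volume.restrict (Icc 0 T))

namespace LipschitzSource

variable {Φ : ℝ → L2 → L2} {w : ℝ → ℝ → ℝ} {T : ℝ}

theorem mono (h : LipschitzSource Φ w T) {S : ℝ} (hS : S ≤ T) : LipschitzSource Φ w S where
  zero := h.zero
  nonneg := h.nonneg
  integrableOn c := (h.integrableOn c).mono_set (Icc_subset_Icc_right hS)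
  norm_sub_le := h.norm_sub_le
  aestronglyMeasurable g hg :=
    (h.aestronglyMeasurable g hg).mono_set (Icc_subset_Icc_right hS)

theorem norm_le (h : LipschitzSource Φ w T) {c : ℝ} {f : L2} (hf : ‖f‖ ≤ c) (s : ℝ) :
    ‖Φ s f‖ ≤ w c s * ‖f‖ := by
  have := h.norm_sub_le c s f 0 hf (by rw [norm_zero]; exact (norm_nonneg _).trans hf)
  rwa [h.zero, sub_zero, sub_zero] at this

theorem integrable_indicator (h : LipschitzSource Φ w T) {g : ℝ → L2} (hg : Continuous g) {c : ℝ}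
    (hc : ∀ s, ‖g s‖ ≤ c) : Integrable ((Icc 0 T).indicator fun s => Φ s (g s)) := by
  rw [integrable_indicator_iff measurableSet_Icc]
  refine Integrable.mono' ((h.integrableOn c).mul_const c) (h.aestronglyMeasurable g hg)
    (Eventually.of_forall fun s => (h.norm_le (hc s) s).trans ?_)
  exact mul_le_mul_of_nonneg_left (hc s) (h.nonneg c s)

theorem exists_time (h : LipschitzSource Φ w T) (hT : 0 < T) (c : ℝ) :
    ∃ S, 0 < S ∧ S ≤ T ∧ ∫ s in (0 : ℝ)..S, w c s ≤ 1 / 2 := by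
  have hW : Integrable ((Icc 0 T).indicator (w c)) :=
    (integrable_indicator_iff measurableSet_Icc).2 (h.integrableOn c)
  have h1 := (continuous_primitive_of_integrable hW).tendsto 0
  rw [intervalIntegral.integral_same] at h1
  have h2 := (h1.mono_left (nhdsWithin_le_nhds (s := Ioi 0))).eventually
    (gt_mem_nhds (show (0 : ℝ) < 1 / 2 by norm_num))
  obtain ⟨S, hS, hS0, hST⟩ := (h2.and (Ioc_mem_nhdsGT hT)).exists
  refine ⟨S, hS0, hST, le_of_eq_of_le ?_ hS.le⟩
  refine intervalIntegral.integral_congr fun s hs => ?_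
  rw [uIcc_of_le hS0.le] at hs
  have hs' : s ∈ Icc 0 T := ⟨hs.1, hs.2.trans hST⟩
  simp [hs']

/-- Gronwall with the Lipschitz weight of a ball that contains both solutions. No smallness and no
relation to the ball of the fixed point argument is required. -/
theorem eqOn_of_mild (h : LipschitzSource Φ w T) {g₀ u₁ : L2} {F G f g : ℝ → L2}
    (hF : Integrable F) (hG : Integrable G) (hf : ContinuousOn f (Icc 0 T))
    (hg : ContinuousOn g (Icc 0 T)) (hfF : ∀ t ∈ Icc 0 T, f t = mild g₀ u₁ F t)
    (hgG : ∀ t ∈ Icc 0 T, g t = mild g₀ u₁ G t)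
    (hFΦ : ∀ᵐ t ∂(volume.restrict (Icc 0 T)), F t = Φ t (f t))
    (hGΦ : ∀ᵐ t ∂(volume.restrict (Icc 0 T)), G t = Φ t (g t)) : EqOn f g (Icc 0 T) := by
  obtain ⟨a, ha⟩ := isCompact_Icc.exists_bound_of_continuousOn hf
  obtain ⟨b, hb⟩ := isCompact_Icc.exists_bound_of_continuousOn hg
  intro t ht
  have hc : ContinuousOn (fun s => ‖f s - g s‖) (Icc 0 T) := (hf.sub hg).norm
  refine sub_eq_zero.1 (norm_eq_zero.1 (eq_zero_of_le_integral_mul (φ := fun s => ‖f s - g s‖)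
    (w := w (max a b)) hc (fun _ _ => norm_nonneg _) (h.integrableOn _) (h.nonneg _)
    (fun t ht => ?_) t ht))
  rw [hfF t ht, hgG t ht]
  refine (norm_mild_sub_le g₀ u₁ hF hG ht.1).trans ?_
  have hsub : Ioc 0 t ⊆ Icc 0 T := fun s hs => ⟨hs.1.le, hs.2.trans ht.2⟩
  rw [intervalIntegral.integral_of_le ht.1, intervalIntegral.integral_of_le ht.1]
  refine integral_mono_ae (hF.sub hG).norm.integrableOn ?_ ?_
  · exact ((h.integrableOn _).mul_continuousOn hc isCompact_Icc).mono_set hsub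
  · filter_upwards [ae_restrict_of_ae_restrict_of_subset hsub hFΦ,
      ae_restrict_of_ae_restrict_of_subset hsub hGΦ, ae_restrict_mem measurableSet_Ioc]
      with s h1 h2 h3
    rw [h1, h2]
    exact h.norm_sub_le _ s _ _ ((ha s (hsub h3)).trans (le_max_left _ _))
      ((hb s (hsub h3)).trans (le_max_right _ _))

/-- Local existence for the semilinear equation in Duhamel form. -/
theorem exists_mild (h : LipschitzSource Φ w T) (hT : 0 < T) (g₀ u₁ : L2) :
    ∃ S, 0 < S ∧ S ≤ T ∧ ∃ g : ℝ → L2, Continuous g ∧ ∃ F : ℝ → L2, Integrable F ∧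
      F = (Icc 0 S).indicator (fun s => Φ s (g s)) ∧ ∀ t ∈ Icc 0 S, g t = mild g₀ u₁ F t := by
  -- The free evolution takes up M/2. With ∫ w_M ≤ 1/2 on [0, S], the source contributes at most
  -- another M/2, and the same 1/2 is the contraction factor.
  set M : ℝ := 2 * (‖g₀‖ + ‖u₁‖) with hM
  have hM0 : 0 ≤ M := by positivity
  obtain ⟨S, hS0, hST, hS⟩ := h.exists_time hT M
  replace h := h.mono hST
  refine ⟨S, hS0, hST, ?_⟩
  let ext : C(Icc (0 : ℝ) S, L2) → ℝ → L2 := fun g => IccExtend hS0.le g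
  have hext : ∀ g, Continuous (ext g) := fun g => g.continuous.Icc_extend'
  have hextn : ∀ g s, ‖ext g s‖ ≤ ‖g‖ := fun g s => g.norm_coe_le_norm _
  have hextd : ∀ g g' s, ‖ext g s - ext g' s‖ ≤ ‖g - g'‖ := fun g g' s =>
    (g - g').norm_coe_le_norm (projIcc 0 S hS0.le s)
  let src : C(Icc (0 : ℝ) S, L2) → ℝ → L2 := fun g => (Icc 0 S).indicator fun s => Φ s (ext g s)
  have hsrc : ∀ g, Integrable (src g) := fun g => h.integrable_indicator (hext g) (hextn g)
  let Ψ : C(Icc (0 : ℝ) S, L2) → C(Icc (0 : ℝ) S, L2) := fun g =>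
    ⟨fun t => mild g₀ u₁ (src g) t, (continuous_mild g₀ u₁ (hsrc g)).comp continuous_subtype_val⟩
  have hwi : ∀ t ∈ Icc (0 : ℝ) S, IntervalIntegrable (w M) volume 0 t := fun t ht => by
    rw [intervalIntegrable_iff_integrableOn_Icc_of_le ht.1]
    exact (h.integrableOn M).mono_set (Icc_subset_Icc_right ht.2)
  have hwt : ∀ t ∈ Icc (0 : ℝ) S, ∫ s in (0 : ℝ)..t, w M s ≤ 1 / 2 := fun t ht =>
    (intervalIntegral.integral_mono_interval le_rfl ht.1 ht.2
      (Eventually.of_forall fun s => h.nonneg M s) (hwi S ⟨hS0.le, le_rfl⟩)).trans hS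
  have hindN : ∀ g s, ‖src g s‖ ≤ ‖Φ s (ext g s)‖ := fun g s => norm_indicator_le_norm_self _ _
  have hmaps : MapsTo Ψ (Metric.closedBall 0 M) (Metric.closedBall 0 M) := by
    intro g hg
    rw [mem_closedBall_zero_iff] at hg ⊢
    refine (ContinuousMap.norm_le _ hM0).2 fun t => ?_
    refine (norm_mild_le g₀ u₁ (hsrc g) t.2.1).trans ?_
    have h1 : ∫ s in (0 : ℝ)..t, ‖src g s‖ ≤ ∫ s in (0 : ℝ)..t, w M s * M := by
      refine intervalIntegral.integral_mono_on t.2.1 (hsrc g).norm.intervalIntegrable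
        ((hwi t t.2).mul_const M) fun s _ => (hindN g s).trans ?_
      have hb := (hextn g s).trans hg
      exact (h.norm_le hb s).trans (mul_le_mul_of_nonneg_left hb (h.nonneg M s))
    rw [intervalIntegral.integral_mul_const] at h1
    have h2 := mul_le_mul_of_nonneg_right (hwt t t.2) hM0
    linarith
  have hlip : LipschitzOnWith (1 / 2) Ψ (Metric.closedBall 0 M) := by
    refine LipschitzOnWith.of_dist_le_mul fun g hg g' hg' => ?_
    rw [mem_closedBall_zero_iff] at hg hg'
    rw [dist_eq_norm, dist_eq_norm]
    refine (ContinuousMap.norm_le _ (by positivity)).2 fun t => ?_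
    refine (norm_mild_sub_le g₀ u₁ (hsrc g) (hsrc g') t.2.1).trans ?_
    have h1 : ∫ s in (0 : ℝ)..t, ‖src g s - src g' s‖ ≤ ∫ s in (0 : ℝ)..t, w M s * ‖g - g'‖ := by
      refine intervalIntegral.integral_mono_on t.2.1
        ((hsrc g).sub (hsrc g')).norm.intervalIntegrable
        ((hwi t t.2).mul_const _) fun s _ => ?_
      have h2 : src g s - src g' s
          = (Icc 0 S).indicator (fun s => Φ s (ext g s) - Φ s (ext g' s)) s := by
        rw [indicator_sub]
      rw [h2]
      refine (norm_indicator_le_norm_self _ _).trans ?_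
      refine (h.norm_sub_le M s _ _ ((hextn g s).trans hg) ((hextn g' s).trans hg')).trans ?_
      exact mul_le_mul_of_nonneg_left (hextd g g' s) (h.nonneg M s)
    rw [intervalIntegral.integral_mul_const] at h1
    have h2 := mul_le_mul_of_nonneg_right (hwt t t.2) (norm_nonneg (g - g'))
    simp only [NNReal.coe_div, NNReal.coe_one, NNReal.coe_ofNat]
    exact h1.trans h2
  have hcon : ContractingWith (1 / 2) (hmaps.restrict Ψ _ _) := by
    refine ⟨by rw [← NNReal.coe_lt_coe]; norm_num, ?_⟩
    rw [lipschitzOnWith_iff_restrict] at hlip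
    intro x y
    exact hlip x y
  obtain ⟨g, hg, hfix, -⟩ := hcon.exists_fixedPoint' Metric.isClosed_closedBall.isComplete hmaps
    (x := 0) (Metric.mem_closedBall_self hM0) (edist_ne_top _ _)
  refine ⟨ext g, hext g, src g, hsrc g, rfl, fun t ht => ?_⟩
  have h1 : ext g t = g ⟨t, ht⟩ := IccExtend_of_mem hS0.le g ht
  rw [h1]
  exact (DFunLike.congr_fun hfix ⟨t, ht⟩).symm

end LipschitzSource

/-! ### Littlewood–Paley blocks as Fourier multipliers -/

/-- On `L¹ ∩ L²` the inverse Fourier integral is the inverse Fourier transform of `L²`. -/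
theorem fourierInv_ae_eq {G : CL2} (hG : Integrable G) :
    (𝓕⁻ (G : R3 → ℂ)) =ᵐ[volume] (𝓕⁻ G : CL2) := by
  have hcont : Continuous (𝓕⁻ (G : R3 → ℂ)) := by
    have : (𝓕⁻ (G : R3 → ℂ)) = fun w => 𝓕 (G : R3 → ℂ) (-w) := by
      ext w; exact Real.fourierInv_eq_fourier_neg _ _
    rw [this]
    exact (VectorFourier.fourierIntegral_continuous Real.continuous_fourierChar
      (innerSL ℝ).continuous₂ hG).comp continuous_neg
  refine ae_eq_of_integral_contDiff_smul_eq hcont.locallyIntegrable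
    ((Lp.memLp _).locallyIntegrable one_le_two) fun g hg hgc => ?_
  have hsm : ContDiff ℝ ((⊤ : ℕ∞) : WithTop ℕ∞) (fun x => (g x : ℂ)) :=
    Complex.ofRealCLM.contDiff.comp hg
  have hcs : HasCompactSupport fun x => (g x : ℂ) := hgc.comp_left (g := Complex.ofReal) rfl
  set ψ : 𝓢(R3, ℂ) := hcs.toSchwartzMap hsm with hψ
  have hψg : ∀ x, ψ x = (g x : ℂ) := fun x => rfl
  have h1 : ∫ x, ψ x • (𝓕⁻ G : CL2) x = ∫ x, (𝓕⁻ ψ) x • G x := by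
    rw [← Lp.toTemperedDistribution_apply, ← Lp.fourierInv_toTemperedDistribution_eq,
      TemperedDistribution.fourierInv_apply, Lp.toTemperedDistribution_apply]
  have h2 : ∫ x, ψ x • (𝓕⁻ (G : R3 → ℂ)) x = ∫ x, (𝓕⁻ ψ) x • G x := by
    -- With minus the inner product as pairing, the general Fourier integral is the inverse
    -- transform. Both inverse transforms of G thus act on test functions ψ as ∫ (𝓕⁻ ψ) G.
    have h3 := VectorFourier.integral_fourierIntegral_smul_eq_flip (μ := (volume : Measure R3))
      (ν := (volume : Measure R3)) (L := -innerₗ R3) (f := ψ) (g := G)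
      Real.continuous_fourierChar (continuous_inner (𝕜 := ℝ) (E := R3)).neg ψ.integrable hG
    have h4 : (-innerₗ R3).flip = -innerₗ R3 := by
      ext x y
      simp [real_inner_comm]
    rw [h4] at h3
    rw [SchwartzMap.fourierInv_coe]
    exact h3.symm
  calc ∫ x, g x • (𝓕⁻ (G : R3 → ℂ)) x = ∫ x, ψ x • (𝓕⁻ (G : R3 → ℂ)) x := by
        refine integral_congr_ae (Eventually.of_forall fun x => ?_)
        simp [hψg]
    _ = ∫ x, ψ x • (𝓕⁻ G : CL2) x := by rw [h1, h2]
    _ = ∫ x, g x • (𝓕⁻ G : CL2) x := by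
        refine integral_congr_ae (Eventually.of_forall fun x => ?_)
        simp [hψg]

/-- Cauchy–Schwarz on the ball of radius R that carries the symbol, together with Plancherel. -/
theorem eLpNorm_one_fourierL2_mult_le {m : R3 → ℝ} {C R : ℝ} (hm : IsSymbol m C)
    (hR : ∀ ξ, m ξ ≠ 0 → ‖ξ‖ ≤ R) (f : L2) :
    eLpNorm (fourierL2 (mult m f)) 1 volume ≤
      ‖mult m f‖ₑ * volume (Metric.closedBall (0 : R3) R) ^ (1 / 2 : ℝ) := by
  set G := fourierL2 (mult m f) with hG
  have h0 : (Metric.closedBall (0 : R3) R).indicator G =ᵐ[volume] G := by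
    filter_upwards [fourierL2_mult hm f] with ξ e
    by_cases hξ : ξ ∈ Metric.closedBall (0 : R3) R
    · rw [indicator_of_mem hξ]
    · rw [indicator_of_notMem hξ, hG, e]
      have : m ξ = 0 := by
        by_contra hc
        exact hξ (mem_closedBall_zero_iff.2 (hR ξ hc))
      simp [this]
  rw [← eLpNorm_congr_ae h0, eLpNorm_indicator_eq_eLpNorm_restrict Metric.isClosed_closedBall.measurableSet]
  refine (eLpNorm_le_eLpNorm_mul_rpow_measure_univ one_le_two
    (Lp.aestronglyMeasurable G).restrict).trans ?_
  have h1 : ‖mult m f‖ₑ = eLpNorm G 2 volume := by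
    rw [← Lp.enorm_def, hG, ← fourierIso_apply, ← ofReal_norm, ← ofReal_norm, fourierIso.norm_map]
  rw [h1, Measure.restrict_apply_univ]
  refine mul_le_mul' (eLpNorm_mono_measure _ Measure.restrict_le_self) (le_of_eq ?_)
  norm_num

theorem integrable_fourierL2_mult {m : R3 → ℝ} {C R : ℝ} (hm : IsSymbol m C)
    (hR : ∀ ξ, m ξ ≠ 0 → ‖ξ‖ ≤ R) (f : L2) : Integrable (fourierL2 (mult m f)) := by
  refine memLp_one_iff_integrable.1 ⟨Lp.aestronglyMeasurable _,
    (eLpNorm_one_fourierL2_mult_le hm hR f).trans_lt ?_⟩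
  refine ENNReal.mul_lt_top enorm_lt_top ?_
  exact ENNReal.rpow_lt_top_of_nonneg (by norm_num) measure_closedBall_lt_top.ne

theorem fourierInv_mul_fourierL2_ae_eq {m : R3 → ℝ} {C R : ℝ} (hm : IsSymbol m C)
    (hR : ∀ ξ, m ξ ≠ 0 → ‖ξ‖ ≤ R) (f : L2) :
    𝓕⁻ (fun ξ : R3 => (m ξ : ℂ) * fourierL2 f ξ) =ᵐ[volume] fun x => ((mult m f x : ℝ) : ℂ) := by
  have h1 : 𝓕⁻ (fun ξ : R3 => (m ξ : ℂ) * fourierL2 f ξ)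
      = 𝓕⁻ (fourierL2 (mult m f) : R3 → ℂ) := by
    ext w
    rw [Real.fourierInv_eq, Real.fourierInv_eq]
    refine integral_congr_ae ?_
    filter_upwards [fourierL2_mult hm f] with ξ e
    rw [e]
  have h2 : (𝓕⁻ (fourierL2 (mult m f)) : CL2) = Complex.ofRealCLM.compLp (mult m f) :=
    FourierTransform.fourierInv_fourier_eq _
  rw [h1]
  refine (fourierInv_ae_eq (integrable_fourierL2_mult hm hR f)).trans ?_
  rw [h2]
  exact Complex.ofRealCLM.coeFn_compLp _

/-- Bernstein's inequality for multipliers with bounded support. -/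
theorem eLpNorm_top_mult_le {m : R3 → ℝ} {C R : ℝ} (hm : IsSymbol m C)
    (hR : ∀ ξ, m ξ ≠ 0 → ‖ξ‖ ≤ R) (f : L2) :
    eLpNorm (mult m f) ∞ volume ≤
      ‖mult m f‖ₑ * volume (Metric.closedBall (0 : R3) R) ^ (1 / 2 : ℝ) := by
  refine le_trans ?_ (eLpNorm_one_fourierL2_mult_le hm hR f)
  rw [eLpNorm_exponent_top]
  refine essSup_le_of_ae_le _ ?_
  have h2 : (𝓕⁻ (fourierL2 (mult m f)) : CL2) = Complex.ofRealCLM.compLp (mult m f) :=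
    FourierTransform.fourierInv_fourier_eq _
  have h3 := fourierInv_ae_eq (integrable_fourierL2_mult hm hR f)
  rw [h2] at h3
  filter_upwards [h3, Complex.ofRealCLM.coeFn_compLp (mult m f)] with x e1 e2
  have e3 : ‖mult m f x‖ₑ = ‖𝓕⁻ (fourierL2 (mult m f) : R3 → ℂ) x‖ₑ := by
    rw [e1, e2, Complex.ofRealCLM_apply, ← ofReal_norm, ← ofReal_norm, Complex.norm_real]
  rw [e3, Real.fourierInv_eq, eLpNorm_one_eq_lintegral_enorm]
  refine (enorm_integral_le_lintegral_enorm _).trans (le_of_eq ?_)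
  refine lintegral_congr fun v => ?_
  rw [← ofReal_norm, ← ofReal_norm, Circle.norm_smul]

namespace LittlewoodPaleyPair

variable (P : LittlewoodPaleyPair)

/-- The symbols of the Littlewood–Paley decomposition, that of `S₀` first. -/
def symbol : ℕ → R3 → ℝ
  | 0, ξ => P.χ ((2 * Real.pi) • ξ)
  | j + 1, ξ => P.φ ((2 : ℝ) ^ (-(j : ℤ)) • (2 * Real.pi) • ξ)

theorem symbol_nonneg : ∀ k ξ, 0 ≤ P.symbol k ξ
  | 0, _ => P.χ_nonneg _
  | _ + 1, _ => P.φ_nonneg _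

theorem hasSum_symbol (ξ : R3) : HasSum (fun k => P.symbol k ξ) 1 := by
  rw [← hasSum_nat_add_iff' 1]
  simpa [symbol] using P.inhomogeneous_sum ((2 * Real.pi) • ξ)

theorem sum_symbol_le_one (s : Finset ℕ) (ξ : R3) : ∑ k ∈ s, P.symbol k ξ ≤ 1 :=
  sum_le_hasSum s (fun k _ => P.symbol_nonneg k ξ) (P.hasSum_symbol ξ)

theorem symbol_le_one (k : ℕ) (ξ : R3) : P.symbol k ξ ≤ 1 := by
  simpa using P.sum_symbol_le_one {k} ξ

theorem measurable_symbol : ∀ k, Measurable (P.symbol k)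
  | 0 => (P.χ.continuous.comp (continuous_const_smul _)).measurable
  | _ + 1 => (P.φ.continuous.comp
      ((continuous_const_smul _).comp (continuous_const_smul _))).measurable

theorem symbol_neg : ∀ k ξ, P.symbol k (-ξ) = P.symbol k ξ
  | 0, ξ => P.χ_radial _ _ (by rw [smul_neg, norm_neg])
  | _ + 1, ξ => P.φ_radial _ _ (by rw [smul_neg, smul_neg, norm_neg])

theorem isSymbol_symbol (k : ℕ) : IsSymbol (P.symbol k) 1 where
  measurable := P.measurable_symbol k
  even := P.symbol_neg k
  bound ξ := by
    rw [abs_of_nonneg (P.symbol_nonneg k ξ)]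
    exact P.symbol_le_one k ξ

theorem isSymbol_sum (n : ℕ) : IsSymbol (fun ξ => ∑ k ∈ Finset.range n, P.symbol k ξ) 1 where
  measurable := Finset.measurable_sum _ fun k _ => P.measurable_symbol k
  even ξ := Finset.sum_congr rfl fun k _ => P.symbol_neg k ξ
  bound ξ := by
    rw [abs_of_nonneg (Finset.sum_nonneg fun k _ => P.symbol_nonneg k ξ)]
    exact P.sum_symbol_le_one _ ξ

theorem norm_two_pi_smul (ξ : R3) : ‖(2 * Real.pi) • ξ‖ = 2 * Real.pi * ‖ξ‖ := by
  rw [norm_smul, Real.norm_of_nonneg Real.two_pi_pos.le]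

theorem norm_le_of_symbol_ne_zero {k : ℕ} {ξ : R3} (h : P.symbol k ξ ≠ 0) : ‖ξ‖ ≤ 2 ^ k := by
  have hπ := Real.pi_gt_three
  have hn := norm_nonneg ξ
  cases k with
  | zero =>
    have h1 : ‖(2 * Real.pi) • ξ‖ ≤ 4 / 3 := P.χ_support (subset_tsupport _ h)
    rw [norm_two_pi_smul] at h1
    rw [pow_zero]
    nlinarith
  | succ j =>
    have h1 := (P.φ_support (subset_tsupport _ h)).2
    rw [norm_two_zpow_smul, norm_two_pi_smul, zpow_neg, zpow_natCast,
      inv_mul_le_iff₀ (by positivity)] at h1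
    have h2 : (0 : ℝ) < 2 ^ j := by positivity
    rw [pow_succ]
    nlinarith

/-- On the support of the block k = j + 1 one has (3/4) 2^j ≤ 2π‖ξ‖ ≤ ω, that is 2^k ≤ (8/3) ω. The
constant 4 leaves room. -/
theorem two_pow_le_of_symbol_ne_zero {k : ℕ} {ξ : R3} (h : P.symbol k ξ ≠ 0) :
    (2 : ℝ) ^ k ≤ 4 * omega ξ := by
  have h1 := one_le_omega ξ
  cases k with
  | zero => rw [pow_zero]; linarith
  | succ j =>
    have h2 := (P.φ_support (subset_tsupport _ h)).1
    rw [norm_two_zpow_smul, norm_two_pi_smul, zpow_neg, zpow_natCast,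
      le_inv_mul_iff₀ (by positivity)] at h2
    have h3 : 2 * Real.pi * ‖ξ‖ ≤ omega ξ := by
      refine le_of_sq_le_sq ?_ (omega_pos ξ).le
      rw [omega_sq]
      linarith
    rw [pow_succ]
    linarith

/-- The Littlewood–Paley blocks of real functions, `S₀` first. -/
def block (k : ℕ) : L2 →L[ℝ] L2 := mult (P.symbol k)

theorem lowFrequency_ae_eq (f : L2) :
    lowFrequency P f =ᵐ[volume] fun x => ((P.block 0 f x : ℝ) : ℂ) :=
  fourierInv_mul_fourierL2_ae_eq (P.isSymbol_symbol 0)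
    (fun _ h => P.norm_le_of_symbol_ne_zero h) f

theorem dyadicBlock_ae_eq (j : ℕ) (f : L2) :
    dyadicBlock P j f =ᵐ[volume] fun x => ((P.block (j + 1) f x : ℝ) : ℂ) :=
  fourierInv_mul_fourierL2_ae_eq (P.isSymbol_symbol (j + 1))
    (fun _ h => P.norm_le_of_symbol_ne_zero h) f

theorem eLpNorm_lowFrequency (f : L2) (r : ℝ≥0∞) :
    eLpNorm (lowFrequency P f) r volume = eLpNorm (P.block 0 f) r volume := by
  rw [eLpNorm_congr_ae (P.lowFrequency_ae_eq f)]
  exact eLpNorm_congr_norm_ae (Eventually.of_forall fun x => Complex.norm_real _)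

theorem eLpNorm_dyadicBlock (j : ℕ) (f : L2) (r : ℝ≥0∞) :
    eLpNorm (dyadicBlock P j f) r volume = eLpNorm (P.block (j + 1) f) r volume := by
  rw [eLpNorm_congr_ae (P.dyadicBlock_ae_eq j f)]
  exact eLpNorm_congr_norm_ae (Eventually.of_forall fun x => Complex.norm_real _)

theorem eLpNorm_top_block_le (k : ℕ) (f : L2) : eLpNorm (P.block k f) ∞ volume ≤
    ‖P.block k f‖ₑ * volume (Metric.closedBall (0 : R3) (2 ^ k)) ^ (1 / 2 : ℝ) :=
  eLpNorm_top_mult_le (P.isSymbol_symbol k) (fun _ h => P.norm_le_of_symbol_ne_zero h) f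

theorem sum_block (n : ℕ) (f : L2) : ∑ k ∈ Finset.range n, P.block k f
    = mult (fun ξ => ∑ k ∈ Finset.range n, P.symbol k ξ) f := by
  apply eq_of_fourierL2_ae
  have h1 : fourierL2 (∑ k ∈ Finset.range n, P.block k f)
      = ∑ k ∈ Finset.range n, fourierL2 (P.block k f) := map_sum fourierIso _ _
  have h2 : ∀ᵐ ξ : R3, ∀ k, fourierL2 (P.block k f) ξ = (P.symbol k ξ : ℂ) * fourierL2 f ξ :=
    ae_all_iff.2 fun k => fourierL2_mult (P.isSymbol_symbol k) f
  rw [h1]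
  filter_upwards [Lp.coeFn_finsetSum (Finset.range n) fun k => fourierL2 (P.block k f), h2,
    fourierL2_mult (P.isSymbol_sum n) f] with ξ e1 e2 e3
  rw [e1, e3]
  simp [e2, Finset.sum_mul]

theorem tendsto_sum_block (f : L2) :
    Tendsto (fun n => ∑ k ∈ Finset.range n, P.block k f) atTop (𝓝 f) := by
  have h1 : IsSymbol (fun _ => 1) 1 := ⟨measurable_const, fun _ => rfl, fun _ => by simp⟩
  have h2 : mult (fun _ => 1) f = f := by
    apply eq_of_fourierL2_ae
    filter_upwards [fourierL2_mult h1 f] with ξ e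
    simp [e]
  have h3 := tendsto_mult (Eventually.of_forall fun n : ℕ => P.isSymbol_sum n) (l := atTop) h1
    (fun ξ => (P.hasSum_symbol ξ).tendsto_sum_nat) f
  rw [h2] at h3
  simpa only [sum_block] using h3

end LittlewoodPaleyPair

/-! ### Summation of frequency blocks -/

theorem tsum_pow_dist_le {x : ℝ≥0∞} (j : ℕ) :
    ∑' l, x ^ (Nat.dist j l) ≤ 2 * (1 - x)⁻¹ := by
  have h1 : ∀ i ∈ Finset.range j, Nat.dist j (j - 1 - i) = i + 1 := fun i hi => by
    have := Finset.mem_range.1 hi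
    simp only [Nat.dist]
    omega
  have h2 : ∀ i, Nat.dist j (i + j) = i := fun i => by
    simp only [Nat.dist]
    omega
  have h3 : ∑ l ∈ Finset.range j, x ^ (Nat.dist j l) ≤ ∑' i, x ^ i := by
    rw [← Finset.sum_range_reflect, Finset.sum_congr rfl fun i hi => by rw [h1 i hi]]
    exact (ENNReal.sum_le_tsum _).trans
      (ENNReal.tsum_comp_le_tsum_of_injective (Nat.succ_injective) fun i => x ^ i)
  have h4 : ∑' i, x ^ (Nat.dist j (i + j)) = ∑' i, x ^ i := tsum_congr fun i => by rw [h2]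
  rw [← ENNReal.tsum_geometric, ← ENNReal.summable.sum_add_tsum_nat_add' (k := j)
    (f := fun l => x ^ (Nat.dist j l)), two_mul, h4]
  exact add_le_add h3 le_rfl

/-- Schur's test for the kernel x^|j-l|, whose rows and columns sum to at most 2/(1-x). In [0, ∞]
the bound is meaningful only for x < 1. -/
theorem sum_sum_pow_dist_le (x : ℝ≥0∞) (c : ℕ → ℝ≥0∞) (n : ℕ) :
    ∑ j ∈ Finset.range n, ∑ l ∈ Finset.range n, x ^ (Nat.dist j l) * (c j + c l)
      ≤ 4 * (1 - x)⁻¹ * ∑' k, c k := by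
  have h1 : ∀ j, ∑ l ∈ Finset.range n, x ^ (Nat.dist j l) * c j ≤ 2 * (1 - x)⁻¹ * c j := by
    intro j
    rw [← Finset.sum_mul]
    gcongr
    exact (ENNReal.sum_le_tsum _).trans (tsum_pow_dist_le j)
  have h2 : ∑ j ∈ Finset.range n, ∑ l ∈ Finset.range n, x ^ (Nat.dist j l) * c j
      ≤ 2 * (1 - x)⁻¹ * ∑' k, c k := by
    refine (Finset.sum_le_sum fun j _ => h1 j).trans ?_
    rw [← Finset.mul_sum]
    gcongr
    exact ENNReal.sum_le_tsum _
  have h3 : ∑ j ∈ Finset.range n, ∑ l ∈ Finset.range n, x ^ (Nat.dist j l) * c l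
      ≤ 2 * (1 - x)⁻¹ * ∑' k, c k := by
    rw [Finset.sum_comm]
    refine le_of_eq_of_le ?_ h2
    refine Finset.sum_congr rfl fun j _ => Finset.sum_congr rfl fun l _ => ?_
    rw [Nat.dist_comm]
  simp_rw [mul_add, Finset.sum_add_distrib]
  refine (add_le_add h2 h3).trans (le_of_eq ?_)
  ring

theorem ennreal_mul_le_sq_add_sq (a b : ℝ≥0∞) : a * b ≤ a ^ 2 + b ^ 2 := by
  rcases le_total a b with h | h
  · calc a * b ≤ b * b := by gcongr
      _ = b ^ 2 := (sq b).symm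
      _ ≤ _ := le_add_self
  · calc a * b ≤ a * a := by gcongr
      _ = a ^ 2 := (sq a).symm
      _ ≤ _ := le_self_add

section Blocks

variable {α : Type*} {mα : MeasurableSpace α} {ν : Measure α}

theorem eLpNorm_sq_eq (f : α → ℝ) (p : ℝ≥0∞) :
    eLpNorm f (p * 2) ν ^ 2 = eLpNorm (fun x => f x * f x) p ν := by
  have h := eLpNorm_norm_rpow f (p := p) (q := 2) (μ := ν) (by norm_num)
  rw [show ENNReal.ofReal 2 = 2 by simp] at h
  rw [← ENNReal.rpow_natCast, Nat.cast_ofNat, ← h]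
  refine eLpNorm_congr_norm_ae (Eventually.of_forall fun x => ?_)
  simp [sq]

/-- A sum of functions whose norms in two Lebesgue spaces grow and decay geometrically is bounded
in the Lebesgue space in between. -/
theorem eLpNorm_sum_sq_le {p r₁ r₂ : ℝ≥0∞} (hp : 1 ≤ p) [hpr : ENNReal.HolderTriple r₁ r₂ p]
    {f : ℕ → α → ℝ} (hf : ∀ k, AEStronglyMeasurable (f k) ν) {x D : ℝ≥0∞} (hx0 : x ≠ 0)
    (hx : x ≠ ∞) {a b : ℕ → ℝ≥0∞} (ha : ∀ k, eLpNorm (f k) r₁ ν ≤ D * x ^ k * a k)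
    (hb : ∀ k, eLpNorm (f k) r₂ ν ≤ D * x⁻¹ ^ k * b k) (n : ℕ) :
    eLpNorm (∑ k ∈ Finset.range n, f k) (p * 2) ν ^ 2
      ≤ D ^ 2 * (4 * (1 - x)⁻¹ * ∑' k, (a k ^ 2 + b k ^ 2)) := by
  -- The block of higher index goes into the decaying norm and the other into the growing one; the
  -- powers combine to x^(l-j).
  have hle : ∀ j l, j ≤ l → eLpNorm (fun y => f j y * f l y) p ν ≤
      D ^ 2 * (x ^ (Nat.dist j l) * ((a j ^ 2 + b j ^ 2) + (a l ^ 2 + b l ^ 2))) := by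
    intro j l hjl
    have h1 : eLpNorm (fun y => f l y * f j y) p ν ≤ eLpNorm (f l) r₁ ν * eLpNorm (f j) r₂ ν :=
      eLpNorm_smul_le_mul_eLpNorm (𝕜 := ℝ) (f := f j) (φ := f l) (hf j) (hf l)
    simp_rw [mul_comm (f j _)]
    refine h1.trans ((mul_le_mul' (ha l) (hb j)).trans ?_)
    obtain ⟨i, rfl⟩ := Nat.exists_eq_add_of_le hjl
    have h0 : Nat.dist j (j + i) = i := by simp only [Nat.dist]; omega
    have h2 : x ^ (j + i) * x⁻¹ ^ j = x ^ (Nat.dist j (j + i)) := by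
      rw [pow_add, mul_right_comm, ← mul_pow, ENNReal.mul_inv_cancel hx0 hx, one_pow, one_mul, h0]
    calc D * x ^ (j + i) * a (j + i) * (D * x⁻¹ ^ j * b j)
        = D ^ 2 * ((x ^ (j + i) * x⁻¹ ^ j) * (a (j + i) * b j)) := by ring
      _ ≤ _ := by
        rw [h2]
        gcongr
        refine (ennreal_mul_le_sq_add_sq _ _).trans ?_
        rw [add_comm]
        exact add_le_add le_add_self le_self_add
  have hall : ∀ j l, eLpNorm (fun y => f j y * f l y) p ν ≤
      D ^ 2 * (x ^ (Nat.dist j l) * ((a j ^ 2 + b j ^ 2) + (a l ^ 2 + b l ^ 2))) := by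
    intro j l
    rcases le_total j l with h | h
    · exact hle j l h
    · have := hle l j h
      rw [Nat.dist_comm, add_comm (a l ^ 2 + b l ^ 2)] at this
      simpa only [mul_comm (f l _)] using this
  rw [eLpNorm_sq_eq]
  have hexp : (fun y => (∑ k ∈ Finset.range n, f k) y * (∑ k ∈ Finset.range n, f k) y)
      = ∑ j ∈ Finset.range n, ∑ l ∈ Finset.range n, fun y => f j y * f l y := by
    ext y
    simp only [Finset.sum_apply]
    exact Finset.sum_mul_sum _ _ _ _
  rw [hexp]
  refine (eLpNorm_sum_le (fun j _ => Finset.aestronglyMeasurable_sum _ fun l _ =>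
    (hf j).mul (hf l)) hp).trans ?_
  refine (Finset.sum_le_sum fun j _ => (eLpNorm_sum_le (fun l _ => (hf j).mul (hf l)) hp).trans
    (Finset.sum_le_sum fun l _ => hall j l)).trans ?_
  simp_rw [← Finset.mul_sum]
  gcongr
  exact sum_sum_pow_dist_le x (fun k => a k ^ 2 + b k ^ 2) n

end Blocks

/-! ### Semicontinuity of Lebesgue norms -/

/-- Convergence in L² gives almost everywhere convergence along a subsequence, and Fatou applies.
The centre c is kept for measuring distances in Lᵖ. -/
theorem isClosed_eLpNorm_sub_le (c : R3 → ℝ) (hc : AEStronglyMeasurable c volume) (r M : ℝ≥0∞) :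
    IsClosed {f : L2 | eLpNorm (fun x => f x - c x) r volume ≤ M} := by
  refine isClosed_of_closure_subset fun f hf => ?_
  obtain ⟨u, hu, hlim⟩ := mem_closure_iff_seq_limit.1 hf
  have h1 : TendstoInMeasure volume (fun n => (u n : R3 → ℝ)) atTop f :=
    tendstoInMeasure_of_tendsto_Lp hlim
  obtain ⟨ns, -, hns⟩ := h1.exists_seq_tendsto_ae
  refine (Lp.eLpNorm_lim_le_liminf_eLpNorm (f := fun n x => u (ns n) x - c x)
    (fun n => (Lp.aestronglyMeasurable _).sub hc) _ ?_).trans ?_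
  · filter_upwards [hns] with x hx
    exact hx.sub_const _
  · refine (liminf_le_liminf (v := fun _ => M) (Eventually.of_forall fun n => hu (ns n))).trans ?_
    rw [liminf_const]

theorem isClosed_eLpNorm_le (r M : ℝ≥0∞) : IsClosed {f : L2 | eLpNorm f r volume ≤ M} := by
  simpa using isClosed_eLpNorm_sub_le 0 aestronglyMeasurable_const r M

/-- The bound for partial sums is uniform, the partial sums converge in L², and sublevel sets of the
Lebesgue norm are closed there. -/
theorem LittlewoodPaleyPair.eLpNorm_sq_le_of_block (P : LittlewoodPaleyPair)
    {p r₁ r₂ : ℝ≥0∞} (hp : 1 ≤ p) [ENNReal.HolderTriple r₁ r₂ p]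
    {x D : ℝ≥0∞} (hx0 : x ≠ 0) (hx : x ≠ ∞) {a b : ℕ → ℝ≥0∞} {f : L2}
    (ha : ∀ k, eLpNorm (P.block k f) r₁ volume ≤ D * x ^ k * a k)
    (hb : ∀ k, eLpNorm (P.block k f) r₂ volume ≤ D * x⁻¹ ^ k * b k) :
    eLpNorm f (p * 2) volume ^ 2 ≤ D ^ 2 * (4 * (1 - x)⁻¹ * ∑' k, (a k ^ 2 + b k ^ 2)) := by
  set R := D ^ 2 * (4 * (1 - x)⁻¹ * ∑' k, (a k ^ 2 + b k ^ 2)) with hR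
  have h1 := (isClosed_eLpNorm_le (p * 2) (R ^ (1 / 2 : ℝ))).mem_of_tendsto
    (P.tendsto_sum_block f) (Eventually.of_forall fun n => ?_)
  · have h2 := pow_le_pow_left' (show eLpNorm f (p * 2) volume ≤ R ^ (1 / 2 : ℝ) from h1) 2
    rw [← ENNReal.rpow_natCast (R ^ (1 / 2 : ℝ)), ← ENNReal.rpow_mul] at h2
    simpa using h2
  · change eLpNorm _ _ _ ≤ _
    rw [eLpNorm_congr_ae (Lp.coeFn_finsetSum _ _)]
    have h3 := eLpNorm_sum_sq_le hp (f := fun k => (P.block k f : R3 → ℝ))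
      (fun k => Lp.aestronglyMeasurable _) hx0 hx ha hb n
    have h4 := ENNReal.rpow_le_rpow h3 (z := 1 / 2) (by norm_num)
    rw [← ENNReal.rpow_natCast, ← ENNReal.rpow_mul] at h4
    simpa [hR] using h4

/-! ### The Sobolev embedding -/

section Interpolation

variable {α : Type*} {mα : MeasurableSpace α} {ν : Measure α}

theorem eLpNorm_three_pow_le {f : α → ℝ} (hf : eLpNorm f ∞ ν ≠ ∞) :
    eLpNorm f 3 ν ^ 3 ≤ eLpNorm f ∞ ν * eLpNorm f 2 ν ^ 2 := by
  have h3 := eLpNorm_nnreal_pow_eq_lintegral (f := f) (μ := ν) (p := 3) (by norm_num)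
  have h2 := eLpNorm_nnreal_pow_eq_lintegral (f := f) (μ := ν) (p := 2) (by norm_num)
  simp only [NNReal.coe_ofNat, ENNReal.rpow_ofNat, ENNReal.coe_ofNat] at h3 h2
  rw [eLpNorm_exponent_top] at hf ⊢
  rw [h3, h2, ← lintegral_const_mul' _ _ hf]
  refine lintegral_mono_ae ?_
  filter_upwards [enorm_ae_le_eLpNormEssSup f ν] with x hx
  rw [pow_succ' _ 2]
  gcongr

theorem eLpNorm_lt_top_of_mem_Icc {f : α → ℝ} {p q r : ℝ} (hp : 0 < p) (hpr : p ≤ r) (hrq : r ≤ q)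
    (hf : AEStronglyMeasurable f ν) (h1 : eLpNorm f (ENNReal.ofReal p) ν < ∞)
    (h2 : eLpNorm f (ENNReal.ofReal q) ν < ∞) : eLpNorm f (ENNReal.ofReal r) ν < ∞ := by
  have key : ∀ {s : ℝ}, 0 < s →
      (eLpNorm f (ENNReal.ofReal s) ν < ∞ ↔ ∫⁻ a, ‖f a‖ₑ ^ s ∂ν < ∞) := fun {s} hs => by
    rw [eLpNorm_lt_top_iff_lintegral_rpow_enorm_lt_top (by simpa using hs) ENNReal.ofReal_ne_top,
      ENNReal.toReal_ofReal hs.le]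
  have hr := hp.trans_le hpr
  rw [key hp] at h1
  rw [key (hr.trans_le hrq)] at h2
  rw [key hr]
  have hle : ∀ a, ‖f a‖ₑ ^ r ≤ ‖f a‖ₑ ^ p + ‖f a‖ₑ ^ q := fun a => by
    rcases le_total ‖f a‖ₑ 1 with h | h
    · exact (ENNReal.rpow_le_rpow_of_exponent_ge h hpr).trans le_self_add
    · exact (ENNReal.rpow_le_rpow_of_exponent_le h hrq).trans le_add_self
  refine (lintegral_mono hle).trans_lt ?_
  rw [lintegral_add_left' (hf.enorm.pow_const p)]
  exact ENNReal.add_lt_top.2 ⟨h1, h2⟩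

end Interpolation

namespace LittlewoodPaleyPair

variable (P : LittlewoodPaleyPair)

/-- On the support of the k-th symbol 2^k ω⁻¹ ≤ 4. Since symbols lie in [0, 1], their squares are
bounded by the symbols, which sum to 1; hence the constant 16. -/
theorem tsum_block_bessel_le (g : L2) :
    ∑' k, (2 ^ k * ‖P.block k (bessel g)‖ₑ) ^ 2 ≤ 16 * ‖g‖ₑ ^ 2 := by
  have hmeas : Measurable fun ξ => ‖fourierL2 g ξ‖ₑ ^ 2 :=
    (Lp.stronglyMeasurable (fourierL2 g)).measurable.enorm.pow_const 2
  have h1 : ∀ k, (2 ^ k * ‖P.block k (bessel g)‖ₑ) ^ 2 ≤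
      ∫⁻ ξ, ENNReal.ofReal (P.symbol k ξ) * (16 * ‖fourierL2 g ξ‖ₑ ^ 2) := by
    intro k
    rw [mul_pow, enorm_sq_eq_lintegral, ← lintegral_const_mul' _ _ (by finiteness)]
    refine lintegral_mono_ae ?_
    filter_upwards [fourierL2_mult (P.isSymbol_symbol k) (bessel g), fourierL2_bessel g]
      with ξ e1 e2
    rw [block, e1, e2, ← mul_assoc, ← Complex.ofReal_mul, enorm_mul, mul_pow, ← mul_assoc,
      ← mul_assoc, ← mul_pow]
    gcongr
    have h2 : ‖((P.symbol k ξ * (omega ξ)⁻¹ : ℝ) : ℂ)‖ₑ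
        = ENNReal.ofReal (P.symbol k ξ * (omega ξ)⁻¹) := by
      rw [← ofReal_norm, Complex.norm_real, Real.norm_of_nonneg]
      exact mul_nonneg (P.symbol_nonneg k ξ) (inv_nonneg.2 (omega_pos ξ).le)
    have h3 : (2 : ℝ≥0∞) ^ k = ENNReal.ofReal (2 ^ k) := by
      rw [ENNReal.ofReal_pow (by norm_num)]; simp
    have h4 : (16 : ℝ≥0∞) = ENNReal.ofReal 16 := by simp
    have hs := P.symbol_nonneg k ξ
    have hs1 := P.symbol_le_one k ξ
    have ho := omega_pos ξ
    rw [h2, h3, h4, ← ENNReal.ofReal_mul (by positivity), ← ENNReal.ofReal_mul hs,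
      ← ENNReal.ofReal_pow (by positivity)]
    refine ENNReal.ofReal_le_ofReal ?_
    by_cases h0 : P.symbol k ξ = 0
    · simp [h0]
    · have h5 : 2 ^ k * (omega ξ)⁻¹ ≤ 4 := by
        rw [← div_eq_mul_inv, div_le_iff₀ ho]
        exact P.two_pow_le_of_symbol_ne_zero h0
      have h6 : 0 ≤ 2 ^ k * (omega ξ)⁻¹ := by positivity
      calc (2 ^ k * (P.symbol k ξ * (omega ξ)⁻¹)) ^ 2
          = P.symbol k ξ ^ 2 * (2 ^ k * (omega ξ)⁻¹) ^ 2 := by ring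
        _ ≤ P.symbol k ξ * 4 ^ 2 := by
            gcongr
            nlinarith
        _ = P.symbol k ξ * 16 := by norm_num
  refine (ENNReal.tsum_le_tsum h1).trans ?_
  have hm : ∀ k, AEMeasurable
      (fun ξ => ENNReal.ofReal (P.symbol k ξ) * (16 * ‖fourierL2 g ξ‖ₑ ^ 2)) volume := fun k =>
    ((P.measurable_symbol k).ennreal_ofReal.mul (hmeas.const_mul 16)).aemeasurable
  rw [← lintegral_tsum hm, enorm_sq_eq_lintegral,
    ← lintegral_const_mul' _ _ (by norm_num)]
  refine lintegral_mono fun ξ => ?_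
  rw [ENNReal.tsum_mul_right, ← ENNReal.ofReal_tsum_of_nonneg (fun k => P.symbol_nonneg k ξ)
    (P.hasSum_symbol ξ).summable, (P.hasSum_symbol ξ).tsum_eq, ENNReal.ofReal_one, one_mul]

end LittlewoodPaleyPair

theorem memLp_six_bessel (g : L2) : MemLp (bessel g) 6 volume := by
  obtain ⟨P⟩ := nonempty_littlewoodPaleyPair
  refine ⟨Lp.aestronglyMeasurable _, ?_⟩
  -- With y² = 2, Bernstein bounds the L^∞ norm of the block k by y^(3k) times its L² norm, and
  -- interpolation with L² bounds its L³ norm by y^k. Relative to 2^k = y^(2k) these are growth y^k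
  -- and decay y^(-k), and 1/3 + 1/∞ = 2/6 leads to L⁶.
  set y : ℝ≥0∞ := 2 ^ (1 / 2 : ℝ) with hy
  have hy2 : y ^ 2 = 2 := by
    rw [hy, ← ENNReal.rpow_natCast, ← ENNReal.rpow_mul]; norm_num
  have hy0 : y ≠ 0 := fun h => by simp [h] at hy2
  have hyt : y ≠ ∞ := fun h => by simp [h] at hy2
  have hyx : ∀ k, y⁻¹ ^ k * y ^ k = 1 := fun k => by
    rw [← mul_pow, ENNReal.inv_mul_cancel hy0 hyt, one_pow]
  have hroot : ∀ n : ℕ, ((2 : ℝ≥0∞) ^ n) ^ (1 / 2 : ℝ) = y ^ n := fun n => by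
    rw [← hy2, ← pow_mul, ← ENNReal.rpow_natCast, ← ENNReal.rpow_mul, ← ENNReal.rpow_natCast]
    congr 1
    push_cast
    ring
  set W : ℝ≥0∞ := volume (Metric.ball (0 : R3) 1) ^ (1 / 2 : ℝ) with hW
  have hWt : W ≠ ∞ := ENNReal.rpow_ne_top_of_nonneg (by norm_num) measure_ball_lt_top.ne
  have hvol : ∀ k : ℕ, volume (Metric.closedBall (0 : R3) (2 ^ k)) ^ (1 / 2 : ℝ)
      = y ^ (3 * k) * W := fun k => by
    rw [Measure.addHaar_closedBall _ _ (by positivity), finrank_euclideanSpace_fin,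
      ENNReal.mul_rpow_of_nonneg _ _ (by norm_num), ← pow_mul, ENNReal.ofReal_pow (by norm_num),
      ENNReal.ofReal_ofNat, mul_comm k 3, hroot]
  set A : ℕ → ℝ≥0∞ := fun k => ‖P.block k (bessel g)‖ₑ with hA
  have hinf : ∀ k, eLpNorm (P.block k (bessel g)) ∞ volume ≤ A k * (y ^ (3 * k) * W) := fun k => by
    have := P.eLpNorm_top_block_le k (bessel g)
    rwa [hvol k] at this
  have h2 : ∀ k, eLpNorm (P.block k (bessel g)) 2 volume = A k := fun k => (Lp.enorm_def _).symm
  have hb : ∀ k, eLpNorm (P.block k (bessel g)) ∞ volume ≤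
      (1 + W) * y⁻¹⁻¹ ^ k * (2 ^ k * A k) := fun k => by
    refine (hinf k).trans ?_
    rw [inv_inv, ← hy2, ← pow_mul]
    calc A k * (y ^ (3 * k) * W) = W * y ^ k * (y ^ (2 * k) * A k) := by ring
      _ ≤ _ := by gcongr; exact le_add_self
  have ha : ∀ k, eLpNorm (P.block k (bessel g)) 3 volume ≤
      (1 + W) * y⁻¹ ^ k * (2 ^ k * A k) := fun k => by
    have hfin : eLpNorm (P.block k (bessel g)) ∞ volume ≠ ∞ :=
      ((hinf k).trans_lt (by finiteness)).ne
    have h3 := eLpNorm_three_pow_le hfin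
    rw [h2] at h3
    rw [← ENNReal.pow_le_pow_left_iff three_ne_zero]
    refine (h3.trans (mul_le_mul_left (hinf k) _)).trans ?_
    -- Interpolation leaves the cube root of W; 1 + W serves for both exponents.
    have hD : W ≤ (1 + W) ^ 3 := le_add_self.trans (le_self_pow₀ le_self_add three_ne_zero)
    calc A k * (y ^ (3 * k) * W) * A k ^ 2
        = W * (y⁻¹ ^ k * y ^ k) ^ 3 * y ^ (3 * k) * A k ^ 3 := by rw [hyx]; ring
      _ ≤ (1 + W) ^ 3 * (y⁻¹ ^ k * y ^ k) ^ 3 * y ^ (3 * k) * A k ^ 3 := by gcongr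
      _ = _ := by rw [← hy2]; ring
  have hT : ENNReal.HolderTriple 3 ∞ 3 := ⟨by simp⟩
  have key := P.eLpNorm_sq_le_of_block (p := 3) (by norm_num) (ENNReal.inv_ne_zero.2 hyt)
    (ENNReal.inv_ne_top.2 hy0) ha hb
  rw [show (3 : ℝ≥0∞) * 2 = 6 by norm_num] at key
  have hx : y⁻¹ < 1 := by
    rw [ENNReal.inv_lt_one]
    exact ENNReal.one_lt_rpow (by norm_num) (by norm_num)
  have hfin : (1 + W) ^ 2 * (4 * (1 - y⁻¹)⁻¹ *
      ∑' k, ((2 ^ k * A k) ^ 2 + (2 ^ k * A k) ^ 2)) < ∞ := by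
    have h5 : (1 - y⁻¹)⁻¹ ≠ ∞ := ENNReal.inv_ne_top.2 (tsub_pos_of_lt hx).ne'
    have h6 : ∑' k, (2 ^ k * A k) ^ 2 ≠ ∞ :=
      ((P.tsum_block_bessel_le g).trans_lt (by finiteness)).ne
    rw [ENNReal.tsum_add]
    finiteness
  have h7 := key.trans_lt hfin
  exact (ENNReal.pow_lt_top_iff.1 h7).resolve_right two_ne_zero

theorem memLp_bessel {r : ℝ} (h2 : 2 ≤ r) (h6 : r ≤ 6) (g : L2) :
    MemLp (bessel g) (ENNReal.ofReal r) volume := by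
  refine ⟨Lp.aestronglyMeasurable _, eLpNorm_lt_top_of_mem_Icc two_pos h2 h6
    (Lp.aestronglyMeasurable _) ?_ ?_⟩
  · simpa using! Lp.eLpNorm_lt_top (bessel g)
  · simpa using! (memLp_six_bessel g).2

/-- An operator on `L²` with values in `Lᵖ` is bounded from `L²` to `Lᵖ`. -/
theorem exists_clm_of_memLp {p : ℝ≥0∞} [Fact (1 ≤ p)] (A : L2 →L[ℝ] L2)
    (h : ∀ g, MemLp (A g) p volume) :
    ∃ E : L2 →L[ℝ] Lp ℝ p (volume : Measure R3), ∀ g, E g =ᵐ[volume] A g := by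
  let E : L2 →ₗ[ℝ] Lp ℝ p (volume : Measure R3) :=
    { toFun := fun g => (h g).toLp
      map_add' := fun f g => by
        refine Lp.ext ?_
        filter_upwards [(h (f + g)).coeFn_toLp, (h f).coeFn_toLp, (h g).coeFn_toLp,
          Lp.coeFn_add (h f).toLp (h g).toLp, Lp.coeFn_add (A f) (A g)] with x e1 e2 e3 e4 e5
        rw [e1, e4, Pi.add_apply, e2, e3, map_add, e5, Pi.add_apply]
      map_smul' := fun c f => by
        refine Lp.ext ?_
        filter_upwards [(h (c • f)).coeFn_toLp, (h f).coeFn_toLp,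
          Lp.coeFn_smul c (h f).toLp, Lp.coeFn_smul c (A f)] with x e1 e2 e4 e5
        rw [RingHom.id_apply, e1, e4, Pi.smul_apply, e2, map_smul, e5, Pi.smul_apply] }
  have hE : ∀ g, E g =ᵐ[volume] A g := fun g => (h g).coeFn_toLp
  -- Convergence in L² and in Lᵖ both imply convergence in measure, whose limit is unique; so the
  -- graph is closed.
  refine ⟨ContinuousLinearMap.ofSeqClosedGraph (g := E) fun u f k hu hk => ?_, hE⟩
  have h1 : TendstoInMeasure volume (fun n => (A (u n) : R3 → ℝ)) atTop (A f) :=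
    tendstoInMeasure_of_tendsto_Lp ((A.continuous.tendsto f).comp hu)
  have h2 : TendstoInMeasure volume (fun n => (E (u n) : R3 → ℝ)) atTop k :=
    tendstoInMeasure_of_tendsto_Lp hk
  have h3 := h2.congr' (Eventually.of_forall fun n => hE (u n)) EventuallyEq.rfl
  exact Lp.ext ((tendstoInMeasure_ae_unique h3 h1).trans (hE f).symm)

/-! ### Functions in the resolution space -/

/-- Index k stands for S₀ if k = 0 and for Δ_(k-1) otherwise. The truncated difference k - 1 gives
S₀ the weight 1, as in the Besov norm. The cross term of the square is dropped. -/
theorem LittlewoodPaleyPair.tsum_block_sq_le_besovENorm_sq (P : LittlewoodPaleyPair) (σ : ℝ)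
    (r : ℝ≥0∞) (f : L2) :
    ∑' k : ℕ, (ENNReal.ofReal (2 ^ (((k - 1 : ℕ) : ℝ) * σ)) *
      eLpNorm (P.block k f) r volume) ^ 2 ≤ besovENorm P σ r f ^ 2 := by
  rw [tsum_eq_zero_add' ENNReal.summable, besovENorm, eLpNorm_lowFrequency]
  simp_rw [eLpNorm_dyadicBlock, Nat.add_sub_cancel]
  rw [add_sq, ← ENNReal.rpow_natCast (_ ^ (1 / 2 : ℝ)), ← ENNReal.rpow_mul]
  norm_num
  rw [add_comm, add_right_comm]
  exact le_self_add

/-- The Lebesgue exponent with `1 / r = 1 / 2 - δ`. -/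
def strichartzExp (δ : ℝ) : ℝ≥0∞ := ENNReal.ofReal (1 / 2 - δ)⁻¹

theorem recip_ofReal_inv {a : ℝ} (ha : 0 < a) : recip (ENNReal.ofReal a⁻¹) = a := by
  rw [recip, ← ENNReal.ofReal_inv_of_pos (inv_pos.2 ha), inv_inv, ENNReal.toReal_ofReal ha.le]

theorem admissible_strichartzExp {δ : ℝ} (h0 : 0 < δ) (h1 : δ < 1 / 2) :
    Admissible 0 (ENNReal.ofReal δ⁻¹) (strichartzExp δ) := by
  have h2 : 0 < 1 / 2 - δ := by linarith
  have key : ∀ {a : ℝ}, 0 < a → a ≤ 1 / 2 → 2 ≤ ENNReal.ofReal a⁻¹ := fun {a} ha ha2 => by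
    rw [← ENNReal.ofReal_ofNat]
    refine ENNReal.ofReal_le_ofReal ?_
    rw [le_inv_comm₀ two_pos ha]
    linarith
  refine ⟨key h0 h1.le, key h2 (by linarith), fun h => ENNReal.ofReal_ne_top h.2.1, ?_⟩
  rw [strichartzExp, recip_ofReal_inv h0, recip_ofReal_inv h2]
  linarith

/-- The Besov embedding behind the use of two Strichartz norms. -/
theorem LittlewoodPaleyPair.exists_eLpNorm_sq_le_besovENorm (P : LittlewoodPaleyPair) {γ : ℝ}
    (hγ₂ : 2 < γ) (hγ₃ : γ < 3) : ∃ C : ℝ≥0∞, C ≠ ∞ ∧ ∀ f : L2,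
      eLpNorm f (rhoExp γ) volume ^ 2 ≤
        C * (besovENorm P (1 / 6) (strichartzExp ((γ - 1) / 6 - 1 / 12)) f ^ 2 +
          besovENorm P (-(1 / 6)) (strichartzExp ((γ - 1) / 6 + 1 / 12)) f ^ 2) := by
  -- The two values of δ lie symmetrically about (γ-1)/6, so that 1/r₁ + 1/r₂ = (4-γ)/3 = 1/p and 2p
  -- = 6/(4-γ).
  set r₁ := strichartzExp ((γ - 1) / 6 - 1 / 12) with hr₁
  set r₂ := strichartzExp ((γ - 1) / 6 + 1 / 12) with hr₂
  set p : ℝ≥0∞ := ENNReal.ofReal (3 / (4 - γ)) with hp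
  have hp2 : p * 2 = rhoExp γ := by
    rw [hp, rhoExp, ← ENNReal.ofReal_ofNat 2, ← ENNReal.ofReal_mul (by
      apply div_nonneg <;> linarith)]
    congr 1
    ring
  have hp1 : 1 ≤ p := by
    rw [hp, ← ENNReal.ofReal_one]
    refine ENNReal.ofReal_le_ofReal ?_
    rw [le_div_iff₀ (by linarith)]
    linarith
  have hT : ENNReal.HolderTriple r₁ r₂ p := ⟨by
    rw [hr₁, hr₂, hp, strichartzExp, strichartzExp,
      ← ENNReal.ofReal_inv_of_pos (inv_pos.2 (by linarith)),
      ← ENNReal.ofReal_inv_of_pos (inv_pos.2 (by linarith)),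
      ← ENNReal.ofReal_inv_of_pos (div_pos three_pos (by linarith)), inv_inv, inv_inv,
      ← ENNReal.ofReal_add (by linarith) (by linarith)]
    congr 1
    rw [inv_div]
    ring⟩
  set x : ℝ≥0∞ := ENNReal.ofReal (2 ^ (-(1 / 6) : ℝ)) with hx
  have hxpos : (0 : ℝ) < 2 ^ (-(1 / 6) : ℝ) := by positivity
  have hx0 : x ≠ 0 := by rw [hx]; simpa using hxpos
  have hxt : x ≠ ∞ := ENNReal.ofReal_ne_top
  have hx1 : x < 1 := by
    rw [hx, ← ENNReal.ofReal_one]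
    exact (ENNReal.ofReal_lt_ofReal_iff one_pos).2
      (Real.rpow_lt_one_of_one_lt_of_neg (by norm_num) (by norm_num))
  have hxx : x⁻¹ * x = 1 := ENNReal.inv_mul_cancel hx0 hxt
  have hx1' : 1 ≤ x⁻¹ := ENNReal.one_le_inv.2 hx1.le
  have hneg : ∀ j : ℕ, ENNReal.ofReal (2 ^ ((j : ℝ) * (-(1 / 6)))) = x ^ j := fun j => by
    rw [hx, ← ENNReal.ofReal_pow hxpos.le, ← Real.rpow_natCast, ← Real.rpow_mul (by norm_num),
      mul_comm]
  have hpos : ∀ j : ℕ, ENNReal.ofReal (2 ^ ((j : ℝ) * (1 / 6))) = x⁻¹ ^ j := fun j => by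
    rw [← ENNReal.inv_pow, ← hneg, ← ENNReal.ofReal_inv_of_pos (by positivity),
      ← Real.rpow_neg (by norm_num)]
    congr 2
    ring
  -- The factor x⁻¹ = 2^(1/6) on each norm pays for the weights 2^((k-1)σ) in place of 2^(kσ).
  refine ⟨x⁻¹ ^ 2 * (4 * (1 - x)⁻¹), ?_, fun f => ?_⟩
  · have h1 : (1 - x)⁻¹ ≠ ∞ := ENNReal.inv_ne_top.2 (tsub_pos_of_lt hx1).ne'
    have h2 : x⁻¹ ≠ ∞ := ENNReal.inv_ne_top.2 hx0
    finiteness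
  have ha : ∀ k, eLpNorm (P.block k f) r₁ volume ≤ x⁻¹ * x ^ k *
      (ENNReal.ofReal (2 ^ (((k - 1 : ℕ) : ℝ) * (1 / 6))) * eLpNorm (P.block k f) r₁ volume) := by
    intro k
    rw [hpos, ← mul_assoc]
    refine le_mul_of_one_le_left zero_le ?_
    cases k with
    | zero => simpa using hx1'
    | succ j =>
      rw [Nat.add_sub_cancel, pow_succ']
      calc (1 : ℝ≥0∞) = (x⁻¹ * x) * (x⁻¹ * x) ^ j := by rw [hxx, one_pow, one_mul]
        _ = x⁻¹ * (x * x ^ j) * x⁻¹ ^ j := by ring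
        _ ≤ _ := le_rfl
  have hb : ∀ k, eLpNorm (P.block k f) r₂ volume ≤ x⁻¹ * x⁻¹ ^ k *
      (ENNReal.ofReal (2 ^ (((k - 1 : ℕ) : ℝ) * (-(1 / 6)))) *
        eLpNorm (P.block k f) r₂ volume) := by
    intro k
    rw [hneg, ← mul_assoc]
    refine le_mul_of_one_le_left zero_le ?_
    cases k with
    | zero => simpa using hx1'
    | succ j =>
      rw [Nat.add_sub_cancel, pow_succ']
      calc (1 : ℝ≥0∞) ≤ x⁻¹ * x⁻¹ := one_le_mul hx1' hx1'
        _ = x⁻¹ * x⁻¹ * (x⁻¹ * x) ^ j := by rw [hxx, one_pow, mul_one]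
        _ = x⁻¹ * (x⁻¹ * x⁻¹ ^ j) * x ^ j := by ring
        _ ≤ _ := le_rfl
  have key := P.eLpNorm_sq_le_of_block hp1 hx0 hxt ha hb
  rw [hp2, ENNReal.tsum_add] at key
  refine key.trans ?_
  rw [mul_assoc, mul_assoc, mul_assoc]
  gcongr
  · exact P.tsum_block_sq_le_besovENorm_sq _ _ f
  · exact P.tsum_block_sq_le_besovENorm_sq _ _ f

/-! ### Borel measurability of Lebesgue and Besov norms and of maps into Lᵖ -/

section Measurability

variable [MeasurableSpace L2] [BorelSpace L2]

theorem measurable_eLpNorm_sub (c : R3 → ℝ) (hc : AEStronglyMeasurable c volume) (r : ℝ≥0∞) :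
    Measurable fun f : L2 => eLpNorm (fun x => f x - c x) r volume :=
  measurable_of_Iic fun M => (isClosed_eLpNorm_sub_le c hc r M).measurableSet

theorem measurable_eLpNorm (r : ℝ≥0∞) : Measurable fun f : L2 => eLpNorm f r volume :=
  measurable_of_Iic fun M => (isClosed_eLpNorm_le r M).measurableSet

theorem LittlewoodPaleyPair.measurable_besovENorm (P : LittlewoodPaleyPair) (σ : ℝ) (r : ℝ≥0∞) :
    Measurable fun f : L2 => besovENorm P σ r f := by
  unfold besovENorm
  simp_rw [P.eLpNorm_dyadicBlock, P.eLpNorm_lowFrequency]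
  have h : ∀ k, Measurable fun f : L2 => eLpNorm (P.block k f) r volume := fun k =>
    (measurable_eLpNorm r).comp (P.block k).continuous.measurable
  exact ((Measurable.tsum fun j => ((h _).const_mul _).pow_const 2).pow_const _).add (h 0)

end Measurability

/-- The class in `Lᵖ` of a function in `L² ∩ Lᵖ`, and `0` for the other functions. -/
def toLpOrZero (p : ℝ≥0∞) (f : L2) : Lp ℝ p (volume : Measure R3) :=
  open Classical in if h : MemLp f p volume then h.toLp else 0

theorem toLpOrZero_ae_eq {p : ℝ≥0∞} {f : L2} (h : MemLp f p volume) :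
    toLpOrZero p f =ᵐ[volume] f := by
  rw [toLpOrZero, dif_pos h]
  exact h.coeFn_toLp

theorem enorm_toLpOrZero_le (p : ℝ≥0∞) [Fact (1 ≤ p)] (f : L2) : ‖toLpOrZero p f‖ₑ ≤ eLpNorm f p volume := by
  by_cases h : MemLp f p volume
  · rw [Lp.enorm_def, eLpNorm_congr_ae (toLpOrZero_ae_eq h)]
  · rw [toLpOrZero, dif_neg h, enorm_zero]
    exact zero_le

/-- In a separable space every open set is a countable union of balls. -/
theorem measurable_of_measurable_edist {α X : Type*} [MeasurableSpace α] [PseudoEMetricSpace X]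
    [SecondCountableTopology X] [MeasurableSpace X] [BorelSpace X] {f : α → X}
    (h : ∀ c, Measurable fun a => edist (f a) c) : Measurable f := by
  refine measurable_of_isOpen fun U hU => ?_
  choose! ε hε hball using fun x (hx : x ∈ U) => EMetric.isOpen_iff.1 hU x hx
  obtain ⟨S, hS, hSU⟩ := TopologicalSpace.isOpen_iUnion_countable
    (fun x : U => Metric.eball (x : X) (ε x)) fun x => Metric.isOpen_eball
  have hU' : U = ⋃ x ∈ S, Metric.eball (x : X) (ε x) := by
    rw [hSU]
    refine Subset.antisymm (fun x hx => mem_iUnion.2 ⟨⟨x, hx⟩, Metric.mem_eball_self (hε x hx)⟩) ?_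
    exact iUnion_subset fun x => hball x x.2
  rw [hU', preimage_iUnion₂]
  refine MeasurableSet.biUnion hS fun x _ => ?_
  exact h x measurableSet_Iio

/-- The curve v is continuous in L² only, while the source needs a measurable curve in L^ρ. The
distance to a fixed c is an Lᵖ norm of a difference, lower semicontinuous on L² and hence Borel; Lᵖ
is separable as p < ∞. -/
theorem measurable_toLpOrZero {p : ℝ≥0∞} [Fact (1 ≤ p)] (hp : p ≠ ∞) [MeasurableSpace L2]
    [BorelSpace L2] [MeasurableSpace (Lp ℝ p (volume : Measure R3))]
    [BorelSpace (Lp ℝ p (volume : Measure R3))] : Measurable (toLpOrZero p) := by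
  have : Fact (p ≠ ∞) := ⟨hp⟩
  refine measurable_of_measurable_edist fun c => ?_
  have hS : MeasurableSet {f : L2 | MemLp f p volume} := by
    have : {f : L2 | MemLp f p volume} = {f : L2 | eLpNorm f p volume < ∞} := by
      ext f
      exact ⟨fun h => h.2, fun h => ⟨Lp.aestronglyMeasurable f, h⟩⟩
    rw [this]
    exact measurable_eLpNorm p measurableSet_Iio
  classical
  have heq : (fun f => edist (toLpOrZero p f) c) = fun f => if f ∈ {f : L2 | MemLp f p volume}
      then eLpNorm (fun x => f x - c x) p volume else edist 0 c := by
    ext f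
    by_cases h : MemLp f p volume
    · rw [if_pos (show f ∈ {f : L2 | MemLp f p volume} from h), Lp.edist_def]
      refine eLpNorm_congr_ae ?_
      filter_upwards [toLpOrZero_ae_eq h] with x hx
      rw [Pi.sub_apply, hx]
    · rw [if_neg (show f ∉ {f : L2 | MemLp f p volume} from h), toLpOrZero, dif_neg h]
  rw [heq]
  exact Measurable.ite hS (measurable_eLpNorm_sub c (Lp.aestronglyMeasurable c) p)
    measurable_const

theorem enorm_le_sobolevENorm {s : ℝ} (hs : 0 ≤ s) (f : L2) : ‖f‖ₑ ≤ sobolevENorm s f := by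
  have h : ‖f‖ₑ = eLpNorm (fourierL2 f) 2 volume := by
    rw [← Lp.enorm_def, ← fourierIso_apply, ← ofReal_norm, ← ofReal_norm, fourierIso.norm_map]
  rw [h]
  refine eLpNorm_mono fun ξ => ?_
  rw [norm_mul, Complex.norm_real]
  refine le_mul_of_one_le_left (norm_nonneg _) ?_
  exact (Real.one_le_rpow (by nlinarith [sq_nonneg (2 * Real.pi * ‖ξ‖)]) (by linarith)).trans
    (le_abs_self _)

theorem ContinuousIntoSobolev.continuousOn {s : ℝ} (hs : 0 ≤ s) {I : Set ℝ} {u : ℝ → L2}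
    (hu : ContinuousIntoSobolev s I u) : ContinuousOn u I := fun t ht => by
  rw [ContinuousWithinAt, tendsto_iff_edist_tendsto_0]
  refine tendsto_of_tendsto_of_tendsto_of_le_of_le tendsto_const_nhds (hu.2 t ht)
    (fun _ => zero_le) fun τ => ?_
  rw [edist_eq_enorm_sub]
  exact enorm_le_sobolevENorm hs _

theorem lintegral_sq_lt_top_of_eLpNorm_lt_top {α : Type*} {mα : MeasurableSpace α}
    {ν : Measure α} [IsFiniteMeasure ν] {B : α → ℝ≥0∞} (hB : AEMeasurable B ν) {q : ℝ≥0∞}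
    (hq : 2 ≤ q) (h : eLpNorm B q ν < ∞) : ∫⁻ t, B t ^ 2 ∂ν < ∞ := by
  have hexp : 0 ≤ 1 / (2 : ℝ≥0∞).toReal - 1 / q.toReal := by
    rcases eq_or_ne q ∞ with rfl | hqt
    · simp
    · exact sub_nonneg.2 (one_div_le_one_div_of_le (by norm_num) (ENNReal.toReal_mono hqt hq))
  have h1 : eLpNorm B 2 ν < ∞ :=
    (eLpNorm_le_eLpNorm_mul_rpow_measure_univ hq hB.aestronglyMeasurable).trans_lt
      (ENNReal.mul_lt_top h (ENNReal.rpow_lt_top_of_nonneg hexp (measure_ne_top _ _)))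
  have h2 := (eLpNorm_lt_top_iff_lintegral_rpow_enorm_lt_top (by norm_num) (by norm_num)).1 h1
  simpa using h2

/-- Functions in `X^β`, `β = (γ - 1) / 3`, are locally square integrable in time with values in
`L^ρ`, `ρ = 6 / (4 - γ)`. -/
theorem MemXTheta.lintegral_sq_lt_top {P : LittlewoodPaleyPair} {γ : ℝ} (hγ₂ : 2 < γ)
    (hγ₃ : γ < 3) {I : Set ℝ} {v : ℝ → L2} (hv : MemXTheta P ((γ - 1) / 3) 0 I v) {T : ℝ}
    (hT : Icc 0 T ⊆ I) : ∫⁻ t in Icc 0 T, eLpNorm (v t) (rhoExp γ) volume ^ 2 < ∞ := by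
  borelize L2
  obtain ⟨C, hC, hle⟩ := P.exists_eLpNorm_sq_le_besovENorm hγ₂ hγ₃
  have hvm : AEMeasurable v (volume.restrict (Icc 0 T)) :=
    ((hv.1.1.continuousOn (by linarith)).mono hT).aemeasurable measurableSet_Icc
  -- On the sharp line for θ = 0 one has 1/q = δ and 1/2 - 1/r = δ, so σ = (γ-1)/3 + δ - 3δ. As δ <
  -- 1/2 the exponent q exceeds 2.
  have hB : ∀ {δ σ : ℝ}, 0 < δ → δ < 1 / 2 → σ = (γ - 1) / 3 - 2 * δ →
      ∫⁻ t in Icc 0 T, besovENorm P σ (strichartzExp δ) (v t) ^ 2 < ∞ := fun {δ σ} h0 h1 hσ => by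
    have hadm := admissible_strichartzExp h0 h1
    refine lintegral_sq_lt_top_of_eLpNorm_lt_top
      ((P.measurable_besovENorm _ _).comp_aemeasurable hvm) hadm.1 ?_
    refine (eLpNorm_mono_measure _ (Measure.restrict_mono hT le_rfl)).trans_lt
      (hv.2 _ _ σ hadm ?_)
    rw [strichartzExp, recip_ofReal_inv h0, recip_ofReal_inv (by linarith), hσ]
    ring
  refine (lintegral_mono fun t => hle (v t)).trans_lt ?_
  have hm : AEMeasurable (fun t =>
      besovENorm P (1 / 6) (strichartzExp ((γ - 1) / 6 - 1 / 12)) (v t) ^ 2)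
      (volume.restrict (Icc 0 T)) :=
    ((P.measurable_besovENorm _ _).comp_aemeasurable hvm).pow_const 2
  rw [lintegral_const_mul' _ _ hC, lintegral_add_left' hm]
  exact ENNReal.mul_lt_top hC.lt_top (ENNReal.add_lt_top.2
    ⟨hB (by linarith) (by linarith) (by ring), hB (by linarith) (by linarith) (by ring)⟩)

theorem MemXTheta.exists_representative {P : LittlewoodPaleyPair} {γ : ℝ} (hγ₂ : 2 < γ)
    (hγ₃ : γ < 3) [Fact (1 ≤ rhoExp γ)] {I : Set ℝ} {v : ℝ → L2}
    (hv : MemXTheta P ((γ - 1) / 3) 0 I v) {T : ℝ} (hT : Icc 0 T ⊆ I) :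
    ∃ V : ℝ → Lp ℝ (rhoExp γ) (volume : Measure R3),
      AEStronglyMeasurable V (volume.restrict (Icc 0 T)) ∧
      IntegrableOn (fun t => ‖V t‖ ^ 2) (Icc 0 T) ∧
      ∀ᵐ t ∂(volume.restrict (Icc 0 T)), V t =ᵐ[volume] v t := by
  borelize L2
  let _ : MeasurableSpace (Lp ℝ (rhoExp γ) (volume : Measure R3)) := borel _
  have : BorelSpace (Lp ℝ (rhoExp γ) (volume : Measure R3)) := ⟨rfl⟩
  have : Fact (rhoExp γ ≠ ∞) := ⟨ENNReal.ofReal_ne_top⟩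
  have hlt := hv.lintegral_sq_lt_top hγ₂ hγ₃ hT
  have hvm : AEMeasurable v (volume.restrict (Icc 0 T)) :=
    ((hv.1.1.continuousOn (by linarith)).mono hT).aemeasurable measurableSet_Icc
  have hV : AEStronglyMeasurable (fun t => toLpOrZero (rhoExp γ) (v t))
      (volume.restrict (Icc 0 T)) :=
    ((measurable_toLpOrZero (p := rhoExp γ) ENNReal.ofReal_ne_top).comp_aemeasurable hvm).aestronglyMeasurable
  refine ⟨fun t => toLpOrZero (rhoExp γ) (v t), hV, ⟨hV.norm.pow 2, ?_⟩, ?_⟩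
  · refine lt_of_le_of_lt (lintegral_mono fun t => ?_) hlt
    rw [enorm_pow, enorm_norm]
    exact pow_le_pow_left' (enorm_toLpOrZero_le _ _) 2
  · have hm : AEMeasurable (fun t => eLpNorm (v t) (rhoExp γ) volume ^ 2)
        (volume.restrict (Icc 0 T)) :=
      ((measurable_eLpNorm _).comp_aemeasurable hvm).pow_const 2
    filter_upwards [ae_lt_top' hm hlt.ne] with t ht
    exact toLpOrZero_ae_eq ⟨Lp.aestronglyMeasurable _,
      (ENNReal.pow_lt_top_iff.1 ht).resolve_right two_ne_zero⟩

/-! ### The nonlinearity as a source term -/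

section Source

set_option maxSynthPendingDepth 3

variable {E X Y Z : Type*} [NormedAddCommGroup E] [NormedSpace ℝ E] [NormedAddCommGroup X]
  [NormedSpace ℝ X] [NormedAddCommGroup Y] [NormedSpace ℝ Y] [NormedAddCommGroup Z]
  [NormedSpace ℝ Z]

theorem norm_trilinear_le (T : E →L[ℝ] X →L[ℝ] Y →L[ℝ] Z) {x : E} {y : X} {z : Y} {a b c : ℝ}
    (hx : ‖x‖ ≤ a) (hy : ‖y‖ ≤ b) (hz : ‖z‖ ≤ c) : ‖T x y z‖ ≤ ‖T‖ * a * b * c :=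
  (T x y).le_of_opNorm_le_of_le ((T x).le_of_opNorm_le_of_le (T.le_of_opNorm_le_of_le le_rfl hx) hy) hz

/-- The nonlinearity as a map of an unknown `g : E` and of a perturbation `V : X`. -/
def sourceMap (T₁ : X →L[ℝ] X →L[ℝ] Y →L[ℝ] Z) (T₂ : Y →L[ℝ] X →L[ℝ] X →L[ℝ] Z)
    (A : E →L[ℝ] X) (B : E →L[ℝ] Y) (V : X) (g : E) : Z :=
  T₁ (A g + V) (A g + V) (B g) + T₂ (B g) (A g + (2 : ℝ) • V) V

variable (T₁ : X →L[ℝ] X →L[ℝ] Y →L[ℝ] Z) (T₂ : Y →L[ℝ] X →L[ℝ] X →L[ℝ] Z)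
  (A : E →L[ℝ] X) (B : E →L[ℝ] Y)

theorem sourceMap_zero (V : X) : sourceMap T₁ T₂ A B V 0 = 0 := by simp [sourceMap]

theorem continuous_sourceMap : Continuous fun p : X × E => sourceMap T₁ T₂ A B p.1 p.2 := by
  unfold sourceMap
  fun_prop

/-- Telescoping one argument at a time gives three differences from T₁ and two from T₂. R bounds
every remaining factor. The growth is quadratic in ‖V‖, which matches the square integrability of V
in time. -/
theorem norm_sourceMap_sub_le (V : X) {f g : E} {c : ℝ} (hf : ‖f‖ ≤ c) (hg : ‖g‖ ≤ c) :
    ‖sourceMap T₁ T₂ A B V f - sourceMap T₁ T₂ A B V g‖ ≤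
      (3 * ‖T₁‖ + 2 * ‖T₂‖) * (‖A‖ + ‖B‖) * ((‖A‖ + ‖B‖) * c + 2 * ‖V‖) ^ 2 * ‖f - g‖ := by
  have hc : 0 ≤ c := (norm_nonneg f).trans hf
  set a := ‖A‖ + ‖B‖ with ha
  have ha0 : 0 ≤ a := by positivity
  set R := a * c + 2 * ‖V‖ with hR
  set d := a * ‖f - g‖ with hd
  have hV : ‖V‖ ≤ R := by rw [hR]; nlinarith [norm_nonneg V, mul_nonneg ha0 hc]
  have hA : ∀ h, ‖A h‖ ≤ a * ‖h‖ := fun h => (A.le_opNorm h).trans (by gcongr; simp [ha])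
  have hB : ∀ h, ‖B h‖ ≤ a * ‖h‖ := fun h => (B.le_opNorm h).trans (by gcongr; simp [ha])
  have hAc : ∀ {h}, ‖h‖ ≤ c → ‖A h‖ ≤ a * c := fun hh => (hA _).trans (by gcongr)
  have hBc : ∀ {h}, ‖h‖ ≤ c → ‖B h‖ ≤ R := fun hh => (hB _).trans (by
    rw [hR]; nlinarith [norm_nonneg V, mul_le_mul_of_nonneg_left hh ha0])
  have hA1 : ∀ {h}, ‖h‖ ≤ c → ‖A h + V‖ ≤ R := fun hh =>
    (norm_add_le _ _).trans (by rw [hR]; linarith [hAc hh, norm_nonneg V])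
  have hA2 : ∀ {h}, ‖h‖ ≤ c → ‖A h + (2 : ℝ) • V‖ ≤ R := fun hh =>
    (norm_add_le _ _).trans (by rw [hR, norm_smul, Real.norm_ofNat]; linarith [hAc hh])
  have hAd : ‖A (f - g)‖ ≤ d := hA _
  have hBd : ‖B (f - g)‖ ≤ d := hB _
  have e : sourceMap T₁ T₂ A B V f - sourceMap T₁ T₂ A B V g
      = T₁ (A (f - g)) (A f + V) (B f) + T₁ (A g + V) (A (f - g)) (B f)
        + T₁ (A g + V) (A g + V) (B (f - g)) + T₂ (B (f - g)) (A f + (2 : ℝ) • V) V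
        + T₂ (B g) (A (f - g)) V := by
    simp only [sourceMap, map_sub, map_add, add_apply, sub_apply]
    abel
  rw [e]
  have h1 := norm_trilinear_le T₁ hAd (hA1 hf) (hBc hf)
  have h2 := norm_trilinear_le T₁ (hA1 hg) hAd (hBc hf)
  have h3 := norm_trilinear_le T₁ (hA1 hg) (hA1 hg) hBd
  have h4 := norm_trilinear_le T₂ hBd (hA2 hf) hV
  have h5 := norm_trilinear_le T₂ (hBc hg) hAd hV
  refine (norm_add_le_of_le (norm_add_le_of_le (norm_add_le_of_le (norm_add_le_of_le h1 h2) h3)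
    h4) h5).trans (le_of_eq ?_)
  rw [hd]
  ring

theorem exists_norm_sourceMap_sub_le : ∃ K a : ℝ, 0 ≤ K ∧ ∀ (V : X) (f g : E) (c : ℝ),
    ‖f‖ ≤ c → ‖g‖ ≤ c → ‖sourceMap T₁ T₂ A B V f - sourceMap T₁ T₂ A B V g‖ ≤
      K * (a * c + 2 * ‖V‖) ^ 2 * ‖f - g‖ :=
  ⟨(3 * ‖T₁‖ + 2 * ‖T₂‖) * (‖A‖ + ‖B‖), ‖A‖ + ‖B‖, by positivity,
    fun V _ _ _ hf hg => norm_sourceMap_sub_le T₁ T₂ A B V hf hg⟩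

theorem aestronglyMeasurable_sourceMap {V : ℝ → X} {ν : Measure ℝ} (hV : AEStronglyMeasurable V ν)
    {g : ℝ → E} (hg : Continuous g) :
    AEStronglyMeasurable (fun t => sourceMap T₁ T₂ A B (V t) (g t)) ν := by
  have h1 : AEStronglyMeasurable (fun t => (V t, g t)) ν := hV.prodMk hg.aestronglyMeasurable
  have h2 := continuous_sourceMap T₁ T₂ A B
  exact h2.comp_aestronglyMeasurable (f := fun t => (V t, g t)) h1

end Source

theorem integrableOn_mul_add_norm_sq {X : Type*} [NormedAddCommGroup X] {V : ℝ → X} {T : ℝ}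
    (hV : AEStronglyMeasurable V (volume.restrict (Icc 0 T)))
    (hV2 : IntegrableOn (fun t => ‖V t‖ ^ 2) (Icc 0 T)) (K c : ℝ) :
    IntegrableOn (fun t => K * (c + 2 * ‖V t‖) ^ 2) (Icc 0 T) := by
  have h1 : MemLp (fun t => ‖V t‖) 2 (volume.restrict (Icc 0 T)) :=
    (memLp_two_iff_integrable_sq hV.norm).2 hV2
  exact ((memLp_const c).add (h1.const_mul 2)).integrable_sq.const_mul K

theorem exists_lipschitzSource_sourceMap {X Y : Type*} [NormedAddCommGroup X] [NormedSpace ℝ X]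
    [NormedAddCommGroup Y] [NormedSpace ℝ Y] (T₁ : X →L[ℝ] X →L[ℝ] Y →L[ℝ] L2)
    (T₂ : Y →L[ℝ] X →L[ℝ] X →L[ℝ] L2) (A : L2 →L[ℝ] X) (B : L2 →L[ℝ] Y) {V : ℝ → X} {T : ℝ}
    (hV : AEStronglyMeasurable V (volume.restrict (Icc 0 T)))
    (hV2 : IntegrableOn (fun t => ‖V t‖ ^ 2) (Icc 0 T)) :
    ∃ w, LipschitzSource (fun t => sourceMap T₁ T₂ A B (V t)) w T := by
  obtain ⟨K, a, hK, h⟩ := exists_norm_sourceMap_sub_le T₁ T₂ A B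
  exact ⟨fun c t => K * (a * c + 2 * ‖V t‖) ^ 2, {
    zero := fun t => sourceMap_zero T₁ T₂ A B (V t)
    nonneg := fun c t => mul_nonneg hK (sq_nonneg _)
    integrableOn := fun c => integrableOn_mul_add_norm_sq hV hV2 K (a * c)
    norm_sub_le := fun c t f g hf hg => h (V t) f g c hf hg
    aestronglyMeasurable := fun g hg => aestronglyMeasurable_sourceMap T₁ T₂ A B hV hg }⟩

/-! ### Local well-posedness of the perturbed equation -/

theorem isSolution_iff {γ T : ℝ} {v : ℝ → L2} {u₀ u₁ : L2} {u : ℝ → L2} :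
    IsSolution γ T v u₀ u₁ u ↔ u 0 = u₀ ∧
      ∃ F : ℝ → L2, IntegrableOn F (Icc 0 T) volume ∧
        (∀ᵐ t ∂(volume.restrict (Icc 0 T)),
          RieszConverges γ (fun x => u t x ^ 2) ∧ RieszConverges γ (fun x => u t x * v t x) ∧
          RieszConverges γ (fun x => v t x ^ 2) ∧
          ∀ᵐ x : R3, F t x = nonlinearity γ (u t) (v t) x) ∧
        ∀ ψ : 𝓢(R3, ℝ), ∀ t ∈ Icc 0 T,
          HasDerivWithinAt (fun s => inner ℝ (u s) (bessel (bessel (helmholtz ψ))))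
            (inner ℝ u₁ (bessel (bessel (helmholtz ψ))) + ∫ τ in (0 : ℝ)..t,
              (-inner ℝ (u τ) (helmholtz ψ)
                - inner ℝ (F τ) (bessel (bessel (helmholtz ψ))))) (Icc 0 T) t := by
  unfold IsSolution
  simp only [integral_mul_eq_inner, integral_mul_laplacian_sub, bessel_bessel_helmholtz]

/-- Existence and uniqueness are both reduced to the profile in L²: Duhamel solutions are weak
solutions, and weak solutions are Duhamel solutions whose source satisfies the same Lipschitz bound.
-/
theorem exists_unique_isSolution {P : LittlewoodPaleyPair} {γ : ℝ} (hγ₂ : 2 < γ) (hγ₃ : γ < 3)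
    {I : Set ℝ} {v : ℝ → L2} (hv : MemXTheta P ((γ - 1) / 3) 0 I v) {T : ℝ} (hT : 0 < T)
    (hTI : Icc 0 T ⊆ I) {u₀ : L2} (hu₀ : sobolevENorm 1 u₀ < ∞) (u₁ : L2) :
    ∃ S, 0 < S ∧ S ≤ T ∧ ∃ u : ℝ → L2,
      (ContinuousIntoSobolev 1 (Icc 0 S) u ∧ IsSolution γ S v u₀ u₁ u) ∧
      ∀ w : ℝ → L2, ContinuousIntoSobolev 1 (Icc 0 S) w → IsSolution γ S v u₀ u₁ w →
        EqOn w u (Icc 0 S) := by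
  have h4 : 0 < 4 - γ := by linarith
  have hρ : Fact (1 ≤ rhoExp γ) := ⟨by
    rw [rhoExp, ← ENNReal.ofReal_one]
    refine ENNReal.ofReal_le_ofReal ?_
    rw [le_div_iff₀ h4]
    linarith⟩
  obtain ⟨A, hA⟩ := exists_clm_of_memLp (p := rhoExp γ) bessel
    (memLp_bessel (by rw [le_div_iff₀ h4]; linarith) (by rw [div_le_iff₀ h4]; linarith))
  obtain ⟨B, hB⟩ := exists_clm_of_memLp (p := 6) bessel memLp_six_bessel
  obtain ⟨⟨T₁, hT₁⟩, T₂, hT₂⟩ := exists_trilinear_pair hγ₂ hγ₃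
  obtain ⟨V, hVm, hV2, hVv⟩ := hv.exists_representative hγ₂ hγ₃ hTI
  obtain ⟨w', hsrc⟩ := exists_lipschitzSource_sourceMap T₁ T₂ A B hVm hV2
  obtain ⟨g₀, rfl⟩ := exists_bessel_eq hu₀
  obtain ⟨S, hS0, hST, g, hg, F, hF, hFg, hgm⟩ := hsrc.exists_mild hT g₀ u₁
  have hVS := ae_restrict_of_ae_restrict_of_subset (Icc_subset_Icc_right hST) hVv
  -- The exceptional times depend on v alone, so one null set serves for all profiles h, in
  -- particular for the solution and for any competitor.
  have hnl : ∀ᵐ t ∂(volume.restrict (Icc 0 S)), ∀ h : L2,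
      RieszConverges γ (fun x => bessel h x ^ 2) ∧ RieszConverges γ (fun x => bessel h x * v t x) ∧
      RieszConverges γ (fun x => v t x ^ 2) ∧
      ∀ᵐ x : R3, sourceMap T₁ T₂ A B (V t) h x = nonlinearity γ (bessel h) (v t) x := by
    filter_upwards [hVS] with t ht h
    exact nonlinearity_ae_eq hT₁ hT₂ (hA h) (hB h) ht
  have hFm : ∀ᵐ t ∂(volume.restrict (Icc 0 S)),
      F t = sourceMap T₁ T₂ A B (V t) (mild g₀ u₁ F t) := by
    filter_upwards [ae_restrict_mem measurableSet_Icc] with t ht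
    rw [← hgm t ht, hFg, indicator_of_mem ht]
  have hmc := continuous_mild g₀ u₁ hF
  refine ⟨S, hS0, hST, fun t => bessel (mild g₀ u₁ F t),
    ⟨continuousIntoSobolev_one_bessel hmc.continuousOn, ?_⟩, fun w hw hws => ?_⟩
  · refine isSolution_iff.2 ⟨by rw [mild_zero], F, hF.integrableOn, ?_, fun ψ t ht =>
      (hasDerivWithinAt_inner_mild hF (helmholtz ψ) ht.1).mono Icc_subset_Ici_self⟩
    filter_upwards [hnl, hFm] with t h1 h2
    obtain ⟨k1, k2, k3, k4⟩ := h1 (mild g₀ u₁ F t)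
    refine ⟨k1, k2, k3, ?_⟩
    rw [h2]
    exact k4
  · obtain ⟨f, hf, hwf⟩ := hw.exists_bessel_eq
    obtain ⟨hw0, G, hG, hGn, hGw⟩ := isSolution_iff.1 hws
    have h0S : (0 : ℝ) ∈ Icc 0 S := ⟨le_rfl, hS0.le⟩
    have hGi : Integrable ((Icc 0 S).indicator G) :=
      (integrable_indicator_iff measurableSet_Icc).2 hG
    have hf0 : f 0 = g₀ := by
      refine sub_eq_zero.1 (eq_zero_of_bessel_eq_zero ?_)
      rw [map_sub, ← hwf 0 h0S, hw0, sub_self]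
    have hfm := eq_mild_of_weak (u₁ := u₁) hGi hf hf0 fun ψ t ht => by
      have hsub : uIcc 0 t ⊆ Icc 0 S := by
        rw [uIcc_of_le ht.1]
        exact Icc_subset_Icc_right ht.2
      have hint : ∫ τ in (0 : ℝ)..t, (-inner ℝ (bessel (f τ)) (helmholtz ψ)
          - inner ℝ ((Icc 0 S).indicator G τ) (bessel (bessel (helmholtz ψ))))
          = ∫ τ in (0 : ℝ)..t, (-inner ℝ (w τ) (helmholtz ψ)
          - inner ℝ (G τ) (bessel (bessel (helmholtz ψ)))) :=
        intervalIntegral.integral_congr fun τ hτ => by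
          simp only [indicator_of_mem (hsub hτ), hwf τ (hsub hτ)]
      rw [hint]
      exact (hGw ψ t ht).congr (fun s hs => by rw [hwf s hs]) (by rw [hwf t ht])
    -- The source of the competitor agrees pointwise with the nonlinearity, hence in L² with the
    -- source map at its profile. This brings it within reach of Gronwall.
    have hGf : ∀ᵐ t ∂(volume.restrict (Icc 0 S)),
        (Icc 0 S).indicator G t = sourceMap T₁ T₂ A B (V t) (f t) := by
      filter_upwards [hnl, hGn, ae_restrict_mem measurableSet_Icc] with t h1 h2 ht
      rw [indicator_of_mem ht]
      refine Lp.ext ?_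
      filter_upwards [(h1 (f t)).2.2.2, h2.2.2.2] with x e1 e2
      rw [e1, e2, hwf t ht]
    have hfg := (hsrc.mono hST).eqOn_of_mild hGi hF hf hmc.continuousOn hfm (fun t _ => rfl) hGf hFm
    intro t ht
    rw [hwf t ht, hfg ht]

end

end KleinGordonHartree

open KleinGordonHartree
theorem proposition4p1 (P : LittlewoodPaleyPair) (γ : ℝ) (hγ₂ : 2 < γ) (hγ₃ : γ < 3)
    (I : Set ℝ) (hI : I.OrdConnected) (h0 : 0 ∈ I) (hpos : ∃ t ∈ I, 0 < t)
    (v : ℝ → L2) (hvα : MemX P ((2 * γ - 4) / 3) I v) (hvβ : MemX P ((γ - 1) / 3) I v)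
    (u₀ u₁ : L2) (hu₀ : sobolevENorm 1 u₀ < ∞) :
    ∃ T : ℝ, 0 < T ∧ Icc 0 T ⊆ I ∧
      ∃ u : ℝ → L2,
        (ContinuousIntoSobolev 1 (Icc 0 T) u ∧ IsSolution γ T v u₀ u₁ u) ∧
        ∀ w : ℝ → L2, ContinuousIntoSobolev 1 (Icc 0 T) w → IsSolution γ T v u₀ u₁ w →
          EqOn w u (Icc 0 T) := by
  obtain ⟨T, hTI, hT⟩ := hpos
  have hsub : Icc 0 T ⊆ I := hI.out h0 hTI
  -- The value θ = 0 provides the admissible pairs with 1/q + 1/r = 1/2.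
  obtain ⟨S, hS0, hST, h⟩ := exists_unique_isSolution hγ₂ hγ₃
    (hvβ 0 le_rfl zero_le_one) hT hsub hu₀ u₁
  exact ⟨S, hS0, (Icc_subset_Icc_right hST).trans hsub, h⟩
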